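/- Let $(\mathtt C,\otimes,\mathbb 1,\tau)$ be an additive symmetric monoidal category with $\otimes$ additive in each variable, having coequalizers and countable coproducts that are preserved by every functor $X\otimes-$. Let $\Sigma$ be an invertible object (there are $\Sigma^-$ and an isomorphism $\Sigma^-\otimes\Sigma\cong\mathbb 1$), and write $\Sigma X=\Sigma\otimes X$. Let $(A,\mu)$ be an associative monoid in $\mathtt C$ (no unit required). For an $A$-bimodule $M$ with actions ${}_A\mu,\mu_A$, let $T_A(M)=A\oplus\bigoplus_{n\ge1}M^{\otimes_A n}$ be the free $A$-algebra with the concatenation product. Associativity isomorphisms are suppressed. For objects $X,Y$, $\Sigma X\otimes Y$ carries external actions (on the left of $X$ and on the right of $Y$) and internal actions (on the right of $X$ and on the left of $Y$), objects being moved past each other by $\tau$. *Double Poisson brackets.* A $\Sigma$-double Poisson bracket on an associative monoid $B$ is a morphism $f:\Sigma B\otimes\Sigma B\to\Sigma B\otimes B$ such that: (antisymmetry) $f=-(\Sigma\tau_{B,B})\,f\,\tau_{\Sigma B,\Sigma B}$; (derivation) $f$ is a derivation in its first variable for the internal $B$-bimodule structure of $\Sigma B\otimes B$; (double Jacobi)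 with $f_l=(f\otimes B)(\Sigma B\otimes f)$, $$f_l+\Sigma\tau_{B,B\otimes B}\,f_l\,\tau_{\Sigma B\otimes\Sigma B,\Sigma B}+\Sigma\tau_{B\otimes B,B}\,f_l\,\tau_{\Sigma B,\Sigma B\otimes\Sigma B}=0.$$ A $\Sigma$-double bracket $f$ on $T_A(M)$ is linear, with restrictions $(\rho,b)$, if it vanishes on $\Sigma A\otimes\Sigma A$ and its restrictions to $\Sigma M\otimes\Sigma A$ and $\Sigma M\otimes\Sigma M$ are given by morphisms $$\rho:\Sigma M\otimes\Sigma A\to\Sigma A\otimes A,\qquad b:\Sigma M\otimes\Sigma M\to\Sigma(M\otimes A\oplus A\otimes M).$$ $\Sigma\text{-}\mathtt{DPFree}^{lin}_A$ is the category whose objects are the free $A$-algebras $T_A(M)$ with a linear $\Sigma$-double Poisson bracket and whose morphisms are the monoid morphisms $\psi:T_A(M)\to T_A(N)$ of the form $T_A(\varphi)$, $\varphi$ a bimodule morphism, such that $(\Sigma\psi\otimes\psi)f_M=f_N(\Sigma\psi\otimes\Sigma\psi)$. *Double Lie–Rinehart algebras.* A $\Sigma$-double Lie–Rinehart structure on $M$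 is a pair $(\rho,b)$ of morphisms as above, with components $b_l$ in $\Sigma M\otimes A$ and $b_r$ in $\Sigma A\otimes M$ of $b$, such that, with $\rho_\tau=-(\Sigma\tau_{A,A})\rho\,\tau_{\Sigma A,\Sigma M}$: 1. the anchor $\rho$ is a morphism of $A$-bimodules from $\Sigma M\otimes\Sigma A$ (structure induced by that of $M$) to $\Sigma A\otimes A$ (internal structure), and is a derivation in its second input for the external structure of $\Sigma A\otimes A$; 2. $b\,\tau_{\Sigma M,\Sigma M}=-\Sigma(\tau_{M,A},\tau_{A,M})\,b$; 3. $b(\Sigma M\otimes\Sigma{}_A\mu)=\phi^l$ and $b(\Sigma M\otimes\Sigma\mu_A)=\phi^r$, where, on $\Sigma M\otimes\Sigma A\otimes M$ and on $\Sigma M\otimes\Sigma M\otimes A$ respectively, $$\phi^l=(\Sigma A\otimes{}_A\mu)(\rho\otimes M)+({}_A\mu^{\Sigma M}\otimes A,\ {}_A\mu^{\Sigma A}\otimes M)(A\otimes b)(\tau_{\Sigma M\otimes\Sigma,A}\otimes M),$$ $$\phi^r=(\Sigma M\otimes\mu,\ \Sigma A\otimes\mu_A)(b\otimes A)+(\Sigma\mu_A\otimes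 A)(\tau_{M,\Sigma}\otimes A\otimes A)(M\otimes\rho)(\tau_{\Sigma M\otimes\Sigma,M}\otimes A);$$ 4. on $\Sigma A\otimes\Sigma M\otimes\Sigma M$, with values in $\Sigma A\otimes A\otimes A$: $(\rho_\tau\otimes A)(\Sigma A\otimes b_l)+\Sigma\tau_{A\otimes A,A}(\rho\otimes A)(\Sigma M\otimes\rho)\tau_{\Sigma A,\Sigma M\otimes\Sigma M}+\Sigma\tau_{A,A\otimes A}(\rho\otimes A)(\Sigma M\otimes\rho_\tau)\tau_{\Sigma A\otimes\Sigma M,\Sigma M}=0$; 5. on $(\Sigma M)^{\otimes3}$, with values in $\Sigma M\otimes A\otimes A$: $(b_l\otimes A)(\Sigma M\otimes b_l)+\Sigma\tau_{A,M\otimes A}(b_r\otimes A)(\Sigma M\otimes b_l)\tau_{\Sigma M\otimes\Sigma M,\Sigma M}+\Sigma\tau_{A\otimes A,M}(\rho\otimes M)(\Sigma M\otimes b_r)\tau_{\Sigma M,\Sigma M\otimes\Sigma M}=0$. $\Sigma\text{-}\mathtt{DLR}_A$ is the category of $A$-bimodules with such a structure; its morphisms are the bimodule morphisms $\varphi:M\to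 N$ that commute with the brackets, $\Sigma(\varphi\otimes A\oplus A\otimes\varphi)\,b_M=b_N(\Sigma\varphi\otimes\Sigma\varphi)$, and with the anchors, $\rho_N(\Sigma\varphi\otimes\Sigma A)=\rho_M$. **Proposition.** (a) For every $A$-bimodule $M$ and all morphisms $\rho$, $b$ as above, $(\rho,b)$ is a $\Sigma$-double Lie–Rinehart structure on $M$ if and only if there is a linear $\Sigma$-double Poisson bracket on $T_A(M)$ with restrictions $(\rho,b)$; such a bracket is then unique. (b) Restriction of brackets, $(T_A(M),f)\mapsto(M,\rho,b)$, $T_A(\varphi)\mapsto\varphi$, is an equivalence of categories $$\Sigma\text{-}\mathtt{DPFree}^{lin}_A\simeq\Sigma\text{-}\mathtt{DLR}_A.$$ (c) If $A$ has a unit, the equivalence in (b) restricts to an equivalence between the full subcategories of those objects whose bimodule $M$ is unital. -/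

import Mathlib

open CategoryTheory CategoryTheory.Limits CategoryTheory.MonoidalCategory

universe v u

namespace DoubleLR

section Objects

variable {C : Type u} [Category.{v} C] [MonoidalCategory C]

variable (C) in
/-- An associative monoid `(A, μ)` in a monoidal category. No unit is required. -/
structure AssocMon where
  X : C
  mul : X ⊗ X ⟶ X
  assoc : mul ▷ X ≫ mul = (α_ X X X).hom ≫ X ◁ mul ≫ mul

/-- Morphisms of associative monoids. -/
def AssocMon.IsHom (A B : AssocMon C) (φ : A.X ⟶ B.X) : Prop :=
  A.mul ≫ φ = (φ ⊗ₘ φ) ≫ B.mul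

theorem AssocMon.isHom_id (A : AssocMon C) : AssocMon.IsHom A A (𝟙 A.X) := by
  simp [AssocMon.IsHom]

theorem AssocMon.IsHom.comp {A B D : AssocMon C} {φ : A.X ⟶ B.X} {ψ : B.X ⟶ D.X}
    (hφ : A.IsHom B φ) (hψ : B.IsHom D ψ) : A.IsHom D (φ ≫ ψ) := by
  unfold AssocMon.IsHom at *
  rw [← Category.assoc, hφ, Category.assoc, hψ, ← Category.assoc, tensorHom_comp_tensorHom]

/-- `η` is a two-sided unit of the associative monoid `A`. -/
structure AssocMon.IsUnit (A : AssocMon C) (η : 𝟙_ C ⟶ A.X) : Prop where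
  one_mul : η ▷ A.X ≫ A.mul = (λ_ A.X).hom
  mul_one : A.X ◁ η ≫ A.mul = (ρ_ A.X).hom

/-- A left module over an associative monoid. -/
structure LeftMod (A : AssocMon C) where
  X : C
  act : A.X ⊗ X ⟶ X
  assoc : A.mul ▷ X ≫ act = (α_ A.X A.X X).hom ≫ A.X ◁ act ≫ act

/-- An `A`-bimodule. -/
structure ABimod (A : AssocMon C) where
  X : C
  actL : A.X ⊗ X ⟶ X
  actR : X ⊗ A.X ⟶ X
  assocL : A.mul ▷ X ≫ actL = (α_ A.X A.X X).hom ≫ A.X ◁ actL ≫ actL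
  assocR : actR ▷ A.X ≫ actR = (α_ X A.X A.X).hom ≫ X ◁ A.mul ≫ actR
  assocM : actL ▷ A.X ≫ actR = (α_ A.X X A.X).hom ≫ A.X ◁ actR ≫ actL

/-- The bimodule `M` is unital for the unit `η` of `A`. -/
structure ABimod.IsUnital {A : AssocMon C} (M : ABimod A) (η : 𝟙_ C ⟶ A.X) : Prop where
  one_actL : η ▷ M.X ≫ M.actL = (λ_ M.X).hom
  actR_one : M.X ◁ η ≫ M.actR = (ρ_ M.X).hom

/-- Morphisms of `A`-bimodules. -/
@[ext]
structure ABimod.Hom {A : AssocMon C} (M N : ABimod A) where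
  hom : M.X ⟶ N.X
  left : M.actL ≫ hom = A.X ◁ hom ≫ N.actL
  right : M.actR ≫ hom = hom ▷ A.X ≫ N.actR

instance (A : AssocMon C) : Category (ABimod A) where
  Hom := ABimod.Hom
  id M := ⟨𝟙 M.X, by simp, by simp⟩
  comp f g := ⟨f.hom ≫ g.hom, by
      rw [← Category.assoc, f.left, Category.assoc, g.left]; simp, by
      rw [← Category.assoc, f.right, Category.assoc, g.right]; simp⟩
  id_comp f := ABimod.Hom.ext (Category.id_comp _)
  comp_id f := ABimod.Hom.ext (Category.comp_id _)
  assoc f g h := ABimod.Hom.ext (Category.assoc _ _ _)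

/-- The monoid `A` as a left module over itself. -/
def AssocMon.regular (A : AssocMon C) : LeftMod A := ⟨A.X, A.mul, A.assoc⟩

/-- The left module underlying a bimodule. -/
def ABimod.toLeft {A : AssocMon C} (M : ABimod A) : LeftMod A := ⟨M.X, M.actL, M.assocL⟩

end Objects

section Colimits

set_option linter.unusedSectionVars false

variable {C : Type u} [Category.{v} C] [MonoidalCategory C] [SymmetricCategory C]

instance preservesRight {J : Type} [SmallCategory J]
    [∀ X : C, PreservesColimitsOfShape J (tensorLeft X)]
    (X : C) : PreservesColimitsOfShape J (tensorRight X) :=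
  preservesColimitsOfShape_of_natIso (BraidedCategory.tensorLeftIsoTensorRight X)

section Coeq

variable [HasCoequalizers C]
  [∀ X : C, PreservesColimitsOfShape WalkingParallelPair (tensorLeft X)]
variable {P Q W : C} (f g : P ⟶ Q) (Z : C)

/-- The morphism `Z ⊗ coeq(f, g) ⟶ W` induced by a morphism `Z ⊗ Q ⟶ W`. -/
noncomputable def coeqDescL (h : Z ⊗ Q ⟶ W) (w : Z ◁ f ≫ h = Z ◁ g ≫ h) :
    Z ⊗ coequalizer f g ⟶ W :=
  (PreservesCoequalizer.iso (tensorLeft Z) f g).inv ≫ coequalizer.desc h w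

@[simp]
theorem coeqDescL_fac (h : Z ⊗ Q ⟶ W) (w : Z ◁ f ≫ h = Z ◁ g ≫ h) :
    Z ◁ coequalizer.π f g ≫ coeqDescL f g Z h w = h :=
  map_π_preserves_coequalizer_inv_desc (tensorLeft Z) f g h w

@[simp]
theorem coeqDescL_fac_assoc (h : Z ⊗ Q ⟶ W) (w : Z ◁ f ≫ h = Z ◁ g ≫ h) {W' : C} (k : W ⟶ W') :
    Z ◁ coequalizer.π f g ≫ coeqDescL f g Z h w ≫ k = h ≫ k := by
  rw [← Category.assoc, coeqDescL_fac]

/-- The morphism `coeq(f, g) ⊗ Z ⟶ W` induced by a morphism `Q ⊗ Z ⟶ W`. -/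
noncomputable def coeqDescR (h : Q ⊗ Z ⟶ W) (w : f ▷ Z ≫ h = g ▷ Z ≫ h) :
    coequalizer f g ⊗ Z ⟶ W :=
  (PreservesCoequalizer.iso (tensorRight Z) f g).inv ≫ coequalizer.desc h w

@[simp]
theorem coeqDescR_fac (h : Q ⊗ Z ⟶ W) (w : f ▷ Z ≫ h = g ▷ Z ≫ h) :
    coequalizer.π f g ▷ Z ≫ coeqDescR f g Z h w = h :=
  map_π_preserves_coequalizer_inv_desc (tensorRight Z) f g h w

@[simp]
theorem coeqDescR_fac_assoc (h : Q ⊗ Z ⟶ W) (w : f ▷ Z ≫ h = g ▷ Z ≫ h) {W' : C} (k : W ⟶ W') :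
    coequalizer.π f g ▷ Z ≫ coeqDescR f g Z h w ≫ k = h ≫ k := by
  rw [← Category.assoc, coeqDescR_fac]

instance epi_whiskerLeft_π : Epi (Z ◁ coequalizer.π f g) :=
  inferInstanceAs (Epi ((tensorLeft Z).map (coequalizer.π f g)))

instance epi_whiskerRight_π : Epi (coequalizer.π f g ▷ Z) :=
  inferInstanceAs (Epi ((tensorRight Z).map (coequalizer.π f g)))

end Coeq

section Coprod

variable [HasCoproductsOfShape ℕ C]
  [∀ X : C, PreservesColimitsOfShape (Discrete ℕ) (tensorLeft X)]
variable (F : ℕ → C) (Z : C) {W : C}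

/-- The morphism `Z ⊗ ∐ F ⟶ W` with given components. -/
noncomputable def sigmaDescL (h : ∀ n, Z ⊗ F n ⟶ W) : Z ⊗ (∐ F) ⟶ W :=
  (PreservesCoproduct.iso (tensorLeft Z) F).hom ≫ Sigma.desc h

@[simp]
theorem sigmaDescL_fac (h : ∀ n, Z ⊗ F n ⟶ W) (n : ℕ) :
    Z ◁ Sigma.ι F n ≫ sigmaDescL F Z h = h n := by
  have h1 : Sigma.ι (fun n => (tensorLeft Z).obj (F n)) n ≫
      (PreservesCoproduct.iso (tensorLeft Z) F).inv = (tensorLeft Z).map (Sigma.ι F n) := by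
    rw [PreservesCoproduct.inv_hom]; exact ι_comp_sigmaComparison _ _ _
  have h2 : Z ◁ Sigma.ι F n = (tensorLeft Z).map (Sigma.ι F n) := rfl
  rw [h2, ← h1, sigmaDescL, Category.assoc, Iso.inv_hom_id_assoc]
  exact Sigma.ι_desc _ _

@[simp]
theorem sigmaDescL_fac_assoc (h : ∀ n, Z ⊗ F n ⟶ W) (n : ℕ) {W' : C} (k : W ⟶ W') :
    Z ◁ Sigma.ι F n ≫ sigmaDescL F Z h ≫ k = h n ≫ k := by
  rw [← Category.assoc, sigmaDescL_fac]

theorem sigma_hom_extL {p q : Z ⊗ (∐ F) ⟶ W}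
    (h : ∀ n, Z ◁ Sigma.ι F n ≫ p = Z ◁ Sigma.ι F n ≫ q) : p = q := by
  have h1 : ∀ n, Sigma.ι (fun n => (tensorLeft Z).obj (F n)) n ≫
      (PreservesCoproduct.iso (tensorLeft Z) F).inv = (tensorLeft Z).map (Sigma.ι F n) := by
    intro n
    rw [PreservesCoproduct.inv_hom]; exact ι_comp_sigmaComparison _ _ _
  rw [← cancel_epi (PreservesCoproduct.iso (tensorLeft Z) F).inv]
  refine Sigma.hom_ext _ _ fun n => ?_
  rw [← Category.assoc, ← Category.assoc, h1]
  exact h n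

/-- The morphism `(∐ F) ⊗ Z ⟶ W` with given components. -/
noncomputable def sigmaDescR (h : ∀ n, F n ⊗ Z ⟶ W) : (∐ F) ⊗ Z ⟶ W :=
  (PreservesCoproduct.iso (tensorRight Z) F).hom ≫ Sigma.desc h

@[simp]
theorem sigmaDescR_fac (h : ∀ n, F n ⊗ Z ⟶ W) (n : ℕ) :
    Sigma.ι F n ▷ Z ≫ sigmaDescR F Z h = h n := by
  have h1 : Sigma.ι (fun n => (tensorRight Z).obj (F n)) n ≫
      (PreservesCoproduct.iso (tensorRight Z) F).inv = (tensorRight Z).map (Sigma.ι F n) := by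
    rw [PreservesCoproduct.inv_hom]; exact ι_comp_sigmaComparison _ _ _
  have h2 : Sigma.ι F n ▷ Z = (tensorRight Z).map (Sigma.ι F n) := rfl
  rw [h2, ← h1, sigmaDescR, Category.assoc, Iso.inv_hom_id_assoc]
  exact Sigma.ι_desc _ _

@[simp]
theorem sigmaDescR_fac_assoc (h : ∀ n, F n ⊗ Z ⟶ W) (n : ℕ) {W' : C} (k : W ⟶ W') :
    Sigma.ι F n ▷ Z ≫ sigmaDescR F Z h ≫ k = h n ≫ k := by
  rw [← Category.assoc, sigmaDescR_fac]

theorem sigma_hom_extR {p q : (∐ F) ⊗ Z ⟶ W}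
    (h : ∀ n, Sigma.ι F n ▷ Z ≫ p = Sigma.ι F n ▷ Z ≫ q) : p = q := by
  have h1 : ∀ n, Sigma.ι (fun n => (tensorRight Z).obj (F n)) n ≫
      (PreservesCoproduct.iso (tensorRight Z) F).inv = (tensorRight Z).map (Sigma.ι F n) := by
    intro n
    rw [PreservesCoproduct.inv_hom]; exact ι_comp_sigmaComparison _ _ _
  rw [← cancel_epi (PreservesCoproduct.iso (tensorRight Z) F).inv]
  refine Sigma.hom_ext _ _ fun n => ?_
  rw [← Category.assoc, ← Category.assoc, h1]
  exact h n

end Coprod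

end Colimits

section FreeAlgebra

set_option linter.unusedSectionVars false

variable {C : Type u} [Category.{v} C] [MonoidalCategory C] [SymmetricCategory C]
  [HasCoequalizers C] [∀ X : C, PreservesColimitsOfShape WalkingParallelPair (tensorLeft X)]

variable {A : AssocMon C}

/-- The underlying object of `M ⊗_A L` for a bimodule `M` and a left module `L`: the coequalizer of
the two morphisms `(M ⊗ A) ⊗ L ⟶ M ⊗ L` given by the two actions of `A`. -/
noncomputable abbrev tensorOverX (M : ABimod A) (L : LeftMod A) : C :=
  coequalizer (M.actR ▷ L.X) ((α_ M.X A.X L.X).hom ≫ M.X ◁ L.act)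

/-- The projection `M ⊗ L ⟶ M ⊗_A L`. -/
noncomputable abbrev tensorOverπ (M : ABimod A) (L : LeftMod A) : M.X ⊗ L.X ⟶ tensorOverX M L :=
  coequalizer.π _ _

theorem tensorOver_condition (M : ABimod A) (L : LeftMod A) :
    M.actR ▷ L.X ≫ tensorOverπ M L = (α_ M.X A.X L.X).hom ≫ M.X ◁ L.act ≫ tensorOverπ M L := by
  rw [coequalizer.condition, Category.assoc]

/-- The tensor product `M ⊗_A L`, with `A` acting on `M`. -/
noncomputable def tensorOver (M : ABimod A) (L : LeftMod A) : LeftMod A where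
  X := tensorOverX M L
  act := coeqDescL _ _ A.X ((α_ A.X M.X L.X).inv ≫ M.actL ▷ L.X ≫ tensorOverπ M L) (by
    have e : A.X ◁ M.actR ≫ M.actL = (α_ A.X M.X A.X).inv ≫ M.actL ▷ A.X ≫ M.actR := by
      rw [M.assocM, Iso.inv_hom_id_assoc]
    calc A.X ◁ (M.actR ▷ L.X) ≫ (α_ A.X M.X L.X).inv ≫ M.actL ▷ L.X ≫ tensorOverπ M L
        = (α_ A.X (M.X ⊗ A.X) L.X).inv ≫ (A.X ◁ M.actR ≫ M.actL) ▷ L.X ≫ tensorOverπ M L := by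
          monoidal
      _ = (α_ A.X (M.X ⊗ A.X) L.X).inv ≫ (α_ A.X M.X A.X).inv ▷ L.X ≫ M.actL ▷ A.X ▷ L.X ≫
            M.actR ▷ L.X ≫ tensorOverπ M L := by
          rw [e]; monoidal
      _ = (A.X ◁ (α_ M.X A.X L.X).hom) ≫ (α_ A.X M.X (A.X ⊗ L.X)).inv ≫
            (M.actL ▷ (A.X ⊗ L.X) ≫ M.X ◁ L.act) ≫ tensorOverπ M L := by
          rw [tensorOver_condition]; monoidal
      _ = _ := by
          rw [← whisker_exchange]; monoidal)
  assoc := by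
    rw [← cancel_epi ((A.X ⊗ A.X) ◁ tensorOverπ M L), whisker_exchange_assoc]
    erw [coeqDescL_fac]
    have h : (A.X ⊗ A.X) ◁ tensorOverπ M L ≫ (α_ A.X A.X (tensorOverX M L)).hom =
        (α_ _ _ _).hom ≫ A.X ◁ A.X ◁ tensorOverπ M L := by monoidal
    rw [reassoc_of% h, ← whiskerLeft_comp_assoc]
    erw [coeqDescL_fac]
    rw [whiskerLeft_comp, whiskerLeft_comp]
    simp only [Category.assoc]
    erw [coeqDescL_fac]
    have h2 := congrArg (· ▷ L.X) M.assocL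
    simp only [comp_whiskerRight] at h2
    calc A.mul ▷ (M.X ⊗ L.X) ≫ (α_ A.X M.X L.X).inv ≫ M.actL ▷ L.X ≫ tensorOverπ M L
        = (α_ (A.X ⊗ A.X) M.X L.X).inv ≫ (A.mul ▷ M.X ▷ L.X ≫ M.actL ▷ L.X) ≫
            tensorOverπ M L := by monoidal
      _ = _ := by rw [h2]; monoidal

theorem tensorOver_act (M : ABimod A) (L : LeftMod A) :
    A.X ◁ tensorOverπ M L ≫ (tensorOver M L).act =
      (α_ A.X M.X L.X).inv ≫ M.actL ▷ L.X ≫ tensorOverπ M L :=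
  coeqDescL_fac _ _ _ _ _

/-- The tensor power `M ⊗_A ⋯ ⊗_A M` with `n + 1` factors. -/
noncomputable def tpow (M : ABimod A) : ℕ → LeftMod A
  | 0 => M.toLeft
  | n + 1 => tensorOver M (tpow M n)

/-- The projection from `M ⊗ (M ⊗_A ⋯ ⊗_A M)` (with `n + 1` factors in the parenthesis) to the next
tensor power. -/
noncomputable def step (M : ABimod A) (n : ℕ) : M.X ⊗ (tpow M n).X ⟶ (tpow M (n + 1)).X :=
  tensorOverπ M (tpow M n)

theorem step_balanced (M : ABimod A) (n : ℕ) :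
    M.actR ▷ (tpow M n).X ≫ step M n =
      (α_ M.X A.X (tpow M n).X).hom ≫ M.X ◁ (tpow M n).act ≫ step M n :=
  tensorOver_condition M (tpow M n)

theorem step_act (M : ABimod A) (n : ℕ) :
    A.X ◁ step M n ≫ (tpow M (n + 1)).act =
      (α_ A.X M.X (tpow M n).X).inv ≫ M.actL ▷ (tpow M n).X ≫ step M n :=
  tensorOver_act M (tpow M n)

instance epi_step (M : ABimod A) (n : ℕ) : Epi (step M n) :=
  inferInstanceAs (Epi (coequalizer.π _ _))

instance epi_whiskerLeft_step (M : ABimod A) (n : ℕ) (Z : C) : Epi (Z ◁ step M n) :=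
  epi_whiskerLeft_π _ _ _

instance epi_step_whiskerRight (M : ABimod A) (n : ℕ) (Z : C) : Epi (step M n ▷ Z) :=
  epi_whiskerRight_π _ _ _

instance epi_step_whisker (M : ABimod A) (n : ℕ) (Z Z' : C) : Epi ((Z ◁ step M n) ▷ Z') :=
  inferInstanceAs (Epi ((tensorLeft Z ⋙ tensorRight Z').map (coequalizer.π _ _)))

/-- Descent of a balanced morphism to the next tensor power. -/
noncomputable def stepDesc (M : ABimod A) (n : ℕ) {W : C} (h : M.X ⊗ (tpow M n).X ⟶ W)
    (w : M.actR ▷ (tpow M n).X ≫ h =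
      (α_ M.X A.X (tpow M n).X).hom ≫ M.X ◁ (tpow M n).act ≫ h) :
    (tpow M (n + 1)).X ⟶ W :=
  coequalizer.desc h (by rw [w, Category.assoc])

theorem stepDesc_fac (M : ABimod A) (n : ℕ) {W : C} (h : M.X ⊗ (tpow M n).X ⟶ W)
    (w : M.actR ▷ (tpow M n).X ≫ h =
      (α_ M.X A.X (tpow M n).X).hom ≫ M.X ◁ (tpow M n).act ≫ h) :
    step M n ≫ stepDesc M n h w = h :=
  coequalizer.π_desc _ _

/-- Descent of a balanced morphism to the next tensor power, tensored with an object `Z`. -/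
noncomputable def stepDescR (M : ABimod A) (n : ℕ) (Z : C) {W : C}
    (h : (M.X ⊗ (tpow M n).X) ⊗ Z ⟶ W)
    (w : M.actR ▷ (tpow M n).X ▷ Z ≫ h =
      ((α_ M.X A.X (tpow M n).X).hom ≫ M.X ◁ (tpow M n).act) ▷ Z ≫ h) :
    (tpow M (n + 1)).X ⊗ Z ⟶ W :=
  coeqDescR _ _ Z h w

theorem stepDescR_fac (M : ABimod A) (n : ℕ) (Z : C) {W : C}
    (h : (M.X ⊗ (tpow M n).X) ⊗ Z ⟶ W)
    (w : M.actR ▷ (tpow M n).X ▷ Z ≫ h =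
      ((α_ M.X A.X (tpow M n).X).hom ≫ M.X ◁ (tpow M n).act) ▷ Z ≫ h) :
    step M n ▷ Z ≫ stepDescR M n Z h w = h :=
  coeqDescR_fac _ _ _ _ _

/-- The homogeneous components of the free algebra: `A` in degree `0` and `M ⊗_A ⋯ ⊗_A M` with `n`
factors in degree `n ≥ 1`. -/
noncomputable def piece (M : ABimod A) : ℕ → C
  | 0 => A.X
  | n + 1 => (tpow M n).X

variable [HasCoproductsOfShape ℕ C]

/-- The underlying object of `T_A(M) = A ⊕ ⨁_{n ≥ 1} M ⊗_A ⋯ ⊗_A M`. -/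
noncomputable def TX (M : ABimod A) : C := ∐ piece M

/-- The inclusion `A ⟶ T_A(M)`. -/
noncomputable def iA (M : ABimod A) : A.X ⟶ TX M := Sigma.ι (piece M) 0

/-- The inclusion into `T_A(M)` of the tensor power with `n + 1` factors. -/
noncomputable def iP (M : ABimod A) (n : ℕ) : (tpow M n).X ⟶ TX M := Sigma.ι (piece M) (n + 1)

/-- The inclusion `M ⟶ T_A(M)`. -/
noncomputable def iM (M : ABimod A) : M.X ⟶ TX M := iP M 0

theorem T_ext (M : ABimod A) {W : C} {p q : TX M ⟶ W}
    (hA : iA M ≫ p = iA M ≫ q) (hP : ∀ n, iP M n ≫ p = iP M n ≫ q) : p = q := by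
  refine Sigma.hom_ext _ _ fun n => ?_
  cases n with
  | zero => exact hA
  | succ n => exact hP n

/-- The components of a family of morphisms out of the homogeneous components. -/
noncomputable def comps (M : ABimod A) {W : C} (F : C ⥤ C) (hA : F.obj A.X ⟶ W)
    (hP : ∀ n, F.obj (tpow M n).X ⟶ W) : ∀ n, F.obj (piece M n) ⟶ W
  | 0 => hA
  | n + 1 => hP n

/-- The morphism out of `T_A(M)` with given components. -/
noncomputable def Tdesc (M : ABimod A) {W : C} (hA : A.X ⟶ W)
    (hP : ∀ n, (tpow M n).X ⟶ W) : TX M ⟶ W :=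
  Sigma.desc (comps M (𝟭 C) hA hP)

theorem iA_Tdesc (M : ABimod A) {W : C} (hA : A.X ⟶ W)
    (hP : ∀ n, (tpow M n).X ⟶ W) : iA M ≫ Tdesc M hA hP = hA :=
  Sigma.ι_desc (comps M (𝟭 C) hA hP) 0

theorem iP_Tdesc (M : ABimod A) {W : C} (hA : A.X ⟶ W)
    (hP : ∀ n, (tpow M n).X ⟶ W) (n : ℕ) : iP M n ≫ Tdesc M hA hP = hP n :=
  Sigma.ι_desc (comps M (𝟭 C) hA hP) (n + 1)

variable [∀ X : C, PreservesColimitsOfShape (Discrete ℕ) (tensorLeft X)]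

theorem T_extL (M : ABimod A) (Z : C) {W : C} {p q : Z ⊗ TX M ⟶ W}
    (hA : Z ◁ iA M ≫ p = Z ◁ iA M ≫ q) (hP : ∀ n, Z ◁ iP M n ≫ p = Z ◁ iP M n ≫ q) : p = q := by
  refine sigma_hom_extL (piece M) Z fun n => ?_
  cases n with
  | zero => exact hA
  | succ n => exact hP n

theorem T_extR (M : ABimod A) (Z : C) {W : C} {p q : TX M ⊗ Z ⟶ W}
    (hA : iA M ▷ Z ≫ p = iA M ▷ Z ≫ q) (hP : ∀ n, iP M n ▷ Z ≫ p = iP M n ▷ Z ≫ q) : p = q := by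
  refine sigma_hom_extR (piece M) Z fun n => ?_
  cases n with
  | zero => exact hA
  | succ n => exact hP n

theorem T_extM (M : ABimod A) (Z Z' : C) {W : C} {p q : (Z ⊗ TX M) ⊗ Z' ⟶ W}
    (hA : (Z ◁ iA M) ▷ Z' ≫ p = (Z ◁ iA M) ▷ Z' ≫ q)
    (hP : ∀ n, (Z ◁ iP M n) ▷ Z' ≫ p = (Z ◁ iP M n) ▷ Z' ≫ q) : p = q := by
  have key : ∀ {X : C} (j : X ⟶ TX M) (r : (Z ⊗ TX M) ⊗ Z' ⟶ W),
      j ▷ (Z ⊗ Z') ≫ (α_ _ _ _).inv ≫ (β_ (TX M) Z).hom ▷ Z' ≫ r =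
        (α_ _ _ _).inv ≫ (β_ X Z).hom ▷ Z' ≫ (Z ◁ j) ▷ Z' ≫ r := by
    intro X j r
    rw [associator_inv_naturality_left_assoc, ← comp_whiskerRight_assoc,
      BraidedCategory.braiding_naturality_left, comp_whiskerRight_assoc]
  rw [← cancel_epi ((β_ (TX M) Z).hom ▷ Z'), ← cancel_epi (α_ (TX M) Z Z').inv]
  refine T_extR M _ ?_ fun n => ?_
  · rw [key, key, hA]
  · rw [key, key, hP]

/-- The morphism out of `Z ⊗ T_A(M)` with given components. -/
noncomputable def TdescL (M : ABimod A) (Z : C) {W : C} (hA : Z ⊗ A.X ⟶ W)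
    (hP : ∀ n, Z ⊗ (tpow M n).X ⟶ W) : Z ⊗ TX M ⟶ W :=
  sigmaDescL (piece M) Z (comps M (tensorLeft Z) hA hP)

theorem iA_TdescL (M : ABimod A) (Z : C) {W : C} (hA : Z ⊗ A.X ⟶ W)
    (hP : ∀ n, Z ⊗ (tpow M n).X ⟶ W) : Z ◁ iA M ≫ TdescL M Z hA hP = hA :=
  sigmaDescL_fac (piece M) Z (comps M (tensorLeft Z) hA hP) 0

theorem iP_TdescL (M : ABimod A) (Z : C) {W : C} (hA : Z ⊗ A.X ⟶ W)
    (hP : ∀ n, Z ⊗ (tpow M n).X ⟶ W) (n : ℕ) : Z ◁ iP M n ≫ TdescL M Z hA hP = hP n :=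
  sigmaDescL_fac (piece M) Z (comps M (tensorLeft Z) hA hP) (n + 1)

/-- The morphism out of `T_A(M) ⊗ Z` with given components. -/
noncomputable def TdescR (M : ABimod A) (Z : C) {W : C} (hA : A.X ⊗ Z ⟶ W)
    (hP : ∀ n, (tpow M n).X ⊗ Z ⟶ W) : TX M ⊗ Z ⟶ W :=
  sigmaDescR (piece M) Z (comps M (tensorRight Z) hA hP)

theorem iA_TdescR (M : ABimod A) (Z : C) {W : C} (hA : A.X ⊗ Z ⟶ W)
    (hP : ∀ n, (tpow M n).X ⊗ Z ⟶ W) : iA M ▷ Z ≫ TdescR M Z hA hP = hA :=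
  sigmaDescR_fac (piece M) Z (comps M (tensorRight Z) hA hP) 0

theorem iP_TdescR (M : ABimod A) (Z : C) {W : C} (hA : A.X ⊗ Z ⟶ W)
    (hP : ∀ n, (tpow M n).X ⊗ Z ⟶ W) (n : ℕ) : iP M n ▷ Z ≫ TdescR M Z hA hP = hP n :=
  sigmaDescR_fac (piece M) Z (comps M (tensorRight Z) hA hP) (n + 1)

/-- The left action of `A` on `T_A(M)`, degree by degree. -/
noncomputable def TactA (M : ABimod A) : A.X ⊗ TX M ⟶ TX M :=
  TdescL M A.X (A.mul ≫ iA M) fun n => (tpow M n).act ≫ iP M n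

theorem iA_TactA (M : ABimod A) : A.X ◁ iA M ≫ TactA M = A.mul ≫ iA M :=
  iA_TdescL _ _ _ _

theorem iP_TactA (M : ABimod A) (n : ℕ) :
    A.X ◁ iP M n ≫ TactA M = (tpow M n).act ≫ iP M n :=
  iP_TdescL _ _ _ _ _

/-- The left multiplication by `M` on `T_A(M)`: the right action `M ⊗ A ⟶ M` in degree `0`, the
projection `M ⊗ L ⟶ M ⊗_A L` in positive degree. -/
noncomputable def TactM (M : ABimod A) : M.X ⊗ TX M ⟶ TX M :=
  TdescL M M.X (M.actR ≫ iM M) fun n => step M n ≫ iP M (n + 1)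

theorem iA_TactM (M : ABimod A) : M.X ◁ iA M ≫ TactM M = M.actR ≫ iM M :=
  iA_TdescL _ _ _ _

theorem iP_TactM (M : ABimod A) (n : ℕ) :
    M.X ◁ iP M n ≫ TactM M = step M n ≫ iP M (n + 1) :=
  iP_TdescL _ _ _ _ _

theorem iM_TactA (M : ABimod A) : A.X ◁ iM M ≫ TactA M = M.actL ≫ iM M :=
  iP_TactA M 0

theorem TactA_assoc (M : ABimod A) :
    A.mul ▷ TX M ≫ TactA M = (α_ A.X A.X (TX M)).hom ≫ A.X ◁ TactA M ≫ TactA M := by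
  refine T_extL M _ ?_ fun n => ?_
  · rw [whisker_exchange_assoc, iA_TactA]
    calc _ = (α_ A.X A.X A.X).hom ≫ A.X ◁ A.mul ≫ A.X ◁ iA M ≫ TactA M := by
          rw [iA_TactA, ← Category.assoc, A.assoc]; simp only [Category.assoc]
      _ = (α_ A.X A.X A.X).hom ≫ A.X ◁ (A.mul ≫ iA M) ≫ TactA M := by monoidal
      _ = (α_ A.X A.X A.X).hom ≫ A.X ◁ (A.X ◁ iA M ≫ TactA M) ≫ TactA M := by rw [iA_TactA]
      _ = _ := by monoidal
  · rw [whisker_exchange_assoc, iP_TactA]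
    calc _ = (α_ A.X A.X _).hom ≫ A.X ◁ (tpow M n).act ≫ A.X ◁ iP M n ≫ TactA M := by
          rw [iP_TactA, ← Category.assoc, (tpow M n).assoc]; simp only [Category.assoc]
      _ = (α_ A.X A.X _).hom ≫ A.X ◁ ((tpow M n).act ≫ iP M n) ≫ TactA M := by monoidal
      _ = (α_ A.X A.X _).hom ≫ A.X ◁ (A.X ◁ iP M n ≫ TactA M) ≫ TactA M := by rw [iP_TactA]
      _ = _ := by monoidal

theorem TactM_balanced (M : ABimod A) :
    M.actR ▷ TX M ≫ TactM M = (α_ M.X A.X (TX M)).hom ≫ M.X ◁ TactA M ≫ TactM M := by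
  refine T_extL M _ ?_ fun n => ?_
  · rw [whisker_exchange_assoc, iA_TactM]
    calc _ = (α_ M.X A.X A.X).hom ≫ M.X ◁ A.mul ≫ M.X ◁ iA M ≫ TactM M := by
          rw [iA_TactM, ← Category.assoc, M.assocR]; simp only [Category.assoc]
      _ = (α_ M.X A.X A.X).hom ≫ M.X ◁ (A.X ◁ iA M ≫ TactA M) ≫ TactM M := by
          rw [iA_TactA]; monoidal
      _ = _ := by monoidal
  · rw [whisker_exchange_assoc, iP_TactM]
    calc _ = (α_ M.X A.X _).hom ≫ M.X ◁ (tpow M n).act ≫ M.X ◁ iP M n ≫ TactM M := by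
          rw [iP_TactM, ← Category.assoc, step_balanced]; simp only [Category.assoc]
      _ = (α_ M.X A.X _).hom ≫ M.X ◁ (A.X ◁ iP M n ≫ TactA M) ≫ TactM M := by
          rw [iP_TactA]; monoidal
      _ = _ := by monoidal

theorem TactM_linear (M : ABimod A) :
    M.actL ▷ TX M ≫ TactM M = (α_ A.X M.X (TX M)).hom ≫ A.X ◁ TactM M ≫ TactA M := by
  refine T_extL M _ ?_ fun n => ?_
  · rw [whisker_exchange_assoc, iA_TactM]
    calc _ = (α_ A.X M.X A.X).hom ≫ A.X ◁ M.actR ≫ A.X ◁ iM M ≫ TactA M := by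
          rw [iM_TactA, ← Category.assoc, M.assocM]; simp only [Category.assoc]
      _ = (α_ A.X M.X A.X).hom ≫ A.X ◁ (M.X ◁ iA M ≫ TactM M) ≫ TactA M := by
          rw [iA_TactM]; monoidal
      _ = _ := by monoidal
  · rw [whisker_exchange_assoc, iP_TactM]
    calc _ = (α_ A.X M.X _).hom ≫ A.X ◁ step M n ≫ A.X ◁ iP M (n + 1) ≫ TactA M := by
          rw [iP_TactA, ← Category.assoc (A.X ◁ step M n), step_act]; simp
      _ = (α_ A.X M.X _).hom ≫ A.X ◁ (M.X ◁ iP M n ≫ TactM M) ≫ TactA M := by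
          rw [iP_TactM]; monoidal
      _ = _ := by monoidal

/-- An auxiliary left `A`-linear action on `T_A(M)` of the tensor power with `n + 1` factors. -/
structure LinAct (M : ABimod A) (n : ℕ) where
  map : (tpow M n).X ⊗ TX M ⟶ TX M
  linear : (tpow M n).act ▷ TX M ≫ map =
    (α_ A.X (tpow M n).X (TX M)).hom ≫ A.X ◁ map ≫ TactA M

/-- The inductive step: `(m ⊗ l) ⊗ t ↦ m (l t)`. -/
noncomputable def LinAct.succMap {M : ABimod A} {n : ℕ} (g : LinAct M n) :
    (tpow M (n + 1)).X ⊗ TX M ⟶ TX M :=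
  stepDescR M n (TX M) ((α_ M.X (tpow M n).X (TX M)).hom ≫ M.X ◁ g.map ≫ TactM M) (by
    calc M.actR ▷ (tpow M n).X ▷ TX M ≫ (α_ M.X (tpow M n).X (TX M)).hom ≫
          M.X ◁ g.map ≫ TactM M
        = (α_ (M.X ⊗ A.X) (tpow M n).X (TX M)).hom ≫
          (M.actR ▷ ((tpow M n).X ⊗ TX M) ≫ M.X ◁ g.map) ≫ TactM M := by monoidal
      _ = (α_ (M.X ⊗ A.X) (tpow M n).X (TX M)).hom ≫ (M.X ⊗ A.X) ◁ g.map ≫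
          M.actR ▷ TX M ≫ TactM M := by rw [← whisker_exchange]; monoidal
      _ = (α_ M.X A.X (tpow M n).X).hom ▷ TX M ≫ (α_ M.X (A.X ⊗ (tpow M n).X) (TX M)).hom ≫
          M.X ◁ ((α_ A.X (tpow M n).X (TX M)).hom ≫ A.X ◁ g.map ≫ TactA M) ≫ TactM M := by
        rw [TactM_balanced]; monoidal
      _ = _ := by rw [← g.linear]; monoidal)

theorem LinAct.step_succMap {M : ABimod A} {n : ℕ} (g : LinAct M n) :
    step M n ▷ TX M ≫ g.succMap =
      (α_ M.X (tpow M n).X (TX M)).hom ≫ M.X ◁ g.map ≫ TactM M :=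
  stepDescR_fac _ _ _ _ _

theorem LinAct.succ_linear {M : ABimod A} {n : ℕ} (g : LinAct M n) :
    (tpow M (n + 1)).act ▷ TX M ≫ g.succMap =
      (α_ A.X (tpow M (n + 1)).X (TX M)).hom ≫ A.X ◁ g.succMap ≫ TactA M := by
  rw [← cancel_epi ((A.X ◁ step M n) ▷ TX M), ← comp_whiskerRight_assoc, step_act]
  calc ((α_ A.X M.X (tpow M n).X).inv ≫ M.actL ▷ (tpow M n).X ≫ step M n) ▷ TX M ≫ g.succMap
      = (α_ A.X M.X (tpow M n).X).inv ▷ TX M ≫ M.actL ▷ (tpow M n).X ▷ TX M ≫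
          step M n ▷ TX M ≫ g.succMap := by
        simp only [comp_whiskerRight, Category.assoc]
    _ = (α_ A.X M.X (tpow M n).X).inv ▷ TX M ≫ (α_ (A.X ⊗ M.X) (tpow M n).X (TX M)).hom ≫
          (M.actL ▷ ((tpow M n).X ⊗ TX M) ≫ M.X ◁ g.map) ≫ TactM M := by
        rw [step_succMap]; monoidal
    _ = (α_ A.X M.X (tpow M n).X).inv ▷ TX M ≫ (α_ (A.X ⊗ M.X) (tpow M n).X (TX M)).hom ≫
          (A.X ⊗ M.X) ◁ g.map ≫ M.actL ▷ TX M ≫ TactM M := by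
        rw [← whisker_exchange]; monoidal
    _ = (α_ A.X (M.X ⊗ (tpow M n).X) (TX M)).hom ≫
          A.X ◁ ((α_ M.X (tpow M n).X (TX M)).hom ≫ M.X ◁ g.map ≫ TactM M) ≫ TactA M := by
        rw [TactM_linear]; monoidal
    _ = (α_ A.X (M.X ⊗ (tpow M n).X) (TX M)).hom ≫ A.X ◁ (step M n ▷ TX M ≫ g.succMap) ≫
          TactA M := by
        rw [step_succMap]
    _ = _ := by monoidal

/-- The left multiplication on `T_A(M)` by the tensor power with `n + 1` factors. -/
noncomputable def TactP (M : ABimod A) : ∀ n, LinAct M n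
  | 0 => ⟨TactM M, TactM_linear M⟩
  | n + 1 => ⟨(TactP M n).succMap, (TactP M n).succ_linear⟩

theorem step_TactP (M : ABimod A) (n : ℕ) :
    step M n ▷ TX M ≫ (TactP M (n + 1)).map =
      (α_ M.X (tpow M n).X (TX M)).hom ≫ M.X ◁ (TactP M n).map ≫ TactM M :=
  stepDescR_fac _ _ _ _ _

/-- The concatenation product on `T_A(M)`. -/
noncomputable def Tmul (M : ABimod A) : TX M ⊗ TX M ⟶ TX M :=
  TdescR M (TX M) (TactA M) fun n => (TactP M n).map

theorem iA_Tmul (M : ABimod A) : iA M ▷ TX M ≫ Tmul M = TactA M := iA_TdescR _ _ _ _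

theorem iP_Tmul (M : ABimod A) (n : ℕ) : iP M n ▷ TX M ≫ Tmul M = (TactP M n).map :=
  iP_TdescR _ _ _ _ _

theorem iM_Tmul (M : ABimod A) : iM M ▷ TX M ≫ Tmul M = TactM M := iP_Tmul M 0

theorem TactA_Tmul (M : ABimod A) :
    TactA M ▷ TX M ≫ Tmul M = (α_ A.X (TX M) (TX M)).hom ≫ A.X ◁ Tmul M ≫ TactA M := by
  have h : ∀ {X : C} (j : X ⟶ TX M),
      (A.X ◁ j) ▷ TX M ≫ (α_ A.X (TX M) (TX M)).hom ≫ A.X ◁ Tmul M ≫ TactA M =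
        (α_ A.X X (TX M)).hom ≫ A.X ◁ (j ▷ TX M ≫ Tmul M) ≫ TactA M := by
    intro X j; monoidal
  refine T_extM M _ _ ?_ fun n => ?_
  · rw [h, iA_Tmul, ← comp_whiskerRight_assoc, iA_TactA, comp_whiskerRight_assoc, iA_Tmul,
      TactA_assoc]
  · rw [h, iP_Tmul, ← comp_whiskerRight_assoc, iP_TactA, comp_whiskerRight_assoc, iP_Tmul,
      (TactP M n).linear]

theorem TactM_Tmul (M : ABimod A) :
    TactM M ▷ TX M ≫ Tmul M = (α_ M.X (TX M) (TX M)).hom ≫ M.X ◁ Tmul M ≫ TactM M := by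
  have h : ∀ {X : C} (j : X ⟶ TX M),
      (M.X ◁ j) ▷ TX M ≫ (α_ M.X (TX M) (TX M)).hom ≫ M.X ◁ Tmul M ≫ TactM M =
        (α_ M.X X (TX M)).hom ≫ M.X ◁ (j ▷ TX M ≫ Tmul M) ≫ TactM M := by
    intro X j; monoidal
  refine T_extM M _ _ ?_ fun n => ?_
  · rw [h, iA_Tmul, ← comp_whiskerRight_assoc, iA_TactM, comp_whiskerRight_assoc, iM_Tmul,
      TactM_balanced]
  · rw [h, iP_Tmul, ← comp_whiskerRight_assoc, iP_TactM, comp_whiskerRight_assoc, iP_Tmul,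
      step_TactP]

theorem TactP_Tmul (M : ABimod A) (n : ℕ) :
    (TactP M n).map ▷ TX M ≫ Tmul M =
      (α_ (tpow M n).X (TX M) (TX M)).hom ≫ (tpow M n).X ◁ Tmul M ≫ (TactP M n).map := by
  induction n with
  | zero => exact TactM_Tmul M
  | succ n ih =>
    have e : Epi (step M n ▷ TX M ▷ TX M) :=
      inferInstanceAs (Epi ((tensorRight (TX M) ⋙ tensorRight (TX M)).map (coequalizer.π _ _)))
    rw [← cancel_epi (step M n ▷ TX M ▷ TX M), ← comp_whiskerRight_assoc, step_TactP]
    calc ((α_ M.X (tpow M n).X (TX M)).hom ≫ M.X ◁ (TactP M n).map ≫ TactM M) ▷ TX M ≫ Tmul M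
        = (α_ M.X (tpow M n).X (TX M)).hom ▷ TX M ≫ (M.X ◁ (TactP M n).map) ▷ TX M ≫
            TactM M ▷ TX M ≫ Tmul M := by monoidal
      _ = (α_ M.X (tpow M n).X (TX M)).hom ▷ TX M ≫ (α_ M.X _ (TX M)).hom ≫
            M.X ◁ ((TactP M n).map ▷ TX M ≫ Tmul M) ≫ TactM M := by
          rw [TactM_Tmul]; monoidal
      _ = (α_ (M.X ⊗ (tpow M n).X) (TX M) (TX M)).hom ≫ (M.X ⊗ (tpow M n).X) ◁ Tmul M ≫
            (α_ M.X (tpow M n).X (TX M)).hom ≫ M.X ◁ (TactP M n).map ≫ TactM M := by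
          rw [ih]; monoidal
      _ = (α_ (M.X ⊗ (tpow M n).X) (TX M) (TX M)).hom ≫ ((M.X ⊗ (tpow M n).X) ◁ Tmul M ≫
            step M n ▷ TX M) ≫ (TactP M (n + 1)).map := by
          rw [← step_TactP, Category.assoc]
      _ = _ := by rw [whisker_exchange]; monoidal

theorem Tmul_assoc (M : ABimod A) :
    Tmul M ▷ TX M ≫ Tmul M = (α_ (TX M) (TX M) (TX M)).hom ≫ TX M ◁ Tmul M ≫ Tmul M := by
  rw [← cancel_epi (α_ (TX M) (TX M) (TX M)).inv, Iso.inv_hom_id_assoc]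
  refine T_extR M _ ?_ fun n => ?_
  · rw [← whisker_exchange_assoc, iA_Tmul, associator_inv_naturality_left_assoc,
      ← comp_whiskerRight_assoc, iA_Tmul, TactA_Tmul, Iso.inv_hom_id_assoc]
  · rw [← whisker_exchange_assoc, iP_Tmul, associator_inv_naturality_left_assoc,
      ← comp_whiskerRight_assoc, iP_Tmul, TactP_Tmul, Iso.inv_hom_id_assoc]

/-- The free `A`-algebra `T_A(M)`. -/
noncomputable def T (M : ABimod A) : AssocMon C := ⟨TX M, Tmul M, Tmul_assoc M⟩

/-- The projection `T_A(M) ⟶ A`. -/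
noncomputable def prA [HasZeroMorphisms C] (M : ABimod A) : TX M ⟶ A.X :=
  Tdesc M (𝟙 A.X) fun _ => 0

/-- The projection `T_A(M) ⟶ M`. -/
noncomputable def prM [HasZeroMorphisms C] (M : ABimod A) : TX M ⟶ M.X :=
  Tdesc M 0 fun
    | 0 => 𝟙 M.X
    | _ + 1 => 0

/-- Morphisms of left modules between tensor powers. -/
structure PowHom (M N : ABimod A) (n : ℕ) where
  map : (tpow M n).X ⟶ (tpow N n).X
  linear : (tpow M n).act ≫ map = A.X ◁ map ≫ (tpow N n).act

/-- The inductive step: `φ ⊗_A g`. -/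
noncomputable def PowHom.succMap {M N : ABimod A} (φ : M ⟶ N) {n : ℕ} (g : PowHom M N n) :
    (tpow M (n + 1)).X ⟶ (tpow N (n + 1)).X :=
  stepDesc M n ((φ.hom ⊗ₘ g.map) ≫ step N n) (by
    have h := step_balanced N n
    calc M.actR ▷ (tpow M n).X ≫ (φ.hom ⊗ₘ g.map) ≫ step N n
        = (M.actR ≫ φ.hom) ▷ (tpow M n).X ≫ N.X ◁ g.map ≫ step N n := by
          rw [MonoidalCategory.tensorHom_def]; monoidal
      _ = φ.hom ▷ A.X ▷ (tpow M n).X ≫ (N.actR ▷ (tpow M n).X ≫ N.X ◁ g.map) ≫ step N n := by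
          rw [φ.right]; monoidal
      _ = φ.hom ▷ A.X ▷ (tpow M n).X ≫ (N.X ⊗ A.X) ◁ g.map ≫ N.actR ▷ (tpow N n).X ≫
            step N n := by
          rw [← whisker_exchange]; monoidal
      _ = (α_ M.X A.X (tpow M n).X).hom ≫ φ.hom ▷ (A.X ⊗ (tpow M n).X) ≫
            N.X ◁ (A.X ◁ g.map ≫ (tpow N n).act) ≫ step N n := by
          rw [h]; monoidal
      _ = (α_ M.X A.X (tpow M n).X).hom ≫ (φ.hom ▷ (A.X ⊗ (tpow M n).X) ≫
            N.X ◁ (tpow M n).act) ≫ N.X ◁ g.map ≫ step N n := by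
          rw [← g.linear]; monoidal
      _ = _ := by
          rw [← whisker_exchange, MonoidalCategory.tensorHom_def]; monoidal)

theorem PowHom.step_succMap {M N : ABimod A} (φ : M ⟶ N) {n : ℕ} (g : PowHom M N n) :
    step M n ≫ g.succMap φ = (φ.hom ⊗ₘ g.map) ≫ step N n :=
  stepDesc_fac _ _ _ _

theorem PowHom.succ_linear {M N : ABimod A} (φ : M ⟶ N) {n : ℕ} (g : PowHom M N n) :
    (tpow M (n + 1)).act ≫ g.succMap φ = A.X ◁ g.succMap φ ≫ (tpow N (n + 1)).act := by
  rw [← cancel_epi (A.X ◁ step M n)]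
  calc A.X ◁ step M n ≫ (tpow M (n + 1)).act ≫ g.succMap φ
      = ((α_ A.X M.X (tpow M n).X).inv ≫ M.actL ▷ (tpow M n).X ≫ step M n) ≫ g.succMap φ := by
        rw [← step_act, Category.assoc]
    _ = (α_ A.X M.X (tpow M n).X).inv ≫ (M.actL ≫ φ.hom) ▷ (tpow M n).X ≫ N.X ◁ g.map ≫
          step N n := by
        rw [Category.assoc, Category.assoc, step_succMap, MonoidalCategory.tensorHom_def]; monoidal
    _ = (α_ A.X M.X (tpow M n).X).inv ≫ (A.X ◁ φ.hom) ▷ (tpow M n).X ≫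
          (N.actL ▷ (tpow M n).X ≫ N.X ◁ g.map) ≫ step N n := by
        rw [φ.left]; monoidal
    _ = A.X ◁ (φ.hom ▷ (tpow M n).X ≫ N.X ◁ g.map) ≫ (α_ A.X N.X (tpow N n).X).inv ≫
          N.actL ▷ (tpow N n).X ≫ step N n := by
        rw [← whisker_exchange]; monoidal
    _ = A.X ◁ (φ.hom ▷ (tpow M n).X ≫ N.X ◁ g.map) ≫ A.X ◁ step N n ≫ (tpow N (n + 1)).act := by
        rw [step_act]
    _ = A.X ◁ (step M n ≫ g.succMap φ) ≫ (tpow N (n + 1)).act := by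
        rw [step_succMap, MonoidalCategory.tensorHom_def]; monoidal
    _ = _ := by monoidal

/-- The morphism `φ ⊗_A ⋯ ⊗_A φ` with `n + 1` factors. -/
noncomputable def powMap {M N : ABimod A} (φ : M ⟶ N) : ∀ n, PowHom M N n
  | 0 => ⟨φ.hom, φ.left⟩
  | n + 1 => ⟨(powMap φ n).succMap φ, (powMap φ n).succ_linear φ⟩

theorem step_powMap {M N : ABimod A} (φ : M ⟶ N) (n : ℕ) :
    step M n ≫ (powMap φ (n + 1)).map = (φ.hom ⊗ₘ (powMap φ n).map) ≫ step N n :=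
  (powMap φ n).step_succMap φ

theorem powMap_id (M : ABimod A) (n : ℕ) : (powMap (𝟙 M) n).map = 𝟙 _ := by
  induction n with
  | zero => rfl
  | succ n ih =>
    have h : ABimod.Hom.hom (𝟙 M) = 𝟙 M.X := rfl
    rw [← cancel_epi (step M n), step_powMap, ih, h]
    simp

theorem powMap_comp {M N P : ABimod A} (φ : M ⟶ N) (ψ : N ⟶ P) (n : ℕ) :
    (powMap (φ ≫ ψ) n).map = (powMap φ n).map ≫ (powMap ψ n).map := by
  induction n with
  | zero => rfl
  | succ n ih =>
    have h : ABimod.Hom.hom (φ ≫ ψ) = φ.hom ≫ ψ.hom := rfl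
    rw [← cancel_epi (step M n), step_powMap, ih, h, ← Category.assoc, step_powMap,
      Category.assoc, step_powMap, tensorHom_comp_tensorHom_assoc]

/-- The morphism `T_A(M) ⟶ T_A(N)` induced by a morphism of bimodules. -/
noncomputable def Tmap {M N : ABimod A} (φ : M ⟶ N) : TX M ⟶ TX N :=
  Tdesc M (iA N) fun n => (powMap φ n).map ≫ iP N n

theorem iA_Tmap {M N : ABimod A} (φ : M ⟶ N) : iA M ≫ Tmap φ = iA N := iA_Tdesc _ _ _

theorem iP_Tmap {M N : ABimod A} (φ : M ⟶ N) (n : ℕ) :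
    iP M n ≫ Tmap φ = (powMap φ n).map ≫ iP N n := iP_Tdesc _ _ _ _

theorem iM_Tmap {M N : ABimod A} (φ : M ⟶ N) : iM M ≫ Tmap φ = φ.hom ≫ iM N := iP_Tmap φ 0

theorem Tmap_id (M : ABimod A) : Tmap (𝟙 M) = 𝟙 (TX M) := by
  refine T_ext M ?_ fun n => ?_
  · rw [iA_Tmap, Category.comp_id]
  · rw [iP_Tmap, powMap_id, Category.comp_id, Category.id_comp]

theorem Tmap_comp {M N P : ABimod A} (φ : M ⟶ N) (ψ : N ⟶ P) :
    Tmap (φ ≫ ψ) = Tmap φ ≫ Tmap ψ := by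
  refine T_ext M ?_ fun n => ?_
  · rw [iA_Tmap, ← Category.assoc, iA_Tmap, iA_Tmap]
  · rw [iP_Tmap, ← Category.assoc, iP_Tmap, Category.assoc, iP_Tmap, powMap_comp, Category.assoc]

section Projections

variable [HasZeroMorphisms C]

theorem iA_prA (M : ABimod A) : iA M ≫ prA M = 𝟙 _ := iA_Tdesc _ _ _

theorem iM_prA (M : ABimod A) : iM M ≫ prA M = 0 := iP_Tdesc _ _ _ 0

theorem iA_prM (M : ABimod A) : iA M ≫ prM M = 0 := iA_Tdesc _ _ _

theorem iM_prM (M : ABimod A) : iM M ≫ prM M = 𝟙 _ := iP_Tdesc _ _ _ 0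

theorem Tmap_prA {M N : ABimod A} (φ : M ⟶ N) : Tmap φ ≫ prA N = prA M := by
  refine T_ext M ?_ fun n => ?_
  · rw [← Category.assoc, iA_Tmap, iA_prA, iA_prA]
  · rw [← Category.assoc, iP_Tmap, Category.assoc, prA, iP_Tdesc, prA, iP_Tdesc, comp_zero]

theorem Tmap_prM {M N : ABimod A} (φ : M ⟶ N) : Tmap φ ≫ prM N = prM M ≫ φ.hom := by
  refine T_ext M ?_ fun n => ?_
  · rw [← Category.assoc, iA_Tmap, iA_prM, ← Category.assoc, iA_prM, zero_comp]
  · rw [← Category.assoc, iP_Tmap, Category.assoc, prM, iP_Tdesc, prM, ← Category.assoc, iP_Tdesc]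
    cases n with
    | zero => exact (Category.comp_id _).trans (Category.id_comp _).symm
    | succ n => rw [comp_zero, zero_comp]

theorem Tmap_injective {M N : ABimod A} {φ ψ : M ⟶ N} (h : Tmap φ = Tmap ψ) : φ = ψ := by
  apply ABimod.Hom.ext
  have h' : (iM M ≫ Tmap φ) ≫ prM N = (iM M ≫ Tmap ψ) ≫ prM N := by rw [h]
  rwa [iM_Tmap, iM_Tmap, Category.assoc, Category.assoc, iM_prM, Category.comp_id,
    Category.comp_id] at h'

end Projections

end FreeAlgebra

section Brackets

set_option linter.unusedSectionVars false

variable {C : Type u} [Category.{v} C] [MonoidalCategory C] [SymmetricCategory C]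

section Permutations

variable (S : C)

/-- External left action: `a ⊗ (s x ⊗ y) ↦ s (a x) ⊗ y`. -/
def extL {P X X' : C} (act : P ⊗ X ⟶ X') (Y : C) : P ⊗ ((S ⊗ X) ⊗ Y) ⟶ (S ⊗ X') ⊗ Y :=
  (α_ P (S ⊗ X) Y).inv ≫ ((α_ P S X).inv ≫ (β_ P S).hom ▷ X ≫ (α_ S P X).hom ≫ S ◁ act) ▷ Y

/-- External right action: `(s x ⊗ y) ⊗ a ↦ s x ⊗ y a`. -/
def extR (X : C) {P Y Y' : C} (act : Y ⊗ P ⟶ Y') : ((S ⊗ X) ⊗ Y) ⊗ P ⟶ (S ⊗ X) ⊗ Y' :=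
  (α_ (S ⊗ X) Y P).hom ≫ (S ⊗ X) ◁ act

/-- Internal left action: `a ⊗ (s x ⊗ y) ↦ s x ⊗ a y`. -/
def intL (X : C) {P Y Y' : C} (act : P ⊗ Y ⟶ Y') : P ⊗ ((S ⊗ X) ⊗ Y) ⟶ (S ⊗ X) ⊗ Y' :=
  (α_ P (S ⊗ X) Y).inv ≫ (β_ P (S ⊗ X)).hom ▷ Y ≫ (α_ (S ⊗ X) P Y).hom ≫ (S ⊗ X) ◁ act

/-- Internal right action: `(s x ⊗ y) ⊗ a ↦ s (x a) ⊗ y`. -/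
def intR {P X X' : C} (act : X ⊗ P ⟶ X') (Y : C) : ((S ⊗ X) ⊗ Y) ⊗ P ⟶ (S ⊗ X') ⊗ Y :=
  (α_ (S ⊗ X) Y P).hom ≫ (S ⊗ X) ◁ (β_ Y P).hom ≫ (α_ (S ⊗ X) P Y).inv ≫
    ((α_ S X P).hom ≫ S ◁ act) ▷ Y

/-- `s (a x) ⊗ y ↦ a ⊗ (s x ⊗ y)`. -/
def fstOutL (P X Y : C) : (S ⊗ (P ⊗ X)) ⊗ Y ⟶ P ⊗ ((S ⊗ X) ⊗ Y) :=
  ((α_ S P X).inv ≫ (β_ S P).hom ▷ X ≫ (α_ P S X).hom) ▷ Y ≫ (α_ P (S ⊗ X) Y).hom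

/-- `s (x a) ⊗ y ↦ (s x ⊗ y) ⊗ a`. -/
def fstOutR (X P Y : C) : (S ⊗ (X ⊗ P)) ⊗ Y ⟶ ((S ⊗ X) ⊗ Y) ⊗ P :=
  (α_ S X P).inv ▷ Y ≫ (α_ (S ⊗ X) P Y).hom ≫ (S ⊗ X) ◁ (β_ P Y).hom ≫ (α_ (S ⊗ X) Y P).inv

/-- `u ⊗ s (a x) ↦ a ⊗ (u ⊗ s x)`. -/
def sndOutL (U P X : C) : U ⊗ (S ⊗ (P ⊗ X)) ⟶ P ⊗ (U ⊗ (S ⊗ X)) :=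
  U ◁ (α_ S P X).inv ≫ (α_ U (S ⊗ P) X).inv ≫ (α_ U S P).inv ▷ X ≫ (β_ (U ⊗ S) P).hom ▷ X ≫
    (α_ P (U ⊗ S) X).hom ≫ P ◁ (α_ U S X).hom

/-- `u ⊗ s (x a) ↦ (u ⊗ s x) ⊗ a`. -/
def sndOutR (U X P : C) : U ⊗ (S ⊗ (X ⊗ P)) ⟶ (U ⊗ (S ⊗ X)) ⊗ P :=
  U ◁ (α_ S X P).inv ≫ (α_ U (S ⊗ X) P).inv

/-- The suspended symmetry `Σ τ_{X, Y}`. -/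
def sSwap (X Y : C) : (S ⊗ X) ⊗ Y ⟶ (S ⊗ Y) ⊗ X :=
  (α_ S X Y).hom ≫ S ◁ (β_ X Y).hom ≫ (α_ S Y X).inv

/-- The symmetry `τ_{U ⊗ V, W}`: `u ⊗ v ⊗ w ↦ w ⊗ u ⊗ v`. -/
def rotIn₁ (U V W : C) : U ⊗ (V ⊗ W) ⟶ W ⊗ (U ⊗ V) :=
  (α_ U V W).inv ≫ (β_ (U ⊗ V) W).hom

/-- The symmetry `τ_{U, V ⊗ W}`: `u ⊗ v ⊗ w ↦ v ⊗ w ⊗ u`. -/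
def rotIn₂ (U V W : C) : U ⊗ (V ⊗ W) ⟶ V ⊗ (W ⊗ U) :=
  (β_ U (V ⊗ W)).hom ≫ (α_ V W U).hom

/-- The suspended symmetry `Σ τ_{X, Y ⊗ Z}`: `s x ⊗ y ⊗ z ↦ s y ⊗ z ⊗ x`. -/
def rotOut₁ (X Y Z : C) : ((S ⊗ X) ⊗ Y) ⊗ Z ⟶ ((S ⊗ Y) ⊗ Z) ⊗ X :=
  (α_ (S ⊗ X) Y Z).hom ≫ (α_ S X (Y ⊗ Z)).hom ≫ S ◁ (β_ X (Y ⊗ Z)).hom ≫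
    (α_ S (Y ⊗ Z) X).inv ≫ (α_ S Y Z).inv ▷ X

/-- The suspended symmetry `Σ τ_{X ⊗ Y, Z}`: `s x ⊗ y ⊗ z ↦ s z ⊗ x ⊗ y`. -/
def rotOut₂ (X Y Z : C) : ((S ⊗ X) ⊗ Y) ⊗ Z ⟶ ((S ⊗ Z) ⊗ X) ⊗ Y :=
  (α_ S X Y).hom ▷ Z ≫ (α_ S (X ⊗ Y) Z).hom ≫ S ◁ (β_ (X ⊗ Y) Z).hom ≫
    (α_ S Z (X ⊗ Y)).inv ≫ (α_ (S ⊗ Z) X Y).inv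

/-- The composite `(f ⊗ Z) (U ⊗ g)`. -/
def nest {U V W V' Z R : C} (f : U ⊗ V' ⟶ R) (g : V ⊗ W ⟶ V' ⊗ Z) :
    U ⊗ (V ⊗ W) ⟶ R ⊗ Z :=
  U ◁ g ≫ (α_ U V' Z).inv ≫ f ▷ Z

end Permutations

variable [Preadditive C]

/-- The double jacobiator of a `Σ`-double bracket. -/
def doubleJacobiator (S X : C) (f : (S ⊗ X) ⊗ (S ⊗ X) ⟶ (S ⊗ X) ⊗ X) :
    (S ⊗ X) ⊗ ((S ⊗ X) ⊗ (S ⊗ X)) ⟶ ((S ⊗ X) ⊗ X) ⊗ X :=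
  nest f f +
    rotIn₁ (S ⊗ X) (S ⊗ X) (S ⊗ X) ≫ nest f f ≫ rotOut₁ S X X X +
    rotIn₂ (S ⊗ X) (S ⊗ X) (S ⊗ X) ≫ nest f f ≫ rotOut₂ S X X X

/-- `Σ`-double Poisson brackets on an associative monoid: antisymmetric `Σ`-double brackets with the
left derivation property and the double Jacobi identity. -/
structure IsDoublePoisson (S : C) (B : AssocMon C)
    (f : (S ⊗ B.X) ⊗ (S ⊗ B.X) ⟶ (S ⊗ B.X) ⊗ B.X) : Prop where
  antisymm : f = -((β_ (S ⊗ B.X) (S ⊗ B.X)).hom ≫ f ≫ sSwap S B.X B.X)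
  derivation : (S ◁ B.mul) ▷ (S ⊗ B.X) ≫ f =
    fstOutL S B.X B.X (S ⊗ B.X) ≫ B.X ◁ f ≫ intL S B.X B.mul +
    fstOutR S B.X B.X (S ⊗ B.X) ≫ f ▷ B.X ≫ intR S B.mul B.X
  jacobi : doubleJacobiator S B.X f = 0

/-- Compatibility of a morphism with double brackets. -/
def IsDoubleLieHom (S : C) {X Y : C} (f : (S ⊗ X) ⊗ (S ⊗ X) ⟶ (S ⊗ X) ⊗ X)
    (g : (S ⊗ Y) ⊗ (S ⊗ Y) ⟶ (S ⊗ Y) ⊗ Y) (φ : X ⟶ Y) : Prop :=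
  f ≫ (S ◁ φ ⊗ₘ φ) = (S ◁ φ ⊗ₘ S ◁ φ) ≫ g

variable [HasBinaryBiproducts C] {A : AssocMon C}

/-- The component in `Σ M ⊗ A` of a morphism with values in `Σ (M ⊗ A ⊕ A ⊗ M)`. -/
noncomputable def brL (S : C) (M : ABimod A) {U : C}
    (b : U ⟶ S ⊗ ((M.X ⊗ A.X) ⊞ (A.X ⊗ M.X))) : U ⟶ (S ⊗ M.X) ⊗ A.X :=
  b ≫ S ◁ biprod.fst ≫ (α_ S M.X A.X).inv

/-- The component in `Σ A ⊗ M` of a morphism with values in `Σ (M ⊗ A ⊕ A ⊗ M)`. -/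
noncomputable def brR (S : C) (M : ABimod A) {U : C}
    (b : U ⟶ S ⊗ ((M.X ⊗ A.X) ⊞ (A.X ⊗ M.X))) : U ⟶ (S ⊗ A.X) ⊗ M.X :=
  b ≫ S ◁ biprod.snd ≫ (α_ S A.X M.X).inv

/-- The antisymmetric counterpart `Σ A ⊗ Σ M ⟶ Σ A ⊗ A` of an anchor. -/
def anchorSwap (S : C) (M : ABimod A) (ρ : (S ⊗ M.X) ⊗ (S ⊗ A.X) ⟶ (S ⊗ A.X) ⊗ A.X) :
    (S ⊗ A.X) ⊗ (S ⊗ M.X) ⟶ (S ⊗ A.X) ⊗ A.X :=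
  -((β_ (S ⊗ A.X) (S ⊗ M.X)).hom ≫ ρ ≫ sSwap S A.X A.X)

/-- `Σ`-double Lie-Rinehart structures on an `A`-bimodule `M`, with anchor `ρ` and bracket `b`. -/
structure IsDLR (S : C) (M : ABimod A)
    (ρ : (S ⊗ M.X) ⊗ (S ⊗ A.X) ⟶ (S ⊗ A.X) ⊗ A.X)
    (b : (S ⊗ M.X) ⊗ (S ⊗ M.X) ⟶ S ⊗ ((M.X ⊗ A.X) ⊞ (A.X ⊗ M.X))) : Prop where
  /-- The anchor is left `A`-linear, for the internal structure on the target. -/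
  anchor_left : extL S M.actL (S ⊗ A.X) ≫ ρ = A.X ◁ ρ ≫ intL S A.X A.mul
  /-- The anchor is right `A`-linear, for the internal structure on the target. -/
  anchor_right : intR S M.actR (S ⊗ A.X) ≫ ρ = ρ ▷ A.X ≫ intR S A.mul A.X
  /-- The anchor is a derivation in its second input, for the external structure on the target. -/
  anchor_derivation : (S ⊗ M.X) ◁ (S ◁ A.mul) ≫ ρ =
    sndOutL S (S ⊗ M.X) A.X A.X ≫ A.X ◁ ρ ≫ extL S A.mul A.X +
    sndOutR S (S ⊗ M.X) A.X A.X ≫ ρ ▷ A.X ≫ extR S A.X A.mul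
  antisymm : (β_ (S ⊗ M.X) (S ⊗ M.X)).hom ≫ b =
    -(b ≫ S ◁ biprod.lift (biprod.snd ≫ (β_ A.X M.X).hom) (biprod.fst ≫ (β_ M.X A.X).hom))
  /-- The derivation property along `A ⊗ M ⟶ M`, component in `Σ M ⊗ A`. -/
  derivation_left_l : (S ⊗ M.X) ◁ (S ◁ M.actL) ≫ brL S M b =
    sndOutL S (S ⊗ M.X) A.X M.X ≫ A.X ◁ brL S M b ≫ extL S M.actL A.X
  /-- The derivation property along `A ⊗ M ⟶ M`, component in `Σ A ⊗ M`. -/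
  derivation_left_r : (S ⊗ M.X) ◁ (S ◁ M.actL) ≫ brR S M b =
    sndOutR S (S ⊗ M.X) A.X M.X ≫ ρ ▷ M.X ≫ extR S A.X M.actL +
    sndOutL S (S ⊗ M.X) A.X M.X ≫ A.X ◁ brR S M b ≫ extL S A.mul M.X
  /-- The derivation property along `M ⊗ A ⟶ M`, component in `Σ M ⊗ A`. -/
  derivation_right_l : (S ⊗ M.X) ◁ (S ◁ M.actR) ≫ brL S M b =
    sndOutR S (S ⊗ M.X) M.X A.X ≫ brL S M b ▷ A.X ≫ extR S M.X A.mul +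
    sndOutL S (S ⊗ M.X) M.X A.X ≫ M.X ◁ ρ ≫ extL S M.actR A.X
  /-- The derivation property along `M ⊗ A ⟶ M`, component in `Σ A ⊗ M`. -/
  derivation_right_r : (S ⊗ M.X) ◁ (S ◁ M.actR) ≫ brR S M b =
    sndOutR S (S ⊗ M.X) M.X A.X ≫ brR S M b ▷ A.X ≫ extR S A.X M.actR
  /-- The compatibility of the bracket with the anchor, on `Σ A ⊗ Σ M ⊗ Σ M`. -/
  compat :
    nest (anchorSwap S M ρ) (brL S M b) +
      rotIn₂ (S ⊗ A.X) (S ⊗ M.X) (S ⊗ M.X) ≫ nest ρ ρ ≫ rotOut₂ S A.X A.X A.X +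
      rotIn₁ (S ⊗ A.X) (S ⊗ M.X) (S ⊗ M.X) ≫ nest ρ (anchorSwap S M ρ) ≫
        rotOut₁ S A.X A.X A.X = 0
  /-- The double Jacobi identity, on `Σ M ⊗ Σ M ⊗ Σ M` with values in `Σ M ⊗ A ⊗ A`. -/
  jacobi :
    nest (brL S M b) (brL S M b) +
      rotIn₁ (S ⊗ M.X) (S ⊗ M.X) (S ⊗ M.X) ≫ nest (brR S M b) (brL S M b) ≫
        rotOut₁ S A.X M.X A.X +
      rotIn₂ (S ⊗ M.X) (S ⊗ M.X) (S ⊗ M.X) ≫ nest ρ (brR S M b) ≫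
        rotOut₂ S A.X A.X M.X = 0

/-- A bimodule with morphisms of the types of an anchor and of a bracket. -/
structure DLRData (S : C) (A : AssocMon C) where
  M : ABimod A
  anchor : (S ⊗ M.X) ⊗ (S ⊗ A.X) ⟶ (S ⊗ A.X) ⊗ A.X
  bracket : (S ⊗ M.X) ⊗ (S ⊗ M.X) ⟶ S ⊗ ((M.X ⊗ A.X) ⊞ (A.X ⊗ M.X))

/-- Bimodule morphisms that commute with the anchors and with the brackets. -/
@[ext]
structure DLRData.Hom {S : C} (X Y : DLRData S A) where
  φ : X.M ⟶ Y.M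
  anchor : (S ◁ φ.hom) ▷ (S ⊗ A.X) ≫ Y.anchor = X.anchor
  bracket : X.bracket ≫ S ◁ biprod.map (φ.hom ▷ A.X) (A.X ◁ φ.hom) =
    (S ◁ φ.hom ⊗ₘ S ◁ φ.hom) ≫ Y.bracket

theorem id_hom' (M : ABimod A) : ABimod.Hom.hom (𝟙 M) = 𝟙 M.X := rfl

theorem comp_hom' {M N P : ABimod A} (f : M ⟶ N) (g : N ⟶ P) :
    ABimod.Hom.hom (f ≫ g) = f.hom ≫ g.hom := rfl

instance (S : C) (A : AssocMon C) : Category (DLRData S A) where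
  Hom := DLRData.Hom
  id X := ⟨𝟙 X.M, by simp [id_hom'], by
      have e : biprod.map (𝟙 (X.M.X ⊗ A.X)) (𝟙 (A.X ⊗ X.M.X)) = 𝟙 _ := by ext <;> simp
      simp [id_hom', e]⟩
  comp f g := ⟨f.φ ≫ g.φ, by
      rw [comp_hom', whiskerLeft_comp, comp_whiskerRight, Category.assoc, g.anchor, f.anchor], by
      have e : biprod.map ((f.φ ≫ g.φ).hom ▷ A.X) (A.X ◁ (f.φ ≫ g.φ).hom) =
          biprod.map (f.φ.hom ▷ A.X) (A.X ◁ f.φ.hom) ≫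
            biprod.map (g.φ.hom ▷ A.X) (A.X ◁ g.φ.hom) := by
        rw [comp_hom']; ext <;> simp
      have e' : (S ◁ (f.φ ≫ g.φ).hom ⊗ₘ S ◁ (f.φ ≫ g.φ).hom) =
          (S ◁ f.φ.hom ⊗ₘ S ◁ f.φ.hom) ≫ (S ◁ g.φ.hom ⊗ₘ S ◁ g.φ.hom) := by
        rw [comp_hom', whiskerLeft_comp, tensorHom_comp_tensorHom]
      rw [e, e', Category.assoc, ← g.bracket, ← Category.assoc (S ◁ f.φ.hom ⊗ₘ S ◁ f.φ.hom),
        ← f.bracket, Category.assoc, ← whiskerLeft_comp]⟩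
  id_comp f := DLRData.Hom.ext (Category.id_comp _)
  comp_id f := DLRData.Hom.ext (Category.comp_id _)
  assoc f g h := DLRData.Hom.ext (Category.assoc _ _ _)

/-- The property of being a `Σ`-double Lie-Rinehart algebra over `A`. -/
def isDLR (S : C) (A : AssocMon C) : ObjectProperty (DLRData S A) :=
  fun X => IsDLR S X.M X.anchor X.bracket

/-- The category `Σ-DLR_A` of `Σ`-double Lie-Rinehart algebras over `A`. -/
abbrev DLR (S : C) (A : AssocMon C) := (isDLR S A).FullSubcategory

variable [HasCoequalizers C] [∀ X : C, PreservesColimitsOfShape WalkingParallelPair (tensorLeft X)]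
  [HasCoproductsOfShape ℕ C] [∀ X : C, PreservesColimitsOfShape (Discrete ℕ) (tensorLeft X)]

/-- The `Σ`-double bracket `f` on `T_A(M)` vanishes on `Σ A ⊗ Σ A` and takes on `Σ M ⊗ Σ A` and on
`Σ M ⊗ Σ M` the values `ρ` and `b` in `Σ A ⊗ A` and in `Σ (M ⊗ A ⊕ A ⊗ M)`. -/
structure RestrictsTo (S : C) (M : ABimod A)
    (f : (S ⊗ TX M) ⊗ (S ⊗ TX M) ⟶ (S ⊗ TX M) ⊗ TX M)
    (ρ : (S ⊗ M.X) ⊗ (S ⊗ A.X) ⟶ (S ⊗ A.X) ⊗ A.X)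
    (b : (S ⊗ M.X) ⊗ (S ⊗ M.X) ⟶ S ⊗ ((M.X ⊗ A.X) ⊞ (A.X ⊗ M.X))) : Prop where
  on_AA : (S ◁ iA M ⊗ₘ S ◁ iA M) ≫ f = 0
  on_MA : (S ◁ iM M ⊗ₘ S ◁ iA M) ≫ f = ρ ≫ (S ◁ iA M ⊗ₘ iA M)
  on_MM : (S ◁ iM M ⊗ₘ S ◁ iM M) ≫ f =
    b ≫ S ◁ biprod.desc (iM M ⊗ₘ iA M) (iA M ⊗ₘ iM M) ≫ (α_ S (TX M) (TX M)).inv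

/-- Linear `Σ`-double brackets on `T_A(M)`. -/
def IsLinear (S : C) (M : ABimod A)
    (f : (S ⊗ TX M) ⊗ (S ⊗ TX M) ⟶ (S ⊗ TX M) ⊗ TX M) : Prop :=
  ∃ ρ b, RestrictsTo S M f ρ b

/-- Free `A`-algebras `T_A(M)` with a linear `Σ`-double Poisson bracket. -/
structure DPFreeLin (S : C) (A : AssocMon C) where
  M : ABimod A
  f : (S ⊗ TX M) ⊗ (S ⊗ TX M) ⟶ (S ⊗ TX M) ⊗ TX M
  poisson : IsDoublePoisson S (T M) f
  linear : IsLinear S M f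

/-- Morphisms of `Σ`-double Poisson algebras induced by a morphism of bimodules. -/
@[ext]
structure DPFreeLin.Hom {S : C} (X Y : DPFreeLin S A) where
  ψ : TX X.M ⟶ TX Y.M
  isHom : AssocMon.IsHom (T X.M) (T Y.M) ψ
  isLie : IsDoubleLieHom S X.f Y.f ψ
  induced : ∃ φ : X.M ⟶ Y.M, ψ = Tmap φ

/-- The category of free `A`-algebras with a linear `Σ`-double Poisson bracket. -/
noncomputable instance (S : C) (A : AssocMon C) : Category (DPFreeLin S A) where
  Hom := DPFreeLin.Hom
  id X := ⟨𝟙 _, AssocMon.isHom_id (T X.M), by simp [IsDoubleLieHom], 𝟙 _, (Tmap_id _).symm⟩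
  comp f g := ⟨f.ψ ≫ g.ψ, by
      exact f.isHom.comp g.isHom, by
      have hf := f.isLie
      have hg := g.isLie
      unfold IsDoubleLieHom at *
      rw [whiskerLeft_comp, ← tensorHom_comp_tensorHom, ← tensorHom_comp_tensorHom,
        ← Category.assoc, hf, Category.assoc, hg, Category.assoc], by
      obtain ⟨φ, hφ⟩ := f.induced
      obtain ⟨φ', hφ'⟩ := g.induced
      exact ⟨φ ≫ φ', by rw [hφ, hφ', Tmap_comp]⟩⟩
  id_comp f := DPFreeLin.Hom.ext (Category.id_comp _)
  comp_id f := DPFreeLin.Hom.ext (Category.comp_id _)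
  assoc f g h := DPFreeLin.Hom.ext (Category.assoc _ _ _)

/-- The part with values in `Σ A ⊗ A` of the restriction of `f` to `Σ M ⊗ Σ A`. -/
noncomputable def restrictAnchor (S : C) (M : ABimod A)
    (f : (S ⊗ TX M) ⊗ (S ⊗ TX M) ⟶ (S ⊗ TX M) ⊗ TX M) :
    (S ⊗ M.X) ⊗ (S ⊗ A.X) ⟶ (S ⊗ A.X) ⊗ A.X :=
  (S ◁ iM M ⊗ₘ S ◁ iA M) ≫ f ≫ (S ◁ prA M ⊗ₘ prA M)

/-- The part with values in `Σ (M ⊗ A ⊕ A ⊗ M)` of the restriction of `f` to `Σ M ⊗ Σ M`. -/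
noncomputable def restrictBracket (S : C) (M : ABimod A)
    (f : (S ⊗ TX M) ⊗ (S ⊗ TX M) ⟶ (S ⊗ TX M) ⊗ TX M) :
    (S ⊗ M.X) ⊗ (S ⊗ M.X) ⟶ S ⊗ ((M.X ⊗ A.X) ⊞ (A.X ⊗ M.X)) :=
  (S ◁ iM M ⊗ₘ S ◁ iM M) ≫ f ≫ (α_ S (TX M) (TX M)).hom ≫
    S ◁ biprod.lift (prM M ⊗ₘ prA M) (prA M ⊗ₘ prM M)

theorem RestrictsTo.anchor_eq {S : C} {M : ABimod A}
    {f : (S ⊗ TX M) ⊗ (S ⊗ TX M) ⟶ (S ⊗ TX M) ⊗ TX M}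
    {ρ : (S ⊗ M.X) ⊗ (S ⊗ A.X) ⟶ (S ⊗ A.X) ⊗ A.X}
    {b : (S ⊗ M.X) ⊗ (S ⊗ M.X) ⟶ S ⊗ ((M.X ⊗ A.X) ⊞ (A.X ⊗ M.X))}
    (h : RestrictsTo S M f ρ b) : restrictAnchor S M f = ρ := by
  rw [restrictAnchor, ← Category.assoc, h.on_MA, Category.assoc, tensorHom_comp_tensorHom,
    ← whiskerLeft_comp, iA_prA]
  simp

theorem RestrictsTo.bracket_eq [MonoidalPreadditive C] {S : C} {M : ABimod A}
    {f : (S ⊗ TX M) ⊗ (S ⊗ TX M) ⟶ (S ⊗ TX M) ⊗ TX M}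
    {ρ : (S ⊗ M.X) ⊗ (S ⊗ A.X) ⟶ (S ⊗ A.X) ⊗ A.X}
    {b : (S ⊗ M.X) ⊗ (S ⊗ M.X) ⟶ S ⊗ ((M.X ⊗ A.X) ⊞ (A.X ⊗ M.X))}
    (h : RestrictsTo S M f ρ b) : restrictBracket S M f = b := by
  have e : biprod.desc (iM M ⊗ₘ iA M) (iA M ⊗ₘ iM M) ≫
      biprod.lift (prM M ⊗ₘ prA M) (prA M ⊗ₘ prM M) = 𝟙 _ := by
    ext <;> simp [tensorHom_comp_tensorHom, iA_prA, iM_prA, iA_prM, iM_prM]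
  rw [restrictBracket, ← Category.assoc, h.on_MM]
  simp only [Category.assoc, Iso.inv_hom_id_assoc]
  rw [← whiskerLeft_comp, e, whiskerLeft_id, Category.comp_id]

/-- The functor that restricts a linear `Σ`-double Poisson bracket on `T_A(M)` to an anchor and a
bracket on `M`, and sends a morphism `T_A(φ)` to `φ`. -/
noncomputable def restrict (S : C) (A : AssocMon C) : DPFreeLin S A ⥤ DLRData S A where
  obj X := ⟨X.M, restrictAnchor S X.M X.f, restrictBracket S X.M X.f⟩
  map {X Y} ψ := ⟨ψ.induced.choose, by
      have hφ := ψ.induced.choose_spec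
      have hl := ψ.isLie
      generalize ψ.induced.choose = φ at *
      unfold IsDoubleLieHom at hl
      rw [hφ] at hl
      simp only [restrictAnchor]
      rw [← tensorHom_id, ← Category.assoc, tensorHom_comp_tensorHom, ← whiskerLeft_comp,
        ← iM_Tmap, Category.id_comp, ← iA_Tmap φ, whiskerLeft_comp, whiskerLeft_comp,
        ← tensorHom_comp_tensorHom, Category.assoc, ← Category.assoc _ Y.f, ← hl,
        Category.assoc, tensorHom_comp_tensorHom, ← whiskerLeft_comp, Tmap_prA], by
      have hφ := ψ.induced.choose_spec
      have hl := ψ.isLie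
      generalize ψ.induced.choose = φ at *
      unfold IsDoubleLieHom at hl
      rw [hφ] at hl
      have e : biprod.lift (prM X.M ⊗ₘ prA X.M) (prA X.M ⊗ₘ prM X.M) ≫
          biprod.map (φ.hom ▷ A.X) (A.X ◁ φ.hom) =
          (Tmap φ ⊗ₘ Tmap φ) ≫
            biprod.lift (prM Y.M ⊗ₘ prA Y.M) (prA Y.M ⊗ₘ prM Y.M) := by
        ext
        · simp only [Category.assoc, biprod.map_fst, biprod.lift_fst, biprod.lift_fst_assoc]
          rw [← tensorHom_id, tensorHom_comp_tensorHom, tensorHom_comp_tensorHom, Tmap_prA,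
            Tmap_prM, Category.comp_id]
        · simp only [Category.assoc, biprod.map_snd, biprod.lift_snd, biprod.lift_snd_assoc]
          rw [← id_tensorHom, tensorHom_comp_tensorHom, tensorHom_comp_tensorHom, Tmap_prA,
            Tmap_prM, Category.comp_id]
      have e2 : (S ◁ Tmap φ ⊗ₘ Tmap φ) ≫ (α_ S (TX Y.M) (TX Y.M)).hom =
          (α_ S (TX X.M) (TX X.M)).hom ≫ S ◁ (Tmap φ ⊗ₘ Tmap φ) := by
        simp only [MonoidalCategory.tensorHom_def]; monoidal
      have e3 : (S ◁ φ.hom ⊗ₘ S ◁ φ.hom) ≫ (S ◁ iM Y.M ⊗ₘ S ◁ iM Y.M) =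
          (S ◁ iM X.M ⊗ₘ S ◁ iM X.M) ≫ (S ◁ Tmap φ ⊗ₘ S ◁ Tmap φ) := by
        rw [tensorHom_comp_tensorHom, tensorHom_comp_tensorHom, ← whiskerLeft_comp,
          ← whiskerLeft_comp, iM_Tmap]
      simp only [restrictBracket, Category.assoc]
      rw [← Category.assoc (S ◁ φ.hom ⊗ₘ S ◁ φ.hom), e3, Category.assoc,
        ← Category.assoc _ Y.f, ← hl, Category.assoc,
        ← Category.assoc _ (α_ S (TX Y.M) (TX Y.M)).hom, e2, Category.assoc, ← whiskerLeft_comp,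
        ← whiskerLeft_comp, e]⟩
  map_id X := by
    apply DLRData.Hom.ext
    apply Tmap_injective
    refine (Exists.choose_spec (DPFreeLin.Hom.induced (𝟙 X))).symm.trans ?_
    exact (Tmap_id _).symm
  map_comp {X Y Z} f g := by
    apply DLRData.Hom.ext
    apply Tmap_injective
    refine (Exists.choose_spec (DPFreeLin.Hom.induced (f ≫ g))).symm.trans ?_
    refine Eq.trans ?_ (Tmap_comp _ _).symm
    rw [← f.induced.choose_spec, ← g.induced.choose_spec]
    rfl

/-- The free `A`-algebras with a linear bracket whose bimodule is unital. -/
def dpUnital (S : C) (A : AssocMon C) (η : 𝟙_ C ⟶ A.X) : ObjectProperty (DPFreeLin S A) :=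
  fun X => X.M.IsUnital η

/-- The double Lie-Rinehart algebras whose bimodule is unital. -/
def isUnitalDLR (S : C) (A : AssocMon C) (η : 𝟙_ C ⟶ A.X) : ObjectProperty (DLRData S A) :=
  fun X => isDLR S A X ∧ X.M.IsUnital η

end Brackets

end DoubleLR

/-!
The bracket on `T_A(M)` is a derivation in each variable, for the internal bimodule structure in
the first one and, by antisymmetry, for the external structure in the second one. As `T_A(M)` is
generated by `A` and `M`, such a biderivation is determined by its values on pairs of generators
(`IsDer.ext`, `biderivation_ext`). This gives the uniqueness of the bracket, and it shows that
`T_A(φ)` is a morphism of double Poisson algebras as soon as `φ` commutes with anchors and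
brackets (`RestrictsTo.isDoubleLieHom`).

Conversely, values on the generators extend to a derivation of `T_A(M)` as soon as they satisfy
the Leibniz rules for the product of `A` and for the two actions of `A` on `M` (`derExt`, by
recursion over the tensor powers, which are coequalizers). The axioms of a double Lie-Rinehart
structure other than the two Jacobi identities are exactly these Leibniz rules, for the components
in `Σ M ⊗ A` and `Σ A ⊗ M`. Extending first in the second variable and then in the first one,
where the Leibniz rules are equalities of derivations in the second variable, yields an
antisymmetric biderivation (`IsDLR.exists_bracket`).

The double jacobiator of an antisymmetric biderivation is a derivation in its third variable
(`doubleJacobiator_isDerSnd`). In this computation two cross terms have to cancel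
(`cross_cancel`); it is here that the invertibility of `Σ` is used: a morphism between objects of
the form `Σ ⊗ X` is the suspension of a morphism, so that one suspension can be carried along.
Since the double jacobiator is also invariant under cyclic permutations, it vanishes if it
vanishes on the generators. Its values there are zero if at least two of the arguments lie in `A`,
the compatibility of the bracket with the anchor if one does (`RestrictsTo.jacobiator_AMM`), and
the sum of the three rotations of the double Jacobi identity of `M` if none does
(`RestrictsTo.jacobiator_MMM`).

Identities between morphisms out of iterated tensor products are checked on generalized elements.
For morphisms `x : G ⟶ X` and `y : G ⟶ Y` out of a cocommutative comonoid `G`, the pair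
`x ⊙ y : G ⟶ X ⊗ Y` is the comultiplication followed by `x ⊗ y`; coherence morphisms and
symmetries act on such pairs as they do on pure tensors of modules. There are enough pairs to
separate morphisms, since each object `X` is a retract of the cocommutative comonoid `𝟙 ⊕ X`,
in which `X` is primitive (`pure_ext`).
-/

namespace DoubleLR

/-! ### Generalized elements over cocommutative comonoids -/

open ComonObj

section Elements

variable {C : Type u} [Category.{v} C] [MonoidalCategory C]

/-- The pure tensor `x ⊙ y : G ⟶ X ⊗ Y` of two generalized elements `x : G ⟶ X` and `y : G ⟶ Y`
over a comonoid `G`. -/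
def pair {G X Y : C} [ComonObj G] (x : G ⟶ X) (y : G ⟶ Y) : G ⟶ X ⊗ Y :=
  Δ ≫ (x ⊗ₘ y)

local infixr:90 " ⊙ " => pair

section Pairing

variable {G X X' Y Y' Z W : C} [ComonObj G]

theorem pair_tensorHom (x : G ⟶ X) (y : G ⟶ Y) (f : X ⟶ X') (g : Y ⟶ Y') :
    x ⊙ y ≫ (f ⊗ₘ g) = (x ≫ f) ⊙ (y ≫ g) := by
  simp [pair, tensorHom_comp_tensorHom]

theorem pair_tensorHom_assoc (x : G ⟶ X) (y : G ⟶ Y) (f : X ⟶ X') (g : Y ⟶ Y')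
    (h : X' ⊗ Y' ⟶ W) : x ⊙ y ≫ (f ⊗ₘ g) ≫ h = (x ≫ f) ⊙ (y ≫ g) ≫ h := by
  rw [← Category.assoc, pair_tensorHom]

theorem pair_whiskerLeft (x : G ⟶ X) (y : G ⟶ Y) (g : Y ⟶ Y') :
    x ⊙ y ≫ X ◁ g = x ⊙ (y ≫ g) := by
  rw [← id_tensorHom, pair_tensorHom, Category.comp_id]

theorem pair_whiskerLeft_assoc (x : G ⟶ X) (y : G ⟶ Y) (g : Y ⟶ Y') (h : X ⊗ Y' ⟶ W) :
    x ⊙ y ≫ X ◁ g ≫ h = x ⊙ (y ≫ g) ≫ h := by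
  rw [← Category.assoc, pair_whiskerLeft]

theorem pair_whiskerRight (x : G ⟶ X) (y : G ⟶ Y) (f : X ⟶ X') :
    x ⊙ y ≫ f ▷ Y = (x ≫ f) ⊙ y := by
  rw [← tensorHom_id, pair_tensorHom, Category.comp_id]

theorem pair_whiskerRight_assoc (x : G ⟶ X) (y : G ⟶ Y) (f : X ⟶ X') (h : X' ⊗ Y ⟶ W) :
    x ⊙ y ≫ f ▷ Y ≫ h = (x ≫ f) ⊙ y ≫ h := by
  rw [← Category.assoc, pair_whiskerRight]

theorem pair_associator (x : G ⟶ X) (y : G ⟶ Y) (z : G ⟶ Z) :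
    (x ⊙ y) ⊙ z ≫ (α_ X Y Z).hom = x ⊙ y ⊙ z := by
  have h : Δ[G] ▷ G ≫ (α_ G G G).hom = Δ[G] ▷ G ≫ (α_ G G G).hom := rfl
  calc (x ⊙ y) ⊙ z ≫ (α_ X Y Z).hom
      = Δ[G] ≫ Δ[G] ▷ G ≫ ((x ⊗ₘ y) ⊗ₘ z) ≫ (α_ X Y Z).hom := by
        simp [pair, MonoidalCategory.tensorHom_def]
    _ = (Δ[G] ≫ Δ[G] ▷ G ≫ (α_ G G G).hom) ≫ (x ⊗ₘ (y ⊗ₘ z)) := by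
        rw [associator_naturality]; simp
    _ = (Δ[G] ≫ G ◁ Δ[G]) ≫ (x ⊗ₘ (y ⊗ₘ z)) := by rw [comul_assoc]
    _ = x ⊙ y ⊙ z := by simp [pair, MonoidalCategory.tensorHom_def']

theorem pair_associator_assoc (x : G ⟶ X) (y : G ⟶ Y) (z : G ⟶ Z) (h : X ⊗ Y ⊗ Z ⟶ W) :
    (x ⊙ y) ⊙ z ≫ (α_ X Y Z).hom ≫ h = x ⊙ y ⊙ z ≫ h := by
  rw [← Category.assoc, pair_associator]

theorem pair_associator_inv (x : G ⟶ X) (y : G ⟶ Y) (z : G ⟶ Z) :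
    x ⊙ y ⊙ z ≫ (α_ X Y Z).inv = (x ⊙ y) ⊙ z := by
  rw [← pair_associator, Category.assoc, Iso.hom_inv_id, Category.comp_id]

theorem pair_associator_inv_assoc (x : G ⟶ X) (y : G ⟶ Y) (z : G ⟶ Z) (h : (X ⊗ Y) ⊗ Z ⟶ W) :
    x ⊙ y ⊙ z ≫ (α_ X Y Z).inv ≫ h = (x ⊙ y) ⊙ z ≫ h := by
  rw [← Category.assoc, pair_associator_inv]

variable [BraidedCategory C] [IsCommComonObj G]

theorem pair_braiding (x : G ⟶ X) (y : G ⟶ Y) : x ⊙ y ≫ (β_ X Y).hom = y ⊙ x := by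
  rw [pair, Category.assoc, BraidedCategory.braiding_naturality, IsCommComonObj.comul_comm_assoc,
    pair]

theorem pair_braiding_assoc (x : G ⟶ X) (y : G ⟶ Y) (h : Y ⊗ X ⟶ W) :
    x ⊙ y ≫ (β_ X Y).hom ≫ h = y ⊙ x ≫ h := by
  rw [← Category.assoc, pair_braiding]

end Pairing

section Additive

variable [Preadditive C] [MonoidalPreadditive C] {G X Y : C} [ComonObj G]

theorem add_pair (x x' : G ⟶ X) (y : G ⟶ Y) : (x + x') ⊙ y = x ⊙ y + x' ⊙ y := by
  simp [pair, MonoidalCategory.tensorHom_def]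

theorem pair_add (x : G ⟶ X) (y y' : G ⟶ Y) : x ⊙ (y + y') = x ⊙ y + x ⊙ y' := by
  simp [pair, MonoidalCategory.tensorHom_def]

theorem neg_pair (x : G ⟶ X) (y : G ⟶ Y) : (-x) ⊙ y = -x ⊙ y := by
  rw [eq_neg_iff_add_eq_zero, ← add_pair]; simp [pair, MonoidalCategory.tensorHom_def]

theorem pair_neg (x : G ⟶ X) (y : G ⟶ Y) : x ⊙ (-y) = -x ⊙ y := by
  rw [eq_neg_iff_add_eq_zero, ← pair_add]; simp [pair, MonoidalCategory.tensorHom_def]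

theorem zero_pair (y : G ⟶ Y) : (0 : G ⟶ X) ⊙ y = 0 := by
  simp [pair, MonoidalCategory.tensorHom_def]

theorem pair_zero (x : G ⟶ X) : x ⊙ (0 : G ⟶ Y) = 0 := by
  simp [pair, MonoidalCategory.tensorHom_def]

end Additive

end Elements

section Separation

set_option linter.unusedSectionVars false

variable {C : Type u} [Category.{v} C] [MonoidalCategory C] [SymmetricCategory C]
  [Preadditive C] [MonoidalPreadditive C] [HasBinaryBiproducts C]

local infixr:90 " ⊙ " => pair

theorem hom_comp_pair {G H X Y : C} [ComonObj G] [ComonObj H] (p : H ⟶ G) [IsComonHom p]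
    (x : G ⟶ X) (y : G ⟶ Y) : p ≫ x ⊙ y = (p ≫ x) ⊙ (p ≫ y) := by
  rw [pair, IsComonHom.hom_comul_assoc, tensorHom_comp_tensorHom, pair]

/-- The trivial square-zero extension `𝟙 ⊕ X`, a cocommutative comonoid in which `X` is primitive.
It carries the universal element of `X`. -/
noncomputable def DualNumbers (X : C) : C := 𝟙_ C ⊞ X

namespace DualNumbers

/-- The inclusion of the unit object. -/
noncomputable def one (X : C) : 𝟙_ C ⟶ DualNumbers X := biprod.inl

/-- The inclusion of the primitive part. -/
noncomputable def prim (X : C) : X ⟶ DualNumbers X := biprod.inr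

/-- The projection to the unit object. -/
noncomputable def counit (X : C) : DualNumbers X ⟶ 𝟙_ C := biprod.fst

theorem hom_ext {X W : C} {p q : DualNumbers X ⟶ W} (h : one X ≫ p = one X ≫ q)
    (h' : prim X ≫ p = prim X ≫ q) : p = q := biprod.hom_ext' _ _ h h'

theorem one_counit (X : C) : one X ≫ counit X = 𝟙 _ := biprod.inl_fst

theorem prim_counit (X : C) : prim X ≫ counit X = 0 := biprod.inr_fst

/-- The comultiplication `1 ↦ 1 ⊗ 1`, `x ↦ x ⊗ 1 + 1 ⊗ x`. -/
noncomputable def comul (X : C) : DualNumbers X ⟶ DualNumbers X ⊗ DualNumbers X :=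
  biprod.desc ((λ_ (𝟙_ C)).inv ≫ (one X ⊗ₘ one X))
    ((ρ_ X).inv ≫ (prim X ⊗ₘ one X) + (λ_ X).inv ≫ (one X ⊗ₘ prim X))

theorem one_comul (X : C) : one X ≫ comul X = (λ_ (𝟙_ C)).inv ≫ (one X ⊗ₘ one X) :=
  biprod.inl_desc _ _

theorem prim_comul (X : C) : prim X ≫ comul X =
    (ρ_ X).inv ≫ (prim X ⊗ₘ one X) + (λ_ X).inv ≫ (one X ⊗ₘ prim X) :=
  biprod.inr_desc _ _

theorem one_comul_assoc (X : C) {W : C} (h : DualNumbers X ⊗ DualNumbers X ⟶ W) :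
    one X ≫ comul X ≫ h = (λ_ (𝟙_ C)).inv ≫ (one X ⊗ₘ one X) ≫ h := by
  rw [← Category.assoc, one_comul, Category.assoc]

theorem prim_comul_assoc (X : C) {W : C} (h : DualNumbers X ⊗ DualNumbers X ⟶ W) :
    prim X ≫ comul X ≫ h =
      (ρ_ X).inv ≫ (prim X ⊗ₘ one X) ≫ h + (λ_ X).inv ≫ (one X ⊗ₘ prim X) ≫ h := by
  rw [← Category.assoc, prim_comul, Preadditive.add_comp, Category.assoc, Category.assoc]

noncomputable instance (X : C) : ComonObj (DualNumbers X) where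
  counit := counit X
  comul := comul X
  counit_comul := by
    apply hom_ext <;> simp only [one_comul_assoc, prim_comul_assoc,
      tensorHom_comp_whiskerRight, one_counit, prim_counit,
      id_tensorHom, MonoidalPreadditive.zero_tensor, comp_zero, zero_add, leftUnitor_inv_naturality]
  comul_counit := by
    apply hom_ext <;> simp only [one_comul_assoc, prim_comul_assoc,
      tensorHom_comp_whiskerLeft, one_counit, prim_counit,
      tensorHom_id, MonoidalPreadditive.tensor_zero, comp_zero, add_zero,
      rightUnitor_inv_naturality, unitors_inv_equal]
  comul_assoc := by
    apply hom_ext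
    · simp only [one_comul_assoc, tensorHom_comp_whiskerLeft, tensorHom_comp_whiskerRight_assoc,
        one_comul]
      simp only [MonoidalCategory.tensorHom_def, comp_whiskerRight, whiskerLeft_comp]
      monoidal
    · simp only [prim_comul_assoc, tensorHom_comp_whiskerLeft, tensorHom_comp_whiskerRight_assoc,
        one_comul, prim_comul, MonoidalPreadditive.tensor_add, MonoidalPreadditive.add_tensor,
        Preadditive.add_comp, Preadditive.comp_add, add_assoc]
      simp only [MonoidalCategory.tensorHom_def, comp_whiskerRight, whiskerLeft_comp]
      congr 1
      · monoidal
      congr 1 <;> monoidal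

instance (X : C) : IsCommComonObj (DualNumbers X) where
  comul_comm := by
    change comul X ≫ (β_ _ _).hom = comul X
    apply hom_ext
    · simp [one_comul, one_comul_assoc, unitors_inv_equal]
    · simp [prim_comul, prim_comul_assoc, add_comm]

end DualNumbers

/-- A class of pure generalized elements of `X` that is stable under restriction along morphisms of
comonoids and contains a split epimorphism. Elements of this class separate the morphisms out of
`X`. -/
class Probe (X : C) where
  El : ∀ {G : C} [ComonObj G] [IsCommComonObj G], (G ⟶ X) → Prop
  res : ∀ {G H : C} [ComonObj G] [IsCommComonObj G] [ComonObj H] [IsCommComonObj H] (p : H ⟶ G)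
    [IsComonHom p] (x : G ⟶ X), El x → El (p ≫ x)
  sep : ∃ (G : C) (_ : ComonObj G) (_ : IsCommComonObj G) (x : G ⟶ X), El x ∧ IsSplitEpi x

/-- All elements of `X` are considered as pure. -/
instance (priority := low) Probe.leaf (X : C) : Probe X where
  El _ := True
  res _ _ _ _ := trivial
  sep := ⟨DualNumbers X, inferInstance, inferInstance, (biprod.snd : 𝟙_ C ⊞ X ⟶ X), trivial,
    inferInstanceAs (IsSplitEpi (biprod.snd : 𝟙_ C ⊞ X ⟶ X))⟩

theorem projections_pair {G H X Y : C} [ComonObj G] [ComonObj H] (x : G ⟶ X) (y : H ⟶ Y) :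
    ((G ◁ ε[H] ≫ (ρ_ G).hom) ≫ x) ⊙ ((ε[G] ▷ H ≫ (λ_ H).hom) ≫ y) = x ⊗ₘ y := by
  have h : Δ[G ⊗ H] ≫ ((G ◁ ε[H] ≫ (ρ_ G).hom) ⊗ₘ (ε[G] ▷ H ≫ (λ_ H).hom)) = 𝟙 (G ⊗ H) := by
    rw [Comon.tensorObj_comul, Category.assoc, ← tensorHom_comp_tensorHom, ← id_tensorHom,
      ← tensorHom_id, ← tensorμ_natural_assoc, tensorHom_comp_tensorHom_assoc, id_tensorHom,
      tensorHom_id, comul_counit, counit_comul]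
    simp only [tensorμ, braiding_tensorUnit_left, MonoidalCategory.tensorHom_def]
    monoidal
  rw [pair, ← tensorHom_comp_tensorHom, reassoc_of% h]

instance (G H : C) [ComonObj G] [ComonObj H] : IsComonHom (G ◁ ε[H] ≫ (ρ_ G).hom) where
  hom_counit := by simp [MonoidalCategory.tensorHom_def', unitors_equal]
  hom_comul := by
    have h : ε[H] ≫ (λ_ (𝟙_ C)).inv = Δ[H] ≫ (ε[H] ⊗ₘ ε[H]) := (counit_comul_hom _).symm
    have h' : (G ◁ ε[H] ≫ (ρ_ G).hom ⊗ₘ G ◁ ε[H] ≫ (ρ_ G).hom) =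
      ((𝟙 G ⊗ₘ ε[H]) ⊗ₘ (𝟙 G ⊗ₘ ε[H])) ≫ ((ρ_ G).hom ⊗ₘ (ρ_ G).hom) := by
      rw [tensorHom_comp_tensorHom, id_tensorHom]
    rw [Comon.tensorObj_comul, h', Category.assoc, Category.assoc, ← tensorμ_natural_assoc,
      tensorHom_comp_tensorHom_assoc, ← h]
    rw [id_tensorHom_id, Category.comp_id, MonoidalCategory.tensorHom_def' Δ[G]]
    simp only [tensorμ, braiding_tensorUnit_right, MonoidalCategory.tensorHom_def]
    monoidal

instance (G H : C) [ComonObj G] [ComonObj H] : IsComonHom (ε[G] ▷ H ≫ (λ_ H).hom) where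
  hom_counit := by simp [MonoidalCategory.tensorHom_def]
  hom_comul := by
    have h : ε[G] ≫ (λ_ (𝟙_ C)).inv = Δ[G] ≫ (ε[G] ⊗ₘ ε[G]) := (counit_comul_hom _).symm
    have h' : (ε[G] ▷ H ≫ (λ_ H).hom ⊗ₘ ε[G] ▷ H ≫ (λ_ H).hom) =
      ((ε[G] ⊗ₘ 𝟙 H) ⊗ₘ (ε[G] ⊗ₘ 𝟙 H)) ≫ ((λ_ H).hom ⊗ₘ (λ_ H).hom) := by
      rw [tensorHom_comp_tensorHom, tensorHom_id]
    rw [Comon.tensorObj_comul, h', Category.assoc, Category.assoc, ← tensorμ_natural_assoc,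
      tensorHom_comp_tensorHom_assoc, ← h]
    simp only [tensorμ, braiding_tensorUnit_left, MonoidalCategory.tensorHom_def]
    monoidal

/-- The pure elements of a tensor product are the pairs of pure elements. -/
instance Probe.tensor (X Y : C) [Probe X] [Probe Y] : Probe (X ⊗ Y) where
  El {G} _ _ z := ∃ (x : G ⟶ X) (y : G ⟶ Y), Probe.El x ∧ Probe.El y ∧ z = x ⊙ y
  res := by
    rintro G H _ _ _ _ p _ _ ⟨x, y, hx, hy, rfl⟩
    exact ⟨p ≫ x, p ≫ y, Probe.res p x hx, Probe.res p y hy, hom_comp_pair p x y⟩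
  sep := by
    obtain ⟨G, _, _, x, hx, _⟩ := Probe.sep (X := X)
    obtain ⟨H, _, _, y, hy, _⟩ := Probe.sep (X := Y)
    refine ⟨G ⊗ H, inferInstance, inferInstance, x ⊗ₘ y, ⟨_, _, Probe.res _ x hx,
      Probe.res _ y hy, (projections_pair x y).symm⟩, ?_⟩
    exact ⟨⟨⟨section_ x ⊗ₘ section_ y, by simp [tensorHom_comp_tensorHom]⟩⟩⟩

/-- Morphisms that agree on pure elements are equal. -/
theorem pure_ext {X W : C} [Probe X] {p q : X ⟶ W}
    (h : ∀ (G : C) [ComonObj G] [IsCommComonObj G] (x : G ⟶ X), Probe.El x → x ≫ p = x ≫ q) :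
    p = q := by
  obtain ⟨G, _, _, x, hx, _⟩ := Probe.sep (X := X)
  rw [← cancel_epi x, h G x hx]

end Separation

/-! ### Derivations -/

attribute [simp] pair_tensorHom pair_tensorHom_assoc pair_whiskerLeft pair_whiskerLeft_assoc
  pair_whiskerRight pair_whiskerRight_assoc pair_associator pair_associator_assoc
  pair_associator_inv pair_associator_inv_assoc pair_braiding pair_braiding_assoc
  add_pair pair_add neg_pair pair_neg zero_pair pair_zero

section Desuspension

variable {C : Type u} [Category.{v} C] [MonoidalCategory C] [SymmetricCategory C]

/-- Tensoring with an invertible object is an equivalence of categories, hence a full functor. -/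
theorem exists_whiskerLeft_eq {S Sinv : C} (e : Sinv ⊗ S ≅ 𝟙_ C) {P Q : C} (F : S ⊗ P ⟶ S ⊗ Q) :
    ∃ g : P ⟶ Q, S ◁ g = F := by
  let E : C ≌ C := CategoryTheory.Equivalence.mk (tensorLeft S) (tensorLeft Sinv)
    ((leftUnitorNatIso C).symm ≪≫ (curriedTensor C).mapIso e.symm ≪≫ tensorLeftTensor Sinv S)
    ((tensorLeftTensor S Sinv).symm ≪≫ (curriedTensor C).mapIso (β_ S Sinv ≪≫ e) ≪≫
      leftUnitorNatIso C)
  exact E.functor.map_surjective F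

end Desuspension

section Derivations

set_option linter.unusedSectionVars false

variable {C : Type u} [Category.{v} C] [MonoidalCategory C] [SymmetricCategory C]
  [Preadditive C] [MonoidalPreadditive C] [HasBinaryBiproducts C]

local infixr:90 " ⊙ " => pair

/-- A morphism `D : U ⊗ X ⟶ W` is, for each value of its first argument, a derivation with respect
to a product on `X` and to left and right multiplications of `X` on `W`. -/
def IsDer {U X W : C} (mul : X ⊗ X ⟶ X) (l : X ⊗ W ⟶ W) (r : W ⊗ X ⟶ W) (D : U ⊗ X ⟶ W) : Prop :=
  ∀ ⦃G : C⦄ [ComonObj G] [IsCommComonObj G] (u : G ⟶ U) (x y : G ⟶ X),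
    u ⊙ (x ⊙ y ≫ mul) ≫ D = x ⊙ (u ⊙ y ≫ D) ≫ l + (u ⊙ x ≫ D) ⊙ y ≫ r

/-- The derivation property can be checked on pure elements of the parameter. -/
theorem IsDer.of_pure {U X W : C} [Probe U] {mul : X ⊗ X ⟶ X} {l : X ⊗ W ⟶ W} {r : W ⊗ X ⟶ W}
    {D : U ⊗ X ⟶ W}
    (h : ∀ ⦃G : C⦄ [ComonObj G] [IsCommComonObj G] (u : G ⟶ U) (x y : G ⟶ X), Probe.El u →
      u ⊙ (x ⊙ y ≫ mul) ≫ D = x ⊙ (u ⊙ y ≫ D) ≫ l + (u ⊙ x ≫ D) ⊙ y ≫ r) :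
    IsDer mul l r D := by
  have key : U ◁ mul ≫ D = ((α_ U X X).inv ≫ (β_ U X).hom ▷ X ≫ (α_ X U X).hom) ≫ X ◁ D ≫ l +
      (α_ U X X).inv ≫ D ▷ X ≫ r := by
    let : Probe X := Probe.leaf X
    apply pure_ext
    rintro G _ _ _ ⟨u, _, hu, ⟨x, y, -, -, rfl⟩, rfl⟩
    simpa using h u x y hu
  intro G _ _ u x y
  simpa using congrArg (u ⊙ x ⊙ y ≫ ·) key

theorem mul_assoc_elem {B : AssocMon C} {G : C} [ComonObj G] (x y z : G ⟶ B.X) :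
    (x ⊙ y ≫ B.mul) ⊙ z ≫ B.mul = x ⊙ (y ⊙ z ≫ B.mul) ≫ B.mul := by
  rw [← pair_whiskerRight_assoc, B.assoc, pair_associator_assoc, pair_whiskerLeft_assoc]

section Ext

variable [HasCoequalizers C] [∀ X : C, PreservesColimitsOfShape WalkingParallelPair (tensorLeft X)]
  [HasCoproductsOfShape ℕ C] [∀ X : C, PreservesColimitsOfShape (Discrete ℕ) (tensorLeft X)]
  {A : AssocMon C} (M : ABimod A) {G : C} [ComonObj G]

theorem mul_iA (a : G ⟶ A.X) (t : G ⟶ TX M) : (a ≫ iA M) ⊙ t ≫ Tmul M = a ⊙ t ≫ TactA M := by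
  rw [← iA_Tmul, pair_whiskerRight_assoc]

theorem mul_iM (m : G ⟶ M.X) (t : G ⟶ TX M) : (m ≫ iM M) ⊙ t ≫ Tmul M = m ⊙ t ≫ TactM M := by
  rw [← iM_Tmul, pair_whiskerRight_assoc]

theorem mul_iA_iA (a a' : G ⟶ A.X) :
    (a ≫ iA M) ⊙ (a' ≫ iA M) ≫ Tmul M = a ⊙ a' ≫ A.mul ≫ iA M := by
  rw [mul_iA, ← iA_TactA, pair_whiskerLeft_assoc]

theorem mul_iA_iP (n : ℕ) (a : G ⟶ A.X) (t : G ⟶ (tpow M n).X) :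
    (a ≫ iA M) ⊙ (t ≫ iP M n) ≫ Tmul M = a ⊙ t ≫ (tpow M n).act ≫ iP M n := by
  rw [mul_iA, ← iP_TactA, pair_whiskerLeft_assoc]

theorem mul_iA_iM (a : G ⟶ A.X) (m : G ⟶ M.X) :
    (a ≫ iA M) ⊙ (m ≫ iM M) ≫ Tmul M = a ⊙ m ≫ M.actL ≫ iM M :=
  mul_iA_iP M 0 a m

theorem mul_iM_iA (m : G ⟶ M.X) (a : G ⟶ A.X) :
    (m ≫ iM M) ⊙ (a ≫ iA M) ≫ Tmul M = m ⊙ a ≫ M.actR ≫ iM M := by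
  rw [mul_iM, ← iA_TactM, pair_whiskerLeft_assoc]

theorem mul_iM_iP (n : ℕ) (m : G ⟶ M.X) (t : G ⟶ (tpow M n).X) :
    (m ≫ iM M) ⊙ (t ≫ iP M n) ≫ Tmul M = m ⊙ t ≫ step M n ≫ iP M (n + 1) := by
  rw [mul_iM, ← iP_TactM, pair_whiskerLeft_assoc]

theorem Tmul_assoc_elem (x y z : G ⟶ TX M) :
    (x ⊙ y ≫ Tmul M) ⊙ z ≫ Tmul M = x ⊙ (y ⊙ z ≫ Tmul M) ≫ Tmul M :=
  mul_assoc_elem (B := T M) x y z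

variable {M}

/-- `T_A(M)` is generated by `A` and `M`: derivations that agree on them are equal. -/
theorem IsDer.ext {U W : C} {l : TX M ⊗ W ⟶ W} {r : W ⊗ TX M ⟶ W} {D D' : U ⊗ TX M ⟶ W}
    (h : IsDer (Tmul M) l r D) (h' : IsDer (Tmul M) l r D')
    (hA : U ◁ iA M ≫ D = U ◁ iA M ≫ D') (hM : U ◁ iM M ≫ D = U ◁ iM M ≫ D') : D = D' := by
  refine T_extL M U hA fun n => ?_
  induction n with
  | zero => exact hM
  | succ n ih =>
    rw [← cancel_epi (U ◁ step M n)]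
    let : Probe U := Probe.leaf U
    apply pure_ext
    rintro G _ _ _ ⟨u, _, -, ⟨m, t, -, -, rfl⟩, rfl⟩
    have e1 : u ⊙ (m ≫ iM M) ≫ D = u ⊙ (m ≫ iM M) ≫ D' := by
      simpa using congrArg (u ⊙ m ≫ ·) hM
    have e2 : u ⊙ (t ≫ iP M n) ≫ D = u ⊙ (t ≫ iP M n) ≫ D' := by
      simpa using congrArg (u ⊙ t ≫ ·) ih
    simp only [pair_whiskerLeft_assoc, Category.assoc]
    rw [← mul_iM_iP, h, h', e1, e2]

end Ext

end Derivations

/-! ### Extension of derivations to the tensor algebra -/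

section Extension

set_option linter.unusedSectionVars false

variable {C : Type u} [Category.{v} C] [MonoidalCategory C] [SymmetricCategory C]
  [Preadditive C] [MonoidalPreadditive C] [HasBinaryBiproducts C]

local infixr:90 " ⊙ " => pair

/-- The associativity laws for commuting left and right multiplications of `X` on `W`. -/
structure IsBimodule {X W : C} (mul : X ⊗ X ⟶ X) (l : X ⊗ W ⟶ W) (r : W ⊗ X ⟶ W) : Prop where
  left : ∀ ⦃G : C⦄ [ComonObj G] [IsCommComonObj G] (x y : G ⟶ X) (w : G ⟶ W),
    (x ⊙ y ≫ mul) ⊙ w ≫ l = x ⊙ (y ⊙ w ≫ l) ≫ l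
  right : ∀ ⦃G : C⦄ [ComonObj G] [IsCommComonObj G] (x y : G ⟶ X) (w : G ⟶ W),
    w ⊙ (x ⊙ y ≫ mul) ≫ r = (w ⊙ x ≫ r) ⊙ y ≫ r
  middle : ∀ ⦃G : C⦄ [ComonObj G] [IsCommComonObj G] (x y : G ⟶ X) (w : G ⟶ W),
    (x ⊙ w ≫ l) ⊙ y ≫ r = x ⊙ (w ⊙ y ≫ r) ≫ l

variable [HasCoequalizers C] [∀ X : C, PreservesColimitsOfShape WalkingParallelPair (tensorLeft X)]
  [HasCoproductsOfShape ℕ C] [∀ X : C, PreservesColimitsOfShape (Discrete ℕ) (tensorLeft X)]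
  {A : AssocMon C} {M : ABimod A}

/-- Values on `A` and on `M` for a derivation of `T_A(M)`, with the Leibniz rules for the product of
`A` and for the two actions of `A` on `M`. -/
structure IsDerGen {U W : C} (M : ABimod A) (l : TX M ⊗ W ⟶ W) (r : W ⊗ TX M ⟶ W)
    (dA : U ⊗ A.X ⟶ W) (dM : U ⊗ M.X ⟶ W) : Prop where
  bimod : IsBimodule (Tmul M) l r
  mul : ∀ ⦃G : C⦄ [ComonObj G] [IsCommComonObj G] (u : G ⟶ U) (a a' : G ⟶ A.X),
    u ⊙ (a ⊙ a' ≫ A.mul) ≫ dA =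
      (a ≫ iA M) ⊙ (u ⊙ a' ≫ dA) ≫ l + (u ⊙ a ≫ dA) ⊙ (a' ≫ iA M) ≫ r
  actL : ∀ ⦃G : C⦄ [ComonObj G] [IsCommComonObj G] (u : G ⟶ U) (a : G ⟶ A.X) (m : G ⟶ M.X),
    u ⊙ (a ⊙ m ≫ M.actL) ≫ dM =
      (a ≫ iA M) ⊙ (u ⊙ m ≫ dM) ≫ l + (u ⊙ a ≫ dA) ⊙ (m ≫ iM M) ≫ r
  actR : ∀ ⦃G : C⦄ [ComonObj G] [IsCommComonObj G] (u : G ⟶ U) (m : G ⟶ M.X) (a : G ⟶ A.X),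
    u ⊙ (m ⊙ a ≫ M.actR) ≫ dM =
      (m ≫ iM M) ⊙ (u ⊙ a ≫ dA) ≫ l + (u ⊙ m ≫ dM) ⊙ (a ≫ iA M) ≫ r

section

variable {U W : C} {l : TX M ⊗ W ⟶ W} {r : W ⊗ TX M ⟶ W} {dA : U ⊗ A.X ⟶ W} {dM : U ⊗ M.X ⟶ W}

/-- A derivation on the tensor power with `n + 1` factors: a morphism with the Leibniz rule for the
left action of `A`. -/
structure DerPow (l : TX M ⊗ W ⟶ W) (r : W ⊗ TX M ⟶ W) (dA : U ⊗ A.X ⟶ W) (n : ℕ) where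
  map : U ⊗ (tpow M n).X ⟶ W
  act : ∀ ⦃G : C⦄ [ComonObj G] [IsCommComonObj G] (u : G ⟶ U) (a : G ⟶ A.X)
    (t : G ⟶ (tpow M n).X), u ⊙ (a ⊙ t ≫ (tpow M n).act) ≫ map =
      (a ≫ iA M) ⊙ (u ⊙ t ≫ map) ≫ l + (u ⊙ a ≫ dA) ⊙ (t ≫ iP M n) ≫ r

/-- The morphism `u ⊗ m ⊗ t ↦ m D(u, t) + D(u, m) t`. -/
noncomputable def DerPow.preSucc {n : ℕ} (D : DerPow l r dA n) (dM : U ⊗ M.X ⟶ W) :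
    U ⊗ (M.X ⊗ (tpow M n).X) ⟶ W :=
  (α_ U M.X (tpow M n).X).inv ≫ (β_ U M.X).hom ▷ (tpow M n).X ≫ (α_ M.X U (tpow M n).X).hom ≫
      (iM M ⊗ₘ D.map) ≫ l +
    (α_ U M.X (tpow M n).X).inv ≫ (dM ⊗ₘ iP M n) ≫ r

theorem DerPow.pair_preSucc {n : ℕ} (D : DerPow l r dA n) {G : C} [ComonObj G] [IsCommComonObj G]
    (u : G ⟶ U) (m : G ⟶ M.X) (t : G ⟶ (tpow M n).X) :
    u ⊙ m ⊙ t ≫ D.preSucc dM =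
      (m ≫ iM M) ⊙ (u ⊙ t ≫ D.map) ≫ l + (u ⊙ m ≫ dM) ⊙ (t ≫ iP M n) ≫ r := by
  simp [DerPow.preSucc]

/-- The inductive step of the extension of a derivation to the tensor powers. -/
noncomputable def DerPow.succMap (h : IsDerGen M l r dA dM) {n : ℕ} (D : DerPow l r dA n) :
    U ⊗ (tpow M (n + 1)).X ⟶ W :=
  coeqDescL _ _ U (D.preSucc dM) (by
    let : Probe U := Probe.leaf U
    apply pure_ext
    rintro G _ _ _ ⟨u, _, -, ⟨_, t, ⟨m, a, -, -, rfl⟩, -, rfl⟩, rfl⟩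
    simp only [pair_whiskerLeft_assoc, pair_whiskerRight, pair_associator_assoc, pair_whiskerLeft,
      D.pair_preSucc, h.actR, D.act, Category.assoc]
    rw [← mul_iM_iA, h.bimod.left, ← mul_iA_iP, h.bimod.right]
    simp only [pair_add, add_pair, Preadditive.add_comp, h.bimod.middle]
    abel)

theorem DerPow.pair_succMap (h : IsDerGen M l r dA dM) {n : ℕ} (D : DerPow l r dA n)
    {G : C} [ComonObj G] [IsCommComonObj G]
    (u : G ⟶ U) (m : G ⟶ M.X) (t : G ⟶ (tpow M n).X) :
    u ⊙ (m ⊙ t ≫ step M n) ≫ D.succMap h =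
      (m ≫ iM M) ⊙ (u ⊙ t ≫ D.map) ≫ l + (u ⊙ m ≫ dM) ⊙ (t ≫ iP M n) ≫ r := by
  have e : U ◁ step M n ≫ D.succMap h = D.preSucc dM := coeqDescL_fac _ _ _ _ _
  rw [← D.pair_preSucc, ← e, pair_whiskerLeft_assoc]

theorem DerPow.succ_act (h : IsDerGen M l r dA dM) {n : ℕ} (D : DerPow l r dA n)
    ⦃G : C⦄ [ComonObj G] [IsCommComonObj G] (u : G ⟶ U) (a : G ⟶ A.X)
    (t : G ⟶ (tpow M (n + 1)).X) : u ⊙ (a ⊙ t ≫ (tpow M (n + 1)).act) ≫ D.succMap h =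
      (a ≫ iA M) ⊙ (u ⊙ t ≫ D.succMap h) ≫ l + (u ⊙ a ≫ dA) ⊙ (t ≫ iP M (n + 1)) ≫ r := by
  have key : U ◁ (tpow M (n + 1)).act ≫ D.succMap h =
      ((α_ U A.X _).inv ≫ (β_ U A.X).hom ▷ _ ≫ (α_ A.X U _).hom) ≫ (iA M ⊗ₘ D.succMap h) ≫ l +
        (α_ U A.X _).inv ≫ (dA ⊗ₘ iP M (n + 1)) ≫ r := by
    have : Epi (U ◁ A.X ◁ step M n) :=
      inferInstanceAs (Epi ((tensorLeft A.X ⋙ tensorLeft U).map (coequalizer.π _ _)))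
    rw [← cancel_epi (U ◁ A.X ◁ step M n)]
    let : Probe U := Probe.leaf U
    apply pure_ext
    rintro G _ _ _ ⟨u, _, -, ⟨a, _, -, ⟨m, t, -, -, rfl⟩, rfl⟩, rfl⟩
    have e1 : a ⊙ (m ⊙ t ≫ step M n) ≫ (tpow M (n + 1)).act =
        (a ⊙ m ≫ M.actL) ⊙ t ≫ step M n := by
      rw [← pair_whiskerLeft_assoc, step_act]
      simp
    simp only [pair_whiskerLeft_assoc, pair_whiskerLeft, Preadditive.comp_add,
      pair_associator_inv_assoc, pair_whiskerRight_assoc, pair_braiding, pair_associator_assoc,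
      pair_tensorHom_assoc, Category.assoc]
    rw [e1, D.pair_succMap h, D.pair_succMap h, h.actL, Category.assoc, ← mul_iA_iM, h.bimod.left,
      ← mul_iM_iP, h.bimod.right]
    simp only [pair_add, add_pair, Preadditive.add_comp, h.bimod.middle]
    abel
  simpa using congrArg (u ⊙ a ⊙ t ≫ ·) key

/-- The extension of a derivation to the tensor powers. -/
noncomputable def derPow (h : IsDerGen M l r dA dM) : ∀ n, DerPow l r dA n
  | 0 => ⟨dM, h.actL⟩
  | n + 1 => ⟨(derPow h n).succMap h, (derPow h n).succ_act h⟩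

/-- The derivation of `T_A(M)` with given values on `A` and on `M`. -/
noncomputable def derExt (h : IsDerGen M l r dA dM) : U ⊗ TX M ⟶ W :=
  TdescL M U dA fun n => (derPow h n).map

theorem pair_iA_derExt (h : IsDerGen M l r dA dM) {G : C} [ComonObj G] (u : G ⟶ U)
    (a : G ⟶ A.X) : u ⊙ (a ≫ iA M) ≫ derExt h = u ⊙ a ≫ dA := by
  rw [← pair_whiskerLeft_assoc, derExt, iA_TdescL]

theorem pair_iP_derExt (h : IsDerGen M l r dA dM) {G : C} [ComonObj G] (n : ℕ) (u : G ⟶ U)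
    (t : G ⟶ (tpow M n).X) : u ⊙ (t ≫ iP M n) ≫ derExt h = u ⊙ t ≫ (derPow h n).map := by
  rw [← pair_whiskerLeft_assoc, derExt, iP_TdescL]

theorem pair_iM_derExt (h : IsDerGen M l r dA dM) {G : C} [ComonObj G] (u : G ⟶ U)
    (m : G ⟶ M.X) : u ⊙ (m ≫ iM M) ≫ derExt h = u ⊙ m ≫ dM :=
  pair_iP_derExt h 0 u m

/-- The Leibniz rule of a morphism on `T_A(M)`, for a left factor given by a morphism to
`T_A(M)`. -/
def LeibnizAt (l : TX M ⊗ W ⟶ W) (r : W ⊗ TX M ⟶ W) (D : U ⊗ TX M ⟶ W) {X : C} (i : X ⟶ TX M) :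
    Prop :=
  ∀ ⦃G : C⦄ [ComonObj G] [IsCommComonObj G] (u : G ⟶ U) (x : G ⟶ X) (y : G ⟶ TX M),
    u ⊙ ((x ≫ i) ⊙ y ≫ Tmul M) ≫ D = (x ≫ i) ⊙ (u ⊙ y ≫ D) ≫ l + (u ⊙ (x ≫ i) ≫ D) ⊙ y ≫ r

theorem leibnizAt_iff {D : U ⊗ TX M ⟶ W} {X : C} (i : X ⟶ TX M) : LeibnizAt l r D i ↔
    U ◁ (i ▷ TX M) ≫ U ◁ Tmul M ≫ D =
      U ◁ (i ▷ TX M) ≫ ((α_ U _ _).inv ≫ (β_ U _).hom ▷ TX M ≫ (α_ _ U _).hom ≫ TX M ◁ D ≫ l +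
        (α_ U _ _).inv ≫ D ▷ TX M ≫ r) := by
  constructor
  · intro h
    let : Probe U := Probe.leaf U
    let : Probe X := Probe.leaf X
    apply pure_ext
    rintro G _ _ _ ⟨u, _, -, ⟨x, t, -, -, rfl⟩, rfl⟩
    simpa using h u x t
  · intro h G _ _ u x y
    simpa using congrArg (u ⊙ x ⊙ y ≫ ·) h

theorem isDer_of_leibnizAt {D : U ⊗ TX M ⟶ W} (hA : LeibnizAt l r D (iA M))
    (hP : ∀ n, LeibnizAt l r D (iP M n)) : IsDer (Tmul M) l r D := by
  have key : LeibnizAt l r D (𝟙 _) := by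
    rw [leibnizAt_iff, id_whiskerRight, whiskerLeft_id, Category.id_comp, Category.id_comp]
    simp only [leibnizAt_iff] at hA hP
    rw [← cancel_epi (α_ U (TX M) (TX M)).hom]
    refine T_extM M _ _ ?_ fun n => ?_
    · simpa using (α_ U _ _).hom ≫= hA
    · simpa using (α_ U _ _).hom ≫= hP n
  intro G _ _ u x y
  simpa using key u x y

theorem leibnizAt_of_components {D : U ⊗ TX M ⟶ W} {X : C} {i : X ⟶ TX M}
    (hA : ∀ ⦃G : C⦄ [ComonObj G] [IsCommComonObj G] (u : G ⟶ U) (x : G ⟶ X) (a : G ⟶ A.X),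
      u ⊙ ((x ≫ i) ⊙ (a ≫ iA M) ≫ Tmul M) ≫ D =
        (x ≫ i) ⊙ (u ⊙ (a ≫ iA M) ≫ D) ≫ l + (u ⊙ (x ≫ i) ≫ D) ⊙ (a ≫ iA M) ≫ r)
    (hP : ∀ n ⦃G : C⦄ [ComonObj G] [IsCommComonObj G] (u : G ⟶ U) (x : G ⟶ X)
      (t : G ⟶ (tpow M n).X), u ⊙ ((x ≫ i) ⊙ (t ≫ iP M n) ≫ Tmul M) ≫ D =
        (x ≫ i) ⊙ (u ⊙ (t ≫ iP M n) ≫ D) ≫ l + (u ⊙ (x ≫ i) ≫ D) ⊙ (t ≫ iP M n) ≫ r) :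
    LeibnizAt l r D i := by
  rw [leibnizAt_iff]
  let : Probe U := Probe.leaf U
  let : Probe X := Probe.leaf X
  refine (cancel_epi (α_ U X (TX M)).hom).1 (T_extL M _ ?_ fun n => ?_)
  · let : Probe A.X := Probe.leaf A.X
    apply pure_ext
    rintro G _ _ _ ⟨_, a, ⟨u, x, -, -, rfl⟩, -, rfl⟩
    simpa using hA u x a
  · let : Probe (tpow M n).X := Probe.leaf _
    apply pure_ext
    rintro G _ _ _ ⟨_, t, ⟨u, x, -, -, rfl⟩, -, rfl⟩
    simpa using hP n u x t

theorem derExt_isDer (h : IsDerGen M l r dA dM) : IsDer (Tmul M) l r (derExt h) := by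
  have hM : LeibnizAt l r (derExt h) (iM M) := by
    refine leibnizAt_of_components (fun G _ _ u m a => ?_) fun n G _ _ u m t => ?_
    · rw [mul_iM_iA, pair_iA_derExt, pair_iM_derExt, ← h.actR, ← pair_iM_derExt h, Category.assoc]
    · rw [mul_iM_iP, pair_iP_derExt, pair_iM_derExt, ← Category.assoc (m ⊙ t), pair_iP_derExt]
      exact (derPow h n).pair_succMap h u m t
  refine isDer_of_leibnizAt (leibnizAt_of_components (fun G _ _ u a a' => ?_)
    fun n G _ _ u a t => ?_) fun n => ?_
  · rw [mul_iA_iA, pair_iA_derExt, pair_iA_derExt, ← h.mul, ← pair_iA_derExt h, Category.assoc]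
  · rw [mul_iA_iP, pair_iP_derExt, pair_iA_derExt, ← (derPow h n).act, ← pair_iP_derExt h,
      Category.assoc]
  · induction n with
    | zero => exact hM
    | succ n ih =>
      have : Epi (U ◁ step M n ▷ TX M) :=
        inferInstanceAs (Epi ((tensorRight (TX M) ⋙ tensorLeft U).map (coequalizer.π _ _)))
      rw [leibnizAt_iff, ← cancel_epi (U ◁ step M n ▷ TX M), ← whiskerLeft_comp_assoc,
        ← whiskerLeft_comp_assoc, ← comp_whiskerRight]
      let : Probe U := Probe.leaf U
      apply pure_ext
      rintro G _ _ _ ⟨u, _, -, ⟨_, y, ⟨m, t, -, -, rfl⟩, -, rfl⟩, rfl⟩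
      simp only [pair_whiskerLeft_assoc, Preadditive.comp_add,
        pair_associator_inv_assoc, pair_whiskerRight_assoc, pair_whiskerRight, pair_braiding,
        pair_associator_assoc, Category.assoc]
      rw [← mul_iM_iP, Tmul_assoc_elem, hM, ih, hM, h.bimod.left, h.bimod.right]
      simp only [pair_add, add_pair, Preadditive.add_comp, h.bimod.middle]
      abel

end

end Extension

/-! ### External and internal actions, derivations in one variable -/

section Suspension

set_option linter.unusedSectionVars false

variable {C : Type u} [Category.{v} C] [MonoidalCategory C] [SymmetricCategory C]

local infixr:90 " ⊙ " => pair

section Evaluation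

variable {G S U V P X X' Y Y' Z W : C} [ComonObj G] [IsCommComonObj G] (s : G ⟶ S) (a : G ⟶ P)
  (x : G ⟶ X) (y : G ⟶ Y) (z : G ⟶ Z) (u : G ⟶ U) (v : G ⟶ V)

@[simp]
theorem pair_extL (act : P ⊗ X ⟶ X') :
    a ⊙ (s ⊙ x) ⊙ y ≫ extL S act Y = (s ⊙ (a ⊙ x ≫ act)) ⊙ y := by
  simp [extL]

@[simp]
theorem pair_extL_assoc (act : P ⊗ X ⟶ X') (h : (S ⊗ X') ⊗ Y ⟶ W) :
    a ⊙ (s ⊙ x) ⊙ y ≫ extL S act Y ≫ h = (s ⊙ (a ⊙ x ≫ act)) ⊙ y ≫ h := by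
  simp [extL]

@[simp]
theorem pair_extR (act : Y ⊗ P ⟶ Y') :
    ((s ⊙ x) ⊙ y) ⊙ a ≫ extR S X act = (s ⊙ x) ⊙ (y ⊙ a ≫ act) := by
  simp [extR]

@[simp]
theorem pair_extR_assoc (act : Y ⊗ P ⟶ Y') (h : (S ⊗ X) ⊗ Y' ⟶ W) :
    ((s ⊙ x) ⊙ y) ⊙ a ≫ extR S X act ≫ h = (s ⊙ x) ⊙ (y ⊙ a ≫ act) ≫ h := by
  simp [extR]

@[simp]
theorem pair_intL (act : P ⊗ Y ⟶ Y') :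
    a ⊙ (s ⊙ x) ⊙ y ≫ intL S X act = (s ⊙ x) ⊙ (a ⊙ y ≫ act) := by
  simp [intL]

@[simp]
theorem pair_intL_assoc (act : P ⊗ Y ⟶ Y') (h : (S ⊗ X) ⊗ Y' ⟶ W) :
    a ⊙ (s ⊙ x) ⊙ y ≫ intL S X act ≫ h = (s ⊙ x) ⊙ (a ⊙ y ≫ act) ≫ h := by
  simp [intL]

@[simp]
theorem pair_intR (act : X ⊗ P ⟶ X') :
    ((s ⊙ x) ⊙ y) ⊙ a ≫ intR S act Y = (s ⊙ (x ⊙ a ≫ act)) ⊙ y := by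
  simp [intR]

@[simp]
theorem pair_intR_assoc (act : X ⊗ P ⟶ X') (h : (S ⊗ X') ⊗ Y ⟶ W) :
    ((s ⊙ x) ⊙ y) ⊙ a ≫ intR S act Y ≫ h = (s ⊙ (x ⊙ a ≫ act)) ⊙ y ≫ h := by
  simp [intR]

@[simp]
theorem pair_fstOutL : (s ⊙ a ⊙ x) ⊙ y ≫ fstOutL S P X Y = a ⊙ (s ⊙ x) ⊙ y := by
  simp [fstOutL]

@[simp]
theorem pair_fstOutL_assoc (h : P ⊗ (S ⊗ X) ⊗ Y ⟶ W) :
    (s ⊙ a ⊙ x) ⊙ y ≫ fstOutL S P X Y ≫ h = a ⊙ (s ⊙ x) ⊙ y ≫ h := by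
  rw [← Category.assoc, pair_fstOutL]

@[simp]
theorem pair_fstOutR : (s ⊙ x ⊙ a) ⊙ y ≫ fstOutR S X P Y = ((s ⊙ x) ⊙ y) ⊙ a := by
  simp [fstOutR]

@[simp]
theorem pair_fstOutR_assoc (h : ((S ⊗ X) ⊗ Y) ⊗ P ⟶ W) :
    (s ⊙ x ⊙ a) ⊙ y ≫ fstOutR S X P Y ≫ h = ((s ⊙ x) ⊙ y) ⊙ a ≫ h := by
  rw [← Category.assoc, pair_fstOutR]

@[simp]
theorem pair_sndOutL : u ⊙ s ⊙ a ⊙ x ≫ sndOutL S U P X = a ⊙ u ⊙ s ⊙ x := by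
  simp [sndOutL]

@[simp]
theorem pair_sndOutL_assoc (h : P ⊗ U ⊗ S ⊗ X ⟶ W) :
    u ⊙ s ⊙ a ⊙ x ≫ sndOutL S U P X ≫ h = a ⊙ u ⊙ s ⊙ x ≫ h := by
  rw [← Category.assoc, pair_sndOutL]

@[simp]
theorem pair_sndOutR : u ⊙ s ⊙ x ⊙ a ≫ sndOutR S U X P = (u ⊙ s ⊙ x) ⊙ a := by
  simp [sndOutR]

@[simp]
theorem pair_sndOutR_assoc (h : (U ⊗ S ⊗ X) ⊗ P ⟶ W) :
    u ⊙ s ⊙ x ⊙ a ≫ sndOutR S U X P ≫ h = (u ⊙ s ⊙ x) ⊙ a ≫ h := by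
  rw [← Category.assoc, pair_sndOutR]

@[simp]
theorem pair_sSwap : (s ⊙ x) ⊙ y ≫ sSwap S X Y = (s ⊙ y) ⊙ x := by
  simp [sSwap]

@[simp]
theorem pair_sSwap_assoc (h : (S ⊗ Y) ⊗ X ⟶ W) :
    (s ⊙ x) ⊙ y ≫ sSwap S X Y ≫ h = (s ⊙ y) ⊙ x ≫ h := by
  simp [sSwap]

@[simp]
theorem pair_rotIn₁ : u ⊙ v ⊙ x ≫ rotIn₁ U V X = x ⊙ u ⊙ v := by
  simp [rotIn₁]

@[simp]
theorem pair_rotIn₁_assoc (h : X ⊗ U ⊗ V ⟶ W) :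
    u ⊙ v ⊙ x ≫ rotIn₁ U V X ≫ h = x ⊙ u ⊙ v ≫ h := by
  simp [rotIn₁]

@[simp]
theorem pair_rotIn₂_assoc (h : V ⊗ X ⊗ U ⟶ W) :
    u ⊙ v ⊙ x ≫ rotIn₂ U V X ≫ h = v ⊙ x ⊙ u ≫ h := by
  simp [rotIn₂]

@[simp]
theorem pair_rotOut₁ : ((s ⊙ x) ⊙ y) ⊙ z ≫ rotOut₁ S X Y Z = ((s ⊙ y) ⊙ z) ⊙ x := by
  simp [rotOut₁]

@[simp]
theorem pair_rotOut₁_assoc (h : ((S ⊗ Y) ⊗ Z) ⊗ X ⟶ W) :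
    ((s ⊙ x) ⊙ y) ⊙ z ≫ rotOut₁ S X Y Z ≫ h = ((s ⊙ y) ⊙ z) ⊙ x ≫ h := by
  simp [rotOut₁]

@[simp]
theorem pair_rotOut₂ : ((s ⊙ x) ⊙ y) ⊙ z ≫ rotOut₂ S X Y Z = ((s ⊙ z) ⊙ x) ⊙ y := by
  simp [rotOut₂]

@[simp]
theorem pair_rotOut₂_assoc (h : ((S ⊗ Z) ⊗ X) ⊗ Y ⟶ W) :
    ((s ⊙ x) ⊙ y) ⊙ z ≫ rotOut₂ S X Y Z ≫ h = ((s ⊙ z) ⊙ x) ⊙ y ≫ h := by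
  simp [rotOut₂]

end Evaluation

variable [Preadditive C] [MonoidalPreadditive C] [HasBinaryBiproducts C]

section Actions

variable {G S P X X' Y Y' : C} [ComonObj G] [IsCommComonObj G]

theorem intL_sSwap (act : P ⊗ Y ⟶ Y') (a : G ⟶ P) (z : G ⟶ (S ⊗ X) ⊗ Y) :
    a ⊙ z ≫ intL S X act ≫ sSwap S X Y' = a ⊙ (z ≫ sSwap S X Y) ≫ extL S act X := by
  have key : intL S X act ≫ sSwap S X Y' = P ◁ sSwap S X Y ≫ extL S act X := by
    apply pure_ext
    rintro G _ _ _ ⟨a, _, -, ⟨_, y, ⟨s, x, -, -, rfl⟩, -, rfl⟩, rfl⟩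
    simp
  simpa using a ⊙ z ≫= key

theorem intR_sSwap (act : X ⊗ P ⟶ X') (a : G ⟶ P) (z : G ⟶ (S ⊗ X) ⊗ Y) :
    z ⊙ a ≫ intR S act Y ≫ sSwap S X' Y = (z ≫ sSwap S X Y) ⊙ a ≫ extR S Y act := by
  have key : intR S act Y ≫ sSwap S X' Y = sSwap S X Y ▷ P ≫ extR S Y act := by
    apply pure_ext
    rintro G _ _ _ ⟨_, a, ⟨_, y, ⟨s, x, -, -, rfl⟩, -, rfl⟩, -, rfl⟩
    simp
  simpa using z ⊙ a ≫= key

theorem extL_sSwap (act : P ⊗ X ⟶ X') (a : G ⟶ P) (z : G ⟶ (S ⊗ X) ⊗ Y) :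
    a ⊙ z ≫ extL S act Y ≫ sSwap S X' Y = a ⊙ (z ≫ sSwap S X Y) ≫ intL S Y act := by
  have key : extL S act Y ≫ sSwap S X' Y = P ◁ sSwap S X Y ≫ intL S Y act := by
    apply pure_ext
    rintro G _ _ _ ⟨a, _, -, ⟨_, y, ⟨s, x, -, -, rfl⟩, -, rfl⟩, rfl⟩
    simp
  simpa using a ⊙ z ≫= key

theorem extR_sSwap (act : Y ⊗ P ⟶ Y') (a : G ⟶ P) (z : G ⟶ (S ⊗ X) ⊗ Y) :
    z ⊙ a ≫ extR S X act ≫ sSwap S X Y' = (z ≫ sSwap S X Y) ⊙ a ≫ intR S act X := by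
  have key : extR S X act ≫ sSwap S X Y' = sSwap S X Y ▷ P ≫ intR S act X := by
    apply pure_ext
    rintro G _ _ _ ⟨_, a, ⟨_, y, ⟨s, x, -, -, rfl⟩, -, rfl⟩, -, rfl⟩
    simp
  simpa using z ⊙ a ≫= key

theorem sSwap_sSwap : sSwap S X Y ≫ sSwap S Y X = 𝟙 _ := by
  apply pure_ext
  rintro G _ _ _ ⟨_, y, ⟨s, x, -, -, rfl⟩, -, rfl⟩
  simp

/-- The external bimodule structure on `Σ B ⊗ B`. -/
theorem isBimodule_ext (S : C) (B : AssocMon C) :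
    IsBimodule B.mul (extL S B.mul B.X) (extR S B.X B.mul) where
  left G _ _ x y w := by
    have key : (α_ _ _ _).inv ≫ B.mul ▷ _ ≫ extL S B.mul B.X =
        B.X ◁ extL S B.mul B.X ≫ extL S B.mul B.X := by
      apply pure_ext
      rintro G _ _ _ ⟨x, _, -, ⟨y, _, -, ⟨_, z, ⟨s, w, -, -, rfl⟩, -, rfl⟩, rfl⟩, rfl⟩
      simp [mul_assoc_elem]
    simpa only [pair_whiskerLeft, pair_whiskerLeft_assoc, pair_whiskerRight,
      pair_whiskerRight_assoc, pair_associator_assoc, pair_associator_inv_assoc,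
      pair_braiding_assoc, pair_braiding] using x ⊙ y ⊙ w ≫= key
  right G _ _ x y w := by
    have key : (α_ _ _ _).hom ≫ _ ◁ B.mul ≫ extR S B.X B.mul =
        extR S B.X B.mul ▷ B.X ≫ extR S B.X B.mul := by
      apply pure_ext
      rintro G _ _ _ ⟨_, y, ⟨_, x, ⟨_, z, ⟨s, w, -, -, rfl⟩, -, rfl⟩, -, rfl⟩, -, rfl⟩
      simp [mul_assoc_elem]
    simpa only [pair_whiskerLeft, pair_whiskerLeft_assoc, pair_whiskerRight,
      pair_whiskerRight_assoc, pair_associator_assoc, pair_associator_inv_assoc,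
      pair_braiding_assoc, pair_braiding] using (w ⊙ x) ⊙ y ≫= key
  middle G _ _ x y w := by
    have key : extL S B.mul B.X ▷ B.X ≫ extR S B.X B.mul =
        (α_ _ _ _).hom ≫ B.X ◁ extR S B.X B.mul ≫ extL S B.mul B.X := by
      apply pure_ext
      rintro G _ _ _ ⟨_, y, ⟨x, _, -, ⟨_, z, ⟨s, w, -, -, rfl⟩, -, rfl⟩, rfl⟩, -, rfl⟩
      simp
    simpa only [pair_whiskerLeft, pair_whiskerLeft_assoc, pair_whiskerRight,
      pair_whiskerRight_assoc, pair_associator_assoc, pair_associator_inv_assoc,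
      pair_braiding_assoc, pair_braiding] using (x ⊙ w) ⊙ y ≫= key

/-- The internal bimodule structure on `Σ B ⊗ B`. -/
theorem isBimodule_int (S : C) (B : AssocMon C) :
    IsBimodule B.mul (intL S B.X B.mul) (intR S B.mul B.X) where
  left G _ _ x y w := by
    have key : (α_ _ _ _).inv ≫ B.mul ▷ _ ≫ intL S B.X B.mul =
        B.X ◁ intL S B.X B.mul ≫ intL S B.X B.mul := by
      apply pure_ext
      rintro G _ _ _ ⟨x, _, -, ⟨y, _, -, ⟨_, z, ⟨s, w, -, -, rfl⟩, -, rfl⟩, rfl⟩, rfl⟩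
      simp [mul_assoc_elem]
    simpa only [pair_whiskerLeft, pair_whiskerLeft_assoc, pair_whiskerRight,
      pair_whiskerRight_assoc, pair_associator_assoc, pair_associator_inv_assoc,
      pair_braiding_assoc, pair_braiding] using x ⊙ y ⊙ w ≫= key
  right G _ _ x y w := by
    have key : (α_ _ _ _).hom ≫ _ ◁ B.mul ≫ intR S B.mul B.X =
        intR S B.mul B.X ▷ B.X ≫ intR S B.mul B.X := by
      apply pure_ext
      rintro G _ _ _ ⟨_, y, ⟨_, x, ⟨_, z, ⟨s, w, -, -, rfl⟩, -, rfl⟩, -, rfl⟩, -, rfl⟩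
      simp [mul_assoc_elem]
    simpa only [pair_whiskerLeft, pair_whiskerLeft_assoc, pair_whiskerRight,
      pair_whiskerRight_assoc, pair_associator_assoc, pair_associator_inv_assoc,
      pair_braiding_assoc, pair_braiding] using (w ⊙ x) ⊙ y ≫= key
  middle G _ _ x y w := by
    have key : intL S B.X B.mul ▷ B.X ≫ intR S B.mul B.X =
        (α_ _ _ _).hom ≫ B.X ◁ intR S B.mul B.X ≫ intL S B.X B.mul := by
      apply pure_ext
      rintro G _ _ _ ⟨_, y, ⟨x, _, -, ⟨_, z, ⟨s, w, -, -, rfl⟩, -, rfl⟩, rfl⟩, -, rfl⟩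
      simp
    simpa only [pair_whiskerLeft, pair_whiskerLeft_assoc, pair_whiskerRight,
      pair_whiskerRight_assoc, pair_associator_assoc, pair_associator_inv_assoc,
      pair_braiding_assoc, pair_braiding] using (x ⊙ w) ⊙ y ≫= key

variable (B : AssocMon C) (x y : G ⟶ B.X) (w : G ⟶ (S ⊗ B.X) ⊗ B.X)

theorem intL_extL : x ⊙ (y ⊙ w ≫ extL S B.mul B.X) ≫ intL S B.X B.mul =
    y ⊙ (x ⊙ w ≫ intL S B.X B.mul) ≫ extL S B.mul B.X := by
  have key : B.X ◁ extL S B.mul B.X ≫ intL S B.X B.mul =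
      (α_ _ _ _).inv ≫ (β_ _ _).hom ▷ _ ≫ (α_ _ _ _).hom ≫
        B.X ◁ intL S B.X B.mul ≫ extL S B.mul B.X := by
    apply pure_ext
    rintro G _ _ _ ⟨x, _, -, ⟨y, _, -, ⟨_, z, ⟨s, w, -, -, rfl⟩, -, rfl⟩, rfl⟩, rfl⟩
    simp
  simpa only [pair_whiskerLeft, pair_whiskerLeft_assoc, pair_whiskerRight,
      pair_whiskerRight_assoc, pair_associator_assoc, pair_associator_inv_assoc,
      pair_braiding_assoc, pair_braiding] using x ⊙ y ⊙ w ≫= key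

theorem intL_extR : x ⊙ (w ⊙ y ≫ extR S B.X B.mul) ≫ intL S B.X B.mul =
    (x ⊙ w ≫ intL S B.X B.mul) ⊙ y ≫ extR S B.X B.mul := by
  have key : B.X ◁ extR S B.X B.mul ≫ intL S B.X B.mul =
      (α_ _ _ _).inv ≫ intL S B.X B.mul ▷ B.X ≫ extR S B.X B.mul := by
    apply pure_ext
    rintro G _ _ _ ⟨x, _, -, ⟨_, y, ⟨_, z, ⟨s, w, -, -, rfl⟩, -, rfl⟩, -, rfl⟩, rfl⟩
    simp [mul_assoc_elem]
  simpa only [pair_whiskerLeft, pair_whiskerLeft_assoc, pair_whiskerRight,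
      pair_whiskerRight_assoc, pair_associator_assoc, pair_associator_inv_assoc,
      pair_braiding_assoc, pair_braiding] using x ⊙ w ⊙ y ≫= key

theorem intR_extL : (y ⊙ w ≫ extL S B.mul B.X) ⊙ x ≫ intR S B.mul B.X =
    y ⊙ (w ⊙ x ≫ intR S B.mul B.X) ≫ extL S B.mul B.X := by
  have key : extL S B.mul B.X ▷ B.X ≫ intR S B.mul B.X =
      (α_ _ _ _).hom ≫ B.X ◁ intR S B.mul B.X ≫ extL S B.mul B.X := by
    apply pure_ext
    rintro G _ _ _ ⟨_, x, ⟨y, _, -, ⟨_, z, ⟨s, w, -, -, rfl⟩, -, rfl⟩, rfl⟩, -, rfl⟩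
    simp [mul_assoc_elem]
  simpa only [pair_whiskerLeft, pair_whiskerLeft_assoc, pair_whiskerRight,
      pair_whiskerRight_assoc, pair_associator_assoc, pair_associator_inv_assoc,
      pair_braiding_assoc, pair_braiding] using (y ⊙ w) ⊙ x ≫= key

theorem intR_extR : (w ⊙ y ≫ extR S B.X B.mul) ⊙ x ≫ intR S B.mul B.X =
    (w ⊙ x ≫ intR S B.mul B.X) ⊙ y ≫ extR S B.X B.mul := by
  have key : extR S B.X B.mul ▷ B.X ≫ intR S B.mul B.X =
      (α_ _ _ _).hom ≫ _ ◁ (β_ _ _).hom ≫ (α_ _ _ _).inv ≫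
        intR S B.mul B.X ▷ B.X ≫ extR S B.X B.mul := by
    apply pure_ext
    rintro G _ _ _ ⟨_, x, ⟨_, y, ⟨_, z, ⟨s, w, -, -, rfl⟩, -, rfl⟩, -, rfl⟩, -, rfl⟩
    simp
  simpa only [pair_whiskerLeft, pair_whiskerLeft_assoc, pair_whiskerRight,
      pair_whiskerRight_assoc, pair_associator_assoc, pair_associator_inv_assoc,
      pair_braiding_assoc, pair_braiding] using (w ⊙ y) ⊙ x ≫= key

end Actions

section Variables

variable {U V S X W : C}

/-- The derivation property of `f : U ⊗ Σ X ⟶ W` in its second variable. -/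
def IsDerSnd (mul : X ⊗ X ⟶ X) (l : X ⊗ W ⟶ W) (r : W ⊗ X ⟶ W) (f : U ⊗ (S ⊗ X) ⟶ W) : Prop :=
  IsDer mul l r ((α_ U S X).hom ≫ f)

/-- The derivation property of `f : Σ X ⊗ V ⟶ W` in its first variable. -/
def IsDerFst (mul : X ⊗ X ⟶ X) (l : X ⊗ W ⟶ W) (r : W ⊗ X ⟶ W) (f : (S ⊗ X) ⊗ V ⟶ W) : Prop :=
  IsDerSnd mul l r ((β_ V (S ⊗ X)).hom ≫ f)

variable {mul : X ⊗ X ⟶ X} {l : X ⊗ W ⟶ W} {r : W ⊗ X ⟶ W}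

theorem isDerSnd_of_pure [Probe U] {f : U ⊗ (S ⊗ X) ⟶ W}
    (h : ∀ ⦃G : C⦄ [ComonObj G] [IsCommComonObj G] (u : G ⟶ U) (s : G ⟶ S) (x y : G ⟶ X),
      Probe.El u → u ⊙ (s ⊙ (x ⊙ y ≫ mul)) ≫ f =
        x ⊙ (u ⊙ s ⊙ y ≫ f) ≫ l + (u ⊙ s ⊙ x ≫ f) ⊙ y ≫ r) :
    IsDerSnd mul l r f := by
  let : Probe S := Probe.leaf S
  refine IsDer.of_pure ?_
  rintro G _ _ _ x y ⟨u, s, hu, -, rfl⟩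
  simpa using h u s x y hu

theorem IsDerSnd.apply {f : U ⊗ (S ⊗ X) ⟶ W} (h : IsDerSnd mul l r f) {G : C} [ComonObj G]
    [IsCommComonObj G] (u : G ⟶ U) (s : G ⟶ S) (x y : G ⟶ X) :
    u ⊙ s ⊙ (x ⊙ y ≫ mul) ≫ f =
        x ⊙ (u ⊙ s ⊙ y ≫ f) ≫ l + (u ⊙ s ⊙ x ≫ f) ⊙ y ≫ r := by
  simpa using h (u ⊙ s) x y

theorem isDerFst_of_pure [Probe V] {f : (S ⊗ X) ⊗ V ⟶ W}
    (h : ∀ ⦃G : C⦄ [ComonObj G] [IsCommComonObj G] (v : G ⟶ V) (s : G ⟶ S) (x y : G ⟶ X),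
      Probe.El v → (s ⊙ (x ⊙ y ≫ mul)) ⊙ v ≫ f =
        x ⊙ ((s ⊙ y) ⊙ v ≫ f) ≫ l + ((s ⊙ x) ⊙ v ≫ f) ⊙ y ≫ r) :
    IsDerFst mul l r f := by
  refine isDerSnd_of_pure fun G _ _ v s x y hv => ?_
  simpa using h v s x y hv

theorem IsDerFst.apply {f : (S ⊗ X) ⊗ V ⟶ W} (h : IsDerFst mul l r f) {G : C} [ComonObj G]
    [IsCommComonObj G] (v : G ⟶ V) (s : G ⟶ S) (x y : G ⟶ X) :
    (s ⊙ (x ⊙ y ≫ mul)) ⊙ v ≫ f =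
        x ⊙ ((s ⊙ y) ⊙ v ≫ f) ≫ l + ((s ⊙ x) ⊙ v ≫ f) ⊙ y ≫ r := by
  simpa using IsDerSnd.apply h v s x y

/-- Restriction of the parameter of a derivation. -/
theorem IsDerSnd.whiskerRight {U' : C} {f : U ⊗ (S ⊗ X) ⟶ W} (h : IsDerSnd mul l r f)
    (i : U' ⟶ U) : IsDerSnd mul l r (i ▷ (S ⊗ X) ≫ f) := by
  let : Probe U' := Probe.leaf U'
  refine isDerSnd_of_pure fun G _ _ u s x y _ => ?_
  simp [h.apply]

end Variables

section Generators

variable [HasCoequalizers C] [∀ X : C, PreservesColimitsOfShape WalkingParallelPair (tensorLeft X)]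
  [HasCoproductsOfShape ℕ C] [∀ X : C, PreservesColimitsOfShape (Discrete ℕ) (tensorLeft X)]
  {A : AssocMon C} {M : ABimod A} {U V S W : C}
  {l l' : TX M ⊗ W ⟶ W} {r r' : W ⊗ TX M ⟶ W}

theorem IsDerSnd.ext {f f' : U ⊗ (S ⊗ TX M) ⟶ W} (h : IsDerSnd (Tmul M) l r f)
    (h' : IsDerSnd (Tmul M) l r f') (hA : U ◁ S ◁ iA M ≫ f = U ◁ S ◁ iA M ≫ f')
    (hM : U ◁ S ◁ iM M ≫ f = U ◁ S ◁ iM M ≫ f') : f = f' := by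
  rw [← cancel_epi (α_ U S (TX M)).hom]
  refine IsDer.ext h h' ?_ ?_
  · simpa using (α_ U S _).hom ≫= hA
  · simpa using (α_ U S _).hom ≫= hM

theorem IsDerFst.ext {f f' : (S ⊗ TX M) ⊗ V ⟶ W} (h : IsDerFst (Tmul M) l r f)
    (h' : IsDerFst (Tmul M) l r f') (hA : (S ◁ iA M) ▷ V ≫ f = (S ◁ iA M) ▷ V ≫ f')
    (hM : (S ◁ iM M) ▷ V ≫ f = (S ◁ iM M) ▷ V ≫ f') : f = f' := by
  rw [← cancel_epi (β_ V (S ⊗ TX M)).hom]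
  refine IsDerSnd.ext h h' ?_ ?_
  · rw [BraidedCategory.braiding_naturality_right_assoc, hA,
      ← BraidedCategory.braiding_naturality_right_assoc]
  · rw [BraidedCategory.braiding_naturality_right_assoc, hM,
      ← BraidedCategory.braiding_naturality_right_assoc]

/-- Biderivations of `T_A(M)` that agree on the generators are equal. -/
theorem biderivation_ext {f f' : (S ⊗ TX M) ⊗ (S ⊗ TX M) ⟶ W} (h₁ : IsDerFst (Tmul M) l r f)
    (h₁' : IsDerFst (Tmul M) l r f') (h₂ : IsDerSnd (Tmul M) l' r' f)
    (h₂' : IsDerSnd (Tmul M) l' r' f')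
    (hAA : (S ◁ iA M ⊗ₘ S ◁ iA M) ≫ f = (S ◁ iA M ⊗ₘ S ◁ iA M) ≫ f')
    (hAM : (S ◁ iA M ⊗ₘ S ◁ iM M) ≫ f = (S ◁ iA M ⊗ₘ S ◁ iM M) ≫ f')
    (hMA : (S ◁ iM M ⊗ₘ S ◁ iA M) ≫ f = (S ◁ iM M ⊗ₘ S ◁ iA M) ≫ f')
    (hMM : (S ◁ iM M ⊗ₘ S ◁ iM M) ≫ f = (S ◁ iM M ⊗ₘ S ◁ iM M) ≫ f') : f = f' := by
  simp only [MonoidalCategory.tensorHom_def', Category.assoc] at hAA hAM hMA hMM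
  exact h₁.ext h₁' ((h₂.whiskerRight _).ext (h₂'.whiskerRight _) hAA hAM)
    ((h₂.whiskerRight _).ext (h₂'.whiskerRight _) hMA hMM)

end Generators

end Suspension

/-! ### The double jacobiator as a derivation -/

section Poisson

set_option linter.unusedSectionVars false

variable {C : Type u} [Category.{v} C] [MonoidalCategory C] [SymmetricCategory C]
  [Preadditive C] [MonoidalPreadditive C] [HasBinaryBiproducts C]

attribute [-simp] MonoidalCategory.tensor_whiskerLeft MonoidalCategory.whiskerRight_tensor
  MonoidalCategory.whisker_assoc BraidedCategory.braiding_tensor_left_hom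
  BraidedCategory.braiding_tensor_right_hom

local infixr:90 " ⊙ " => pair

section Opposite

variable {S U V T : C}

/-- The antisymmetric counterpart of a morphism with values in `Σ T ⊗ T`. -/
def swapNeg (d : U ⊗ V ⟶ (S ⊗ T) ⊗ T) : V ⊗ U ⟶ (S ⊗ T) ⊗ T :=
  -((β_ V U).hom ≫ d ≫ sSwap S T T)

theorem pair_swapNeg (d : U ⊗ V ⟶ (S ⊗ T) ⊗ T) {G : C} [ComonObj G] [IsCommComonObj G]
    (u : G ⟶ U) (v : G ⟶ V) : v ⊙ u ≫ swapNeg d = -(u ⊙ v ≫ d ≫ sSwap S T T) := by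
  simp [swapNeg]

theorem IsDerSnd.swapNeg {μ : T ⊗ T ⟶ T} {d : U ⊗ (S ⊗ T) ⟶ (S ⊗ T) ⊗ T}
    (h : IsDerSnd μ (extL S μ T) (extR S T μ) d) :
    IsDerFst μ (intL S T μ) (intR S μ T) (swapNeg d) := by
  let : Probe U := Probe.leaf U
  refine isDerFst_of_pure fun G _ _ u s x y _ => ?_
  rw [pair_swapNeg, ← Category.assoc, h.apply]
  simp [pair_swapNeg, extL_sSwap, extR_sSwap]
  abel

theorem IsDerFst.swapNeg {μ : T ⊗ T ⟶ T} {d : (S ⊗ T) ⊗ V ⟶ (S ⊗ T) ⊗ T}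
    (h : IsDerFst μ (intL S T μ) (intR S μ T) d) :
    IsDerSnd μ (extL S μ T) (extR S T μ) (swapNeg d) := by
  let : Probe V := Probe.leaf V
  refine isDerSnd_of_pure fun G _ _ u s x y _ => ?_
  rw [pair_swapNeg, ← Category.assoc, h.apply]
  simp [pair_swapNeg, intL_sSwap, intR_sSwap]
  abel

end Opposite

section Derivation

variable {S : C} {B : AssocMon C} {f : (S ⊗ B.X) ⊗ (S ⊗ B.X) ⟶ (S ⊗ B.X) ⊗ B.X}

/-- A double Poisson bracket is a derivation in its first variable, for the internal structure. -/
theorem IsDoublePoisson.isDerFst (h : IsDoublePoisson S B f) :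
    IsDerFst B.mul (intL S B.X B.mul) (intR S B.mul B.X) f := by
  let : Probe (S ⊗ B.X) := Probe.leaf _
  refine isDerFst_of_pure fun G _ _ v s x y _ => ?_
  simpa using (s ⊙ x ⊙ y) ⊙ v ≫= h.derivation

theorem pair_antisymm {X : C} {f : (S ⊗ X) ⊗ (S ⊗ X) ⟶ (S ⊗ X) ⊗ X}
    (h : f = -((β_ (S ⊗ X) (S ⊗ X)).hom ≫ f ≫ sSwap S X X)) {G : C} [ComonObj G]
    [IsCommComonObj G] (u v : G ⟶ S ⊗ X) : u ⊙ v ≫ f = -(v ⊙ u ≫ f ≫ sSwap S X X) := by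
  calc u ⊙ v ≫ f = u ⊙ v ≫ (-((β_ (S ⊗ X) (S ⊗ X)).hom ≫ f ≫ sSwap S X X)) := by rw [← h]
    _ = _ := by rw [Preadditive.comp_neg, pair_braiding_assoc]

/-- By antisymmetry, a derivation in the first variable for the internal structure is a derivation
in the second variable for the external structure. -/
theorem isDerSnd_of_antisymm (h : f = -((β_ (S ⊗ B.X) (S ⊗ B.X)).hom ≫ f ≫ sSwap S B.X B.X))
    (h' : IsDerFst B.mul (intL S B.X B.mul) (intR S B.mul B.X) f) :
    IsDerSnd B.mul (extL S B.mul B.X) (extR S B.X B.mul) f := by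
  have e : swapNeg f = f := h.symm
  exact e ▸ h'.swapNeg

theorem IsDoublePoisson.isDerSnd (h : IsDoublePoisson S B f) :
    IsDerSnd B.mul (extL S B.mul B.X) (extR S B.X B.mul) f :=
  isDerSnd_of_antisymm h.antisymm h.isDerFst

end Derivation

section Rotations

variable {S X Y Z W : C}

theorem rotOut₁_rotOut₁ : rotOut₁ S X Y Z ≫ rotOut₁ S Y Z X = rotOut₂ S X Y Z := by
  apply pure_ext
  rintro G _ _ _ ⟨_, z, ⟨_, y, ⟨s, x, -, -, rfl⟩, -, rfl⟩, -, rfl⟩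
  simp

theorem rotOut₁_rotOut₂ : rotOut₁ S X Y Z ≫ rotOut₂ S Y Z X = 𝟙 _ := by
  apply pure_ext
  rintro G _ _ _ ⟨_, z, ⟨_, y, ⟨s, x, -, -, rfl⟩, -, rfl⟩, -, rfl⟩
  simp

theorem rotOut₂_rotOut₁ : rotOut₂ S X Y Z ≫ rotOut₁ S Z X Y = 𝟙 _ := by
  apply pure_ext
  rintro G _ _ _ ⟨_, z, ⟨_, y, ⟨s, x, -, -, rfl⟩, -, rfl⟩, -, rfl⟩
  simp

theorem rotOut₂_rotOut₂ : rotOut₂ S X Y Z ≫ rotOut₂ S Z X Y = rotOut₁ S X Y Z := by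
  apply pure_ext
  rintro G _ _ _ ⟨_, z, ⟨_, y, ⟨s, x, -, -, rfl⟩, -, rfl⟩, -, rfl⟩
  simp

end Rotations

section Jacobiator

variable (S : C) {X : C}

/-- The bracket with the first factor: `u ⊗ (w ⊗ z) ↦ f(u, w) ⊗ z`. -/
def bracketFst (f : (S ⊗ X) ⊗ (S ⊗ X) ⟶ (S ⊗ X) ⊗ X) :
    (S ⊗ X) ⊗ ((S ⊗ X) ⊗ X) ⟶ ((S ⊗ X) ⊗ X) ⊗ X :=
  (α_ _ _ _).inv ≫ f ▷ X

/-- The outer left multiplication on `Σ X ⊗ X ⊗ X`. -/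
def outL (mul : X ⊗ X ⟶ X) : X ⊗ (((S ⊗ X) ⊗ X) ⊗ X) ⟶ ((S ⊗ X) ⊗ X) ⊗ X :=
  (α_ _ _ _).inv ≫ extL S mul X ▷ X

/-- The outer right multiplication on `Σ X ⊗ X ⊗ X`. -/
def outR (mul : X ⊗ X ⟶ X) : (((S ⊗ X) ⊗ X) ⊗ X) ⊗ X ⟶ ((S ⊗ X) ⊗ X) ⊗ X :=
  (α_ _ _ _).hom ≫ _ ◁ mul

variable {S} {G : C} [ComonObj G] [IsCommComonObj G]

theorem pair_bracketFst (f : (S ⊗ X) ⊗ (S ⊗ X) ⟶ (S ⊗ X) ⊗ X) (u w : G ⟶ S ⊗ X) (z : G ⟶ X) :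
    u ⊙ w ⊙ z ≫ bracketFst S f = (u ⊙ w ≫ f) ⊙ z := by
  simp [bracketFst]

theorem pair_bracketFst_assoc (f : (S ⊗ X) ⊗ (S ⊗ X) ⟶ (S ⊗ X) ⊗ X) (u w : G ⟶ S ⊗ X)
    (z : G ⟶ X) {W : C} (h : ((S ⊗ X) ⊗ X) ⊗ X ⟶ W) :
    u ⊙ w ⊙ z ≫ bracketFst S f ≫ h = (u ⊙ w ≫ f) ⊙ z ≫ h := by
  simp [bracketFst]

theorem pair_outL (mul : X ⊗ X ⟶ X) (x z : G ⟶ X) (w : G ⟶ (S ⊗ X) ⊗ X) :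
    x ⊙ w ⊙ z ≫ outL S mul = (x ⊙ w ≫ extL S mul X) ⊙ z := by
  simp [outL]

theorem pair_outR (mul : X ⊗ X ⟶ X) (x z : G ⟶ X) (w : G ⟶ (S ⊗ X) ⊗ X) :
    (w ⊙ z) ⊙ x ≫ outR S mul = w ⊙ (z ⊙ x ≫ mul) := by
  simp [outR]

theorem pair_doubleJacobiator (f : (S ⊗ X) ⊗ (S ⊗ X) ⟶ (S ⊗ X) ⊗ X) (u v w : G ⟶ S ⊗ X) :
    u ⊙ v ⊙ w ≫ doubleJacobiator S X f =
      u ⊙ (v ⊙ w ≫ f) ≫ bracketFst S f + w ⊙ (u ⊙ v ≫ f) ≫ bracketFst S f ≫ rotOut₁ S X X X +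
        v ⊙ (w ⊙ u ≫ f) ≫ bracketFst S f ≫ rotOut₂ S X X X := by
  simp [doubleJacobiator, nest, bracketFst]

variable (mul : X ⊗ X ⟶ X)

theorem intL_rotOut₁ (x z : G ⟶ X) (k : G ⟶ (S ⊗ X) ⊗ X) :
    (x ⊙ k ≫ intL S X mul) ⊙ z ≫ rotOut₁ S X X X =
      x ⊙ (k ⊙ z ≫ rotOut₁ S X X X) ≫ outL S mul := by
  have key : intL S X mul ▷ X ≫ rotOut₁ S X X X =
      (α_ _ _ _).hom ≫ X ◁ rotOut₁ S X X X ≫ outL S mul := by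
    apply pure_ext
    rintro G _ _ _ ⟨_, z, ⟨x, _, -, ⟨_, y, ⟨s, w, -, -, rfl⟩, -, rfl⟩, rfl⟩, -, rfl⟩
    simp [pair_outL]
  simpa only [pair_whiskerLeft_assoc, pair_whiskerRight_assoc, pair_associator_assoc]
    using (x ⊙ k) ⊙ z ≫= key

theorem intR_rotOut₁ (y z : G ⟶ X) (k : G ⟶ (S ⊗ X) ⊗ X) :
    (k ⊙ y ≫ intR S mul X) ⊙ z ≫ rotOut₁ S X X X =
      (k ⊙ z ≫ rotOut₁ S X X X) ⊙ y ≫ outR S mul := by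
  have key : intR S mul X ▷ X ≫ rotOut₁ S X X X =
      (α_ _ _ _).hom ≫ _ ◁ (β_ _ _).hom ≫ (α_ _ _ _).inv ≫ rotOut₁ S X X X ▷ X ≫ outR S mul := by
    apply pure_ext
    rintro G _ _ _ ⟨_, z, ⟨_, y, ⟨_, k, ⟨s, w, -, -, rfl⟩, -, rfl⟩, -, rfl⟩, -, rfl⟩
    simp [pair_outR]
  simpa only [pair_whiskerLeft_assoc, pair_whiskerRight_assoc, pair_associator_assoc,
    pair_associator_inv_assoc, pair_braiding] using (k ⊙ y) ⊙ z ≫= key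

theorem mul_rotOut₂ (x z : G ⟶ X) (k : G ⟶ (S ⊗ X) ⊗ X) :
    k ⊙ (x ⊙ z ≫ mul) ≫ rotOut₂ S X X X =
      x ⊙ (k ⊙ z ≫ rotOut₂ S X X X) ≫ outL S mul := by
  have key : _ ◁ mul ≫ rotOut₂ S X X X =
      (α_ _ _ _).inv ≫ (β_ _ _).hom ▷ _ ≫ (α_ _ _ _).hom ≫ X ◁ rotOut₂ S X X X ≫ outL S mul := by
    apply pure_ext
    rintro G _ _ _ ⟨_, _, ⟨_, k, ⟨s, w, -, -, rfl⟩, -, rfl⟩, ⟨x, z, -, -, rfl⟩, rfl⟩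
    simp [pair_outL]
  simpa only [pair_whiskerLeft_assoc, pair_whiskerRight_assoc, pair_associator_assoc,
    pair_associator_inv_assoc, pair_braiding] using k ⊙ x ⊙ z ≫= key

theorem extR_rotOut₂ (y z : G ⟶ X) (k : G ⟶ (S ⊗ X) ⊗ X) :
    (k ⊙ y ≫ extR S X mul) ⊙ z ≫ rotOut₂ S X X X =
      (k ⊙ z ≫ rotOut₂ S X X X) ⊙ y ≫ outR S mul := by
  have key : extR S X mul ▷ X ≫ rotOut₂ S X X X =
      (α_ _ _ _).hom ≫ _ ◁ (β_ _ _).hom ≫ (α_ _ _ _).inv ≫ rotOut₂ S X X X ▷ X ≫ outR S mul := by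
    apply pure_ext
    rintro G _ _ _ ⟨_, z, ⟨_, y, ⟨_, k, ⟨s, w, -, -, rfl⟩, -, rfl⟩, -, rfl⟩, -, rfl⟩
    simp [pair_outR]
  simpa only [pair_whiskerLeft_assoc, pair_whiskerRight_assoc, pair_associator_assoc,
    pair_associator_inv_assoc, pair_braiding] using (k ⊙ y) ⊙ z ≫= key

variable (f : (S ⊗ X) ⊗ (S ⊗ X) ⟶ (S ⊗ X) ⊗ X)

/-- The term of the Leibniz rule of `bracketFst` for the external left multiplication that contains
the bracket with the multiplier: `u ⊗ x ⊗ (s y ⊗ z) ↦ f(u, s x) y ⊗ z`. -/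
def crossL : (S ⊗ X) ⊗ (X ⊗ ((S ⊗ X) ⊗ X)) ⟶ ((S ⊗ X) ⊗ X) ⊗ X :=
  (S ⊗ X) ◁ ((α_ X (S ⊗ X) X).inv ≫ ((α_ X S X).inv ≫ (β_ X S).hom ▷ X) ▷ X) ≫
    (α_ (S ⊗ X) ((S ⊗ X) ⊗ X) X).inv ≫
      ((α_ (S ⊗ X) (S ⊗ X) X).inv ≫ f ▷ X ≫ extR S X mul) ▷ X

/-- The term of the Leibniz rule of `bracketFst` for the internal right multiplication that contains
the bracket with the multiplier: `v ⊗ (t p ⊗ p') ⊗ y ↦ p f(v, t y) ⊗ p'`. -/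
def crossR : (S ⊗ X) ⊗ (((S ⊗ X) ⊗ X) ⊗ X) ⟶ ((S ⊗ X) ⊗ X) ⊗ X :=
  (S ⊗ X) ◁ ((α_ (S ⊗ X) X X).hom ≫ (S ⊗ X) ◁ (β_ X X).hom ≫ (α_ (S ⊗ X) X X).inv ≫
    ((β_ S X).hom ▷ X ≫ (α_ X S X).hom) ▷ X) ≫ (α_ (S ⊗ X) (X ⊗ (S ⊗ X)) X).inv ≫
      ((α_ (S ⊗ X) X (S ⊗ X)).inv ≫ (β_ (S ⊗ X) X).hom ▷ (S ⊗ X) ≫ (α_ X (S ⊗ X) (S ⊗ X)).hom ≫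
        X ◁ f ≫ extL S mul X) ▷ X

theorem pair_crossL (u : G ⟶ S ⊗ X) (s : G ⟶ S) (x y z : G ⟶ X) :
    u ⊙ x ⊙ (s ⊙ y) ⊙ z ≫ crossL mul f = ((u ⊙ s ⊙ x ≫ f) ⊙ y ≫ extR S X mul) ⊙ z := by
  simp [crossL]

theorem pair_crossR (v : G ⟶ S ⊗ X) (s : G ⟶ S) (p p' y : G ⟶ X) :
    v ⊙ ((s ⊙ p) ⊙ p') ⊙ y ≫ crossR mul f =
      (p ⊙ (v ⊙ s ⊙ y ≫ f) ≫ extL S mul X) ⊙ p' := by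
  simp [crossR]

theorem pair_crossR_assoc (v : G ⟶ S ⊗ X) (s : G ⟶ S) (p p' y : G ⟶ X) {W : C}
    (h : ((S ⊗ X) ⊗ X) ⊗ X ⟶ W) : v ⊙ ((s ⊙ p) ⊙ p') ⊙ y ≫ crossR mul f ≫ h =
      (p ⊙ (v ⊙ s ⊙ y ≫ f) ≫ extL S mul X) ⊙ p' ≫ h := by
  rw [← Category.assoc, pair_crossR]

variable {mul f}

/-- The Leibniz rule of `bracketFst` for the external left multiplication. -/
theorem bracketFst_extL (h : IsDerSnd mul (extL S mul X) (extR S X mul) f) (u : G ⟶ S ⊗ X)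
    (x : G ⟶ X) (k : G ⟶ (S ⊗ X) ⊗ X) :
    u ⊙ (x ⊙ k ≫ extL S mul X) ≫ bracketFst S f =
      x ⊙ (u ⊙ k ≫ bracketFst S f) ≫ outL S mul + u ⊙ x ⊙ k ≫ crossL mul f := by
  have key : (S ⊗ X) ◁ extL S mul X ≫ bracketFst S f =
      ((α_ _ _ _).inv ≫ (β_ _ _).hom ▷ _ ≫ (α_ _ _ _).hom) ≫
        X ◁ bracketFst S f ≫ outL S mul + crossL mul f := by
    apply pure_ext
    rintro G _ _ _ ⟨u, _, -, ⟨x, _, -, ⟨_, z, ⟨s, y, -, -, rfl⟩, -, rfl⟩, rfl⟩, rfl⟩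
    simp [pair_bracketFst, h.apply, pair_outL, pair_crossL]
  simpa using u ⊙ x ⊙ k ≫= key

theorem bracketFst_extR (u : G ⟶ S ⊗ X) (y : G ⟶ X) (k : G ⟶ (S ⊗ X) ⊗ X) :
    u ⊙ (k ⊙ y ≫ extR S X mul) ≫ bracketFst S f = (u ⊙ k ≫ bracketFst S f) ⊙ y ≫ outR S mul := by
  have key : (S ⊗ X) ◁ extR S X mul ≫ bracketFst S f =
      (α_ _ _ _).inv ≫ bracketFst S f ▷ X ≫ outR S mul := by
    apply pure_ext
    rintro G _ _ _ ⟨u, _, -, ⟨_, y, ⟨v, z, -, -, rfl⟩, -, rfl⟩, rfl⟩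
    simp [pair_bracketFst, pair_outR, extR]
  simpa using u ⊙ k ⊙ y ≫= key

theorem bracketFst_rotOut₁ (h : IsDerFst mul (intL S X mul) (intR S mul X) f) (s : G ⟶ S)
    (x y : G ⟶ X) (k : G ⟶ (S ⊗ X) ⊗ X) :
    (s ⊙ (x ⊙ y ≫ mul)) ⊙ k ≫ bracketFst S f ≫ rotOut₁ S X X X =
      x ⊙ ((s ⊙ y) ⊙ k ≫ bracketFst S f ≫ rotOut₁ S X X X) ≫ outL S mul +
        ((s ⊙ x) ⊙ k ≫ bracketFst S f ≫ rotOut₁ S X X X) ⊙ y ≫ outR S mul := by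
  have key : (S ◁ mul) ▷ _ ≫ bracketFst S f ≫ rotOut₁ S X X X =
      fstOutL S X X _ ≫ X ◁ (bracketFst S f ≫ rotOut₁ S X X X) ≫ outL S mul +
        fstOutR S X X _ ≫ (bracketFst S f ≫ rotOut₁ S X X X) ▷ X ≫ outR S mul := by
    apply pure_ext
    rintro G _ _ _ ⟨_, _, ⟨s, _, -, ⟨x, y, -, -, rfl⟩, rfl⟩, ⟨v, z, -, -, rfl⟩, rfl⟩
    simp [pair_bracketFst_assoc, h.apply, intL_rotOut₁, intR_rotOut₁]
  simpa using (s ⊙ x ⊙ y) ⊙ k ≫= key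

theorem bracketFst_intL (v : G ⟶ S ⊗ X) (x : G ⟶ X) (k : G ⟶ (S ⊗ X) ⊗ X) :
    v ⊙ (x ⊙ k ≫ intL S X mul) ≫ bracketFst S f ≫ rotOut₂ S X X X =
      x ⊙ (v ⊙ k ≫ bracketFst S f ≫ rotOut₂ S X X X) ≫ outL S mul := by
  have key : (S ⊗ X) ◁ intL S X mul ≫ bracketFst S f ≫ rotOut₂ S X X X =
      ((α_ _ _ _).inv ≫ (β_ _ _).hom ▷ _ ≫ (α_ _ _ _).hom) ≫
        X ◁ (bracketFst S f ≫ rotOut₂ S X X X) ≫ outL S mul := by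
    apply pure_ext
    rintro G _ _ _ ⟨v, _, -, ⟨x, _, -, ⟨_, z, ⟨s, w, -, -, rfl⟩, -, rfl⟩, rfl⟩, rfl⟩
    simp [pair_bracketFst_assoc, mul_rotOut₂]
  simpa using v ⊙ x ⊙ k ≫= key

/-- The Leibniz rule of `bracketFst` for the internal right multiplication. -/
theorem bracketFst_intR (h : IsDerSnd mul (extL S mul X) (extR S X mul) f) (v : G ⟶ S ⊗ X)
    (y : G ⟶ X) (k : G ⟶ (S ⊗ X) ⊗ X) :
    v ⊙ (k ⊙ y ≫ intR S mul X) ≫ bracketFst S f ≫ rotOut₂ S X X X =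
      (v ⊙ k ≫ bracketFst S f ≫ rotOut₂ S X X X) ⊙ y ≫ outR S mul +
        v ⊙ k ⊙ y ≫ crossR mul f ≫ rotOut₂ S X X X := by
  have key : (S ⊗ X) ◁ intR S mul X ≫ bracketFst S f ≫ rotOut₂ S X X X =
      (α_ _ _ _).inv ≫ (bracketFst S f ≫ rotOut₂ S X X X) ▷ X ≫ outR S mul +
        crossR mul f ≫ rotOut₂ S X X X := by
    apply pure_ext
    rintro G _ _ _ ⟨v, _, -, ⟨_, y, ⟨_, z, ⟨s, w, -, -, rfl⟩, -, rfl⟩, -, rfl⟩, rfl⟩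
    simp [pair_bracketFst_assoc, h.apply, ← extR_rotOut₂, pair_crossR_assoc]
    abel
  simpa using v ⊙ k ⊙ y ≫= key

/-- The common value of the two cross terms: `s ⊗ (p ⊗ p') ⊗ (q ⊗ q') ↦ s p ⊗ p' q ⊗ q'`. -/
def crossValue (S : C) (mul : X ⊗ X ⟶ X) : S ⊗ ((X ⊗ X) ⊗ (X ⊗ X)) ⟶ ((S ⊗ X) ⊗ X) ⊗ X :=
  S ◁ (α_ (X ⊗ X) X X).inv ≫ (α_ S ((X ⊗ X) ⊗ X) X).inv ≫
    ((α_ S (X ⊗ X) X).inv ≫ (α_ S X X).inv ▷ X ≫ extR S X mul) ▷ X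

theorem pair_crossValue (s : G ⟶ S) (p : G ⟶ X ⊗ X) (q q' : G ⟶ X) :
    s ⊙ p ⊙ q ⊙ q' ≫ crossValue S mul =
      ((s ⊙ p ≫ (α_ S X X).inv) ⊙ q ≫ extR S X mul) ⊙ q' := by
  simp [crossValue]

theorem pair_crossValue' (s : G ⟶ S) (p p' : G ⟶ X) (q : G ⟶ X ⊗ X) :
    s ⊙ (p ⊙ p') ⊙ q ≫ crossValue S mul =
      (p' ⊙ (s ⊙ q ≫ (α_ S X X).inv) ≫ extL S mul X) ⊙ p ≫ rotOut₂ S X X X := by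
  have key : crossValue S mul = S ◁ ((β_ X X).hom ▷ (X ⊗ X) ≫ (α_ _ _ _).hom ≫
      X ◁ (β_ X (X ⊗ X)).hom) ≫ (α_ _ _ _).inv ≫ (β_ _ _).hom ▷ _ ≫ (α_ _ _ _).hom ≫
        X ◁ (α_ _ _ _).inv ≫ (α_ _ _ _).inv ≫
          (X ◁ (α_ S X X).inv ≫ extL S mul X) ▷ X ≫ rotOut₂ S X X X := by
    apply pure_ext
    rintro G _ _ _ ⟨s, _, -, ⟨_, _, ⟨p, p', -, -, rfl⟩, ⟨q, q', -, -, rfl⟩, rfl⟩, rfl⟩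
    simp [pair_crossValue]
  simpa using s ⊙ (p ⊙ p') ⊙ q ≫= key

/-- The two cross terms in the Leibniz rule of the double jacobiator cancel. The bracket is
determined by its desuspension in the second variable, `f(u, s x) = s g(u, x)`; thus the brackets
with `u` and with `v` act on the same suspension and can be interchanged. -/
theorem cross_cancel {Sinv : C} (e : Sinv ⊗ S ≅ 𝟙_ C)
    (h : f = -((β_ (S ⊗ X) (S ⊗ X)).hom ≫ f ≫ sSwap S X X)) (u v : G ⟶ S ⊗ X) (s : G ⟶ S)
    (x y : G ⟶ X) :
    u ⊙ x ⊙ (v ⊙ s ⊙ y ≫ f) ≫ crossL mul f +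
      v ⊙ ((s ⊙ x) ⊙ u ≫ f) ⊙ y ≫ crossR mul f ≫ rotOut₂ S X X X = 0 := by
  obtain ⟨g, hg⟩ := exists_whiskerLeft_eq e ((α_ S (S ⊗ X) X).inv ≫ (β_ S (S ⊗ X)).hom ▷ X ≫
    (α_ (S ⊗ X) S X).hom ≫ f ≫ (α_ S X X).hom)
  have hf : ∀ {G : C} [ComonObj G] [IsCommComonObj G] (u : G ⟶ S ⊗ X) (s : G ⟶ S) (x : G ⟶ X),
      u ⊙ s ⊙ x ≫ f = s ⊙ (u ⊙ x ≫ g) ≫ (α_ S X X).inv := by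
    intro G _ _ u s x
    rw [← pair_whiskerLeft_assoc, hg]
    simp
  have hL : ∀ q : G ⟶ X ⊗ X, u ⊙ x ⊙ (s ⊙ q ≫ (α_ S X X).inv) ≫ crossL mul f =
      s ⊙ (u ⊙ x ≫ g) ⊙ q ≫ crossValue S mul := by
    have key : (S ⊗ X) ◁ X ◁ (α_ S X X).inv ≫ crossL mul f =
        (α_ _ _ _).inv ≫ (α_ _ _ _).inv ≫ (β_ _ _).hom ▷ _ ≫ (α_ _ _ _).hom ≫
          S ◁ g ▷ _ ≫ crossValue S mul := by
      apply pure_ext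
      rintro G _ _ _ ⟨u, _, -, ⟨x, _, -, ⟨s, _, -, ⟨q, q', -, -, rfl⟩, rfl⟩, rfl⟩, rfl⟩
      simp [pair_crossL, pair_crossValue, hf]
    intro q
    simpa using u ⊙ x ⊙ s ⊙ q ≫= key
  have hR : ∀ p : G ⟶ X ⊗ X,
      v ⊙ (s ⊙ p ≫ (α_ S X X).inv ≫ sSwap S X X) ⊙ y ≫ crossR mul f ≫ rotOut₂ S X X X =
        s ⊙ p ⊙ (v ⊙ y ≫ g) ≫ crossValue S mul := by
    have key : (S ⊗ X) ◁ ((α_ S X X).inv ≫ sSwap S X X) ▷ X ≫ crossR mul f ≫ rotOut₂ S X X X =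
        (S ⊗ X) ◁ (α_ _ _ _).hom ≫ (α_ _ _ _).inv ≫ (β_ _ _).hom ▷ _ ≫ (α_ _ _ _).hom ≫
          S ◁ ((α_ _ _ _).inv ≫ (β_ _ _).hom ▷ _ ≫ (α_ _ _ _).hom ≫ _ ◁ g) ≫
            crossValue S mul := by
      apply pure_ext
      rintro G _ _ _ ⟨v, _, -, ⟨_, y, ⟨s, _, -, ⟨p, p', -, -, rfl⟩, rfl⟩, -, rfl⟩, rfl⟩
      simp [pair_crossR_assoc, pair_crossValue', hf]
    intro p
    simpa using v ⊙ (s ⊙ p) ⊙ y ≫= key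
  have hs : (s ⊙ x) ⊙ u ≫ f = -(s ⊙ (u ⊙ x ≫ g) ≫ (α_ S X X).inv ≫ sSwap S X X) := by
    rw [pair_antisymm h, ← Category.assoc, hf, Category.assoc]
  rw [hf, hL, hs]
  simp [hR]

end Jacobiator

section Generators

variable {S : C} {B : AssocMon C} {f : (S ⊗ B.X) ⊗ (S ⊗ B.X) ⟶ (S ⊗ B.X) ⊗ B.X}

/-- The double jacobiator is a derivation in its third variable, for the outer structure. -/
theorem doubleJacobiator_isDerSnd {Sinv : C} (e : Sinv ⊗ S ≅ 𝟙_ C)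
    (h : f = -((β_ (S ⊗ B.X) (S ⊗ B.X)).hom ≫ f ≫ sSwap S B.X B.X))
    (h' : IsDerFst B.mul (intL S B.X B.mul) (intR S B.mul B.X) f) :
    IsDerSnd B.mul (outL S B.mul) (outR S B.mul)
      ((α_ (S ⊗ B.X) (S ⊗ B.X) (S ⊗ B.X)).hom ≫ doubleJacobiator S B.X f) := by
  have h₂ := isDerSnd_of_antisymm h h'
  let : Probe (S ⊗ B.X) := Probe.leaf _
  refine isDerSnd_of_pure ?_
  rintro G _ _ _ s x y ⟨u, v, -, -, rfl⟩
  have hc := cross_cancel (mul := B.mul) e h u v s x y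
  simp only [pair_associator_assoc, pair_doubleJacobiator, h₂.apply, h'.apply, pair_add, add_pair,
    Preadditive.add_comp, bracketFst_extL h₂, bracketFst_extR, bracketFst_rotOut₁ h',
    bracketFst_intL, bracketFst_intR h₂]
  rw [← sub_eq_zero, ← hc]
  abel

/-- The double jacobiator is equivariant under cyclic permutations. -/
theorem doubleJacobiator_cyclic {X : C} (f : (S ⊗ X) ⊗ (S ⊗ X) ⟶ (S ⊗ X) ⊗ X) :
    rotIn₁ _ _ _ ≫ doubleJacobiator S X f ≫ rotOut₁ S X X X = doubleJacobiator S X f := by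
  apply pure_ext
  rintro G _ _ _ ⟨u, _, -, ⟨v, w, -, -, rfl⟩, rfl⟩
  rw [pair_rotIn₁_assoc, ← Category.assoc, pair_doubleJacobiator, pair_doubleJacobiator]
  simp only [Preadditive.add_comp, Category.assoc, rotOut₁_rotOut₁,
    rotOut₂_rotOut₁, Category.comp_id]
  abel

end Generators

end Poisson

/-! ### Values of a linear bracket on the generators -/

section Restriction

set_option linter.unusedSectionVars false

variable {C : Type u} [Category.{v} C] [MonoidalCategory C] [SymmetricCategory C]
  [Preadditive C] [MonoidalPreadditive C] [HasBinaryBiproducts C]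

attribute [-simp] MonoidalCategory.tensor_whiskerLeft MonoidalCategory.whiskerRight_tensor
  MonoidalCategory.whisker_assoc BraidedCategory.braiding_tensor_left_hom
  BraidedCategory.braiding_tensor_right_hom

local infixr:90 " ⊙ " => pair

section Naturality

variable {G S P P' X X' X₁ X₁' Y Y' Y₁ Y₁' Z Z' : C} [ComonObj G] [IsCommComonObj G]

theorem extL_natural {act : P ⊗ X ⟶ X₁} {act' : P' ⊗ X' ⟶ X₁'} {p : P ⟶ P'} {i : X ⟶ X'}
    {i₁ : X₁ ⟶ X₁'} (h : (p ⊗ₘ i) ≫ act' = act ≫ i₁) (j : Y ⟶ Y') (a : G ⟶ P)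
    (z : G ⟶ (S ⊗ X) ⊗ Y) :
    (a ≫ p) ⊙ (z ≫ (S ◁ i ⊗ₘ j)) ≫ extL S act' Y' = a ⊙ z ≫ extL S act Y ≫ (S ◁ i₁ ⊗ₘ j) := by
  have key : (p ⊗ₘ (S ◁ i ⊗ₘ j)) ≫ extL S act' Y' = extL S act Y ≫ (S ◁ i₁ ⊗ₘ j) := by
    apply pure_ext
    rintro G _ _ _ ⟨a, _, -, ⟨_, y, ⟨s, x, -, -, rfl⟩, -, rfl⟩, rfl⟩
    simp [← h]
  simpa using a ⊙ z ≫= key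

theorem extR_natural {act : Y ⊗ P ⟶ Y₁} {act' : Y' ⊗ P' ⟶ Y₁'} {p : P ⟶ P'} {j : Y ⟶ Y'}
    {j₁ : Y₁ ⟶ Y₁'} (h : (j ⊗ₘ p) ≫ act' = act ≫ j₁) (i : X ⟶ X') (a : G ⟶ P)
    (z : G ⟶ (S ⊗ X) ⊗ Y) :
    (z ≫ (S ◁ i ⊗ₘ j)) ⊙ (a ≫ p) ≫ extR S X' act' = z ⊙ a ≫ extR S X act ≫ (S ◁ i ⊗ₘ j₁) := by
  have key : ((S ◁ i ⊗ₘ j) ⊗ₘ p) ≫ extR S X' act' = extR S X act ≫ (S ◁ i ⊗ₘ j₁) := by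
    apply pure_ext
    rintro G _ _ _ ⟨_, a, ⟨_, y, ⟨s, x, -, -, rfl⟩, -, rfl⟩, -, rfl⟩
    simp [← h]
  simpa only [pair_tensorHom_assoc] using z ⊙ a ≫= key

theorem intL_natural {act : P ⊗ Y ⟶ Y₁} {act' : P' ⊗ Y' ⟶ Y₁'} {p : P ⟶ P'} {j : Y ⟶ Y'}
    {j₁ : Y₁ ⟶ Y₁'} (h : (p ⊗ₘ j) ≫ act' = act ≫ j₁) (i : X ⟶ X') (a : G ⟶ P)
    (z : G ⟶ (S ⊗ X) ⊗ Y) :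
    (a ≫ p) ⊙ (z ≫ (S ◁ i ⊗ₘ j)) ≫ intL S X' act' = a ⊙ z ≫ intL S X act ≫ (S ◁ i ⊗ₘ j₁) := by
  have key : (p ⊗ₘ (S ◁ i ⊗ₘ j)) ≫ intL S X' act' = intL S X act ≫ (S ◁ i ⊗ₘ j₁) := by
    apply pure_ext
    rintro G _ _ _ ⟨a, _, -, ⟨_, y, ⟨s, x, -, -, rfl⟩, -, rfl⟩, rfl⟩
    simp [← h]
  simpa using a ⊙ z ≫= key

theorem intR_natural {act : X ⊗ P ⟶ X₁} {act' : X' ⊗ P' ⟶ X₁'} {p : P ⟶ P'} {i : X ⟶ X'}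
    {i₁ : X₁ ⟶ X₁'} (h : (i ⊗ₘ p) ≫ act' = act ≫ i₁) (j : Y ⟶ Y') (a : G ⟶ P)
    (z : G ⟶ (S ⊗ X) ⊗ Y) :
    (z ≫ (S ◁ i ⊗ₘ j)) ⊙ (a ≫ p) ≫ intR S act' Y' = z ⊙ a ≫ intR S act Y ≫ (S ◁ i₁ ⊗ₘ j) := by
  have key : ((S ◁ i ⊗ₘ j) ⊗ₘ p) ≫ intR S act' Y' = intR S act Y ≫ (S ◁ i₁ ⊗ₘ j) := by
    apply pure_ext
    rintro G _ _ _ ⟨_, a, ⟨_, y, ⟨s, x, -, -, rfl⟩, -, rfl⟩, -, rfl⟩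
    simp [← h]
  simpa only [pair_tensorHom_assoc] using z ⊙ a ≫= key

theorem sSwap_natural (i : X ⟶ X') (j : Y ⟶ Y') :
    (S ◁ i ⊗ₘ j) ≫ sSwap S X' Y' = sSwap S X Y ≫ (S ◁ j ⊗ₘ i) := by
  apply pure_ext
  rintro G _ _ _ ⟨_, y, ⟨s, x, -, -, rfl⟩, -, rfl⟩
  simp

theorem rotOut₁_natural (i : X ⟶ X') (j : Y ⟶ Y') (k : Z ⟶ Z') :
    ((S ◁ i ⊗ₘ j) ⊗ₘ k) ≫ rotOut₁ S X' Y' Z' = rotOut₁ S X Y Z ≫ ((S ◁ j ⊗ₘ k) ⊗ₘ i) := by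
  apply pure_ext
  rintro G _ _ _ ⟨_, z, ⟨_, y, ⟨s, x, -, -, rfl⟩, -, rfl⟩, -, rfl⟩
  simp

theorem rotOut₂_natural (i : X ⟶ X') (j : Y ⟶ Y') (k : Z ⟶ Z') :
    ((S ◁ i ⊗ₘ j) ⊗ₘ k) ≫ rotOut₂ S X' Y' Z' = rotOut₂ S X Y Z ≫ ((S ◁ k ⊗ₘ i) ⊗ₘ j) := by
  apply pure_ext
  rintro G _ _ _ ⟨_, z, ⟨_, y, ⟨s, x, -, -, rfl⟩, -, rfl⟩, -, rfl⟩
  simp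

end Naturality

section Components

variable {S : C} {A : AssocMon C} {M : ABimod A} {U : C}

/-- A morphism with values in `Σ (M ⊗ A ⊕ A ⊗ M)` is the sum of its two components. -/
theorem eq_brL_add_brR (b : U ⟶ S ⊗ ((M.X ⊗ A.X) ⊞ (A.X ⊗ M.X))) :
    b = brL S M b ≫ (α_ S M.X A.X).hom ≫ S ◁ biprod.inl +
      brR S M b ≫ (α_ S A.X M.X).hom ≫ S ◁ biprod.inr := by
  simp only [brL, brR, Category.assoc, Iso.inv_hom_id_assoc, ← Preadditive.comp_add,
    ← whiskerLeft_comp, ← MonoidalPreadditive.whiskerLeft_add, biprod.total, whiskerLeft_id,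
    Category.comp_id]

theorem bracket_ext {b b' : U ⟶ S ⊗ ((M.X ⊗ A.X) ⊞ (A.X ⊗ M.X))}
    (hl : brL S M b = brL S M b') (hr : brR S M b = brR S M b') : b = b' := by
  rw [eq_brL_add_brR b, eq_brL_add_brR b', hl, hr]

theorem bracket_desc (b : U ⟶ S ⊗ ((M.X ⊗ A.X) ⊞ (A.X ⊗ M.X))) {W W' : C} (i : M.X ⟶ W)
    (j : A.X ⟶ W') (i' : A.X ⟶ W) (j' : M.X ⟶ W') :
    b ≫ S ◁ biprod.desc (i ⊗ₘ j) (i' ⊗ₘ j') ≫ (α_ S W W').inv =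
      brL S M b ≫ (S ◁ i ⊗ₘ j) + brR S M b ≫ (S ◁ i' ⊗ₘ j') := by
  conv_lhs => rw [eq_brL_add_brR b]
  simp only [Preadditive.add_comp, Category.assoc, ← whiskerLeft_comp_assoc, biprod.inl_desc,
    biprod.inr_desc]
  congr 2 <;>
  · simp only [MonoidalCategory.tensorHom_def]
    monoidal

/-- Antisymmetry of a bracket with values in `Σ (M ⊗ A ⊕ A ⊗ M)` in terms of its components. -/
theorem bracket_antisymm_iff (b : (S ⊗ M.X) ⊗ (S ⊗ M.X) ⟶ S ⊗ ((M.X ⊗ A.X) ⊞ (A.X ⊗ M.X))) :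
    (β_ (S ⊗ M.X) (S ⊗ M.X)).hom ≫ b =
      -(b ≫ S ◁ biprod.lift (biprod.snd ≫ (β_ A.X M.X).hom) (biprod.fst ≫ (β_ M.X A.X).hom)) ↔
    (β_ (S ⊗ M.X) (S ⊗ M.X)).hom ≫ brL S M b = -(brR S M b ≫ sSwap S A.X M.X) ∧
    (β_ (S ⊗ M.X) (S ⊗ M.X)).hom ≫ brR S M b = -(brL S M b ≫ sSwap S M.X A.X) := by
  have el : brL S M (-(b ≫ S ◁ biprod.lift (biprod.snd ≫ (β_ A.X M.X).hom)
      (biprod.fst ≫ (β_ M.X A.X).hom))) = -(brR S M b ≫ sSwap S A.X M.X) := by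
    simp only [brL, brR, sSwap, Preadditive.neg_comp, Category.assoc, ← whiskerLeft_comp_assoc,
      biprod.lift_fst, Iso.inv_hom_id_assoc]
  have er : brR S M (-(b ≫ S ◁ biprod.lift (biprod.snd ≫ (β_ A.X M.X).hom)
      (biprod.fst ≫ (β_ M.X A.X).hom))) = -(brL S M b ≫ sSwap S M.X A.X) := by
    simp only [brL, brR, sSwap, Preadditive.neg_comp, Category.assoc, ← whiskerLeft_comp_assoc,
      biprod.lift_snd, Iso.inv_hom_id_assoc]
  have hl : (β_ (S ⊗ M.X) (S ⊗ M.X)).hom ≫ brL S M b =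
      brL S M ((β_ (S ⊗ M.X) (S ⊗ M.X)).hom ≫ b) := by simp only [brL, Category.assoc]
  have hr : (β_ (S ⊗ M.X) (S ⊗ M.X)).hom ≫ brR S M b =
      brR S M ((β_ (S ⊗ M.X) (S ⊗ M.X)).hom ≫ b) := by simp only [brR, Category.assoc]
  rw [← el, ← er, hl, hr]
  exact ⟨fun h => by rw [h]; exact ⟨rfl, rfl⟩, fun h => bracket_ext h.1 h.2⟩

end Components

variable [HasCoequalizers C] [∀ X : C, PreservesColimitsOfShape WalkingParallelPair (tensorLeft X)]
  [HasCoproductsOfShape ℕ C] [∀ X : C, PreservesColimitsOfShape (Discrete ℕ) (tensorLeft X)]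
  {A : AssocMon C} {M : ABimod A} {S : C}

section Products

variable (M)

theorem iA_iA_mul : (iA M ⊗ₘ iA M) ≫ Tmul M = A.mul ≫ iA M := by
  apply pure_ext
  rintro G _ _ _ ⟨a, a', -, -, rfl⟩
  simp [mul_iA_iA]

theorem iA_iM_mul : (iA M ⊗ₘ iM M) ≫ Tmul M = M.actL ≫ iM M := by
  apply pure_ext
  rintro G _ _ _ ⟨a, a', -, -, rfl⟩
  simp [mul_iA_iM]

theorem iM_iA_mul : (iM M ⊗ₘ iA M) ≫ Tmul M = M.actR ≫ iM M := by
  apply pure_ext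
  rintro G _ _ _ ⟨a, a', -, -, rfl⟩
  simp [mul_iM_iA]

end Products

section Splitting

variable {U : C}

theorem cancel_AA {p q : U ⟶ (S ⊗ A.X) ⊗ A.X}
    (h : p ≫ (S ◁ iA M ⊗ₘ iA M) = q ≫ (S ◁ iA M ⊗ₘ iA M)) : p = q := by
  have h' := h =≫ (S ◁ prA M ⊗ₘ prA M)
  simpa only [Category.assoc, tensorHom_comp_tensorHom, ← whiskerLeft_comp, iA_prA,
    whiskerLeft_id, id_tensorHom_id, Category.comp_id] using h'

theorem cancel_AAA {p q : U ⟶ ((S ⊗ A.X) ⊗ A.X) ⊗ A.X}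
    (h : p ≫ ((S ◁ iA M ⊗ₘ iA M) ⊗ₘ iA M) = q ≫ ((S ◁ iA M ⊗ₘ iA M) ⊗ₘ iA M)) : p = q := by
  have h' := h =≫ ((S ◁ prA M ⊗ₘ prA M) ⊗ₘ prA M)
  simpa only [Category.assoc, tensorHom_comp_tensorHom, ← whiskerLeft_comp, iA_prA,
    whiskerLeft_id, id_tensorHom_id, Category.comp_id] using h'

theorem cancel_MA_AM {p q : U ⟶ (S ⊗ M.X) ⊗ A.X} {p' q' : U ⟶ (S ⊗ A.X) ⊗ M.X}
    (h : p ≫ (S ◁ iM M ⊗ₘ iA M) + p' ≫ (S ◁ iA M ⊗ₘ iM M) =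
      q ≫ (S ◁ iM M ⊗ₘ iA M) + q' ≫ (S ◁ iA M ⊗ₘ iM M)) : p = q ∧ p' = q' := by
  constructor
  · have h' := h =≫ (S ◁ prM M ⊗ₘ prA M)
    simpa only [Preadditive.add_comp, Category.assoc, tensorHom_comp_tensorHom,
      ← whiskerLeft_comp, iA_prA, iM_prM, iA_prM, iM_prA, MonoidalPreadditive.whiskerLeft_zero,
      MonoidalPreadditive.zero_tensor, comp_zero, add_zero,
      whiskerLeft_id, id_tensorHom_id, Category.comp_id] using h'
  · have h' := h =≫ (S ◁ prA M ⊗ₘ prM M)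
    simpa only [Preadditive.add_comp, Category.assoc, tensorHom_comp_tensorHom,
      ← whiskerLeft_comp, iA_prA, iM_prM, iA_prM, iM_prA, MonoidalPreadditive.whiskerLeft_zero,
      MonoidalPreadditive.zero_tensor, comp_zero, zero_add,
      whiskerLeft_id, id_tensorHom_id, Category.comp_id] using h'

end Splitting

section Values

variable {f : (S ⊗ TX M) ⊗ (S ⊗ TX M) ⟶ (S ⊗ TX M) ⊗ TX M}
  {ρ : (S ⊗ M.X) ⊗ (S ⊗ A.X) ⟶ (S ⊗ A.X) ⊗ A.X}
  {b : (S ⊗ M.X) ⊗ (S ⊗ M.X) ⟶ S ⊗ ((M.X ⊗ A.X) ⊞ (A.X ⊗ M.X))}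
  (R : RestrictsTo S M f ρ b)
  {G : C} [ComonObj G] [IsCommComonObj G]

include R

theorem RestrictsTo.apply_AA (u u' : G ⟶ S ⊗ A.X) :
    (u ≫ S ◁ iA M) ⊙ (u' ≫ S ◁ iA M) ≫ f = 0 := by
  rw [← pair_tensorHom_assoc, R.on_AA, comp_zero]

theorem RestrictsTo.apply_MA (w : G ⟶ S ⊗ M.X) (u : G ⟶ S ⊗ A.X) :
    (w ≫ S ◁ iM M) ⊙ (u ≫ S ◁ iA M) ≫ f = (w ⊙ u ≫ ρ) ≫ (S ◁ iA M ⊗ₘ iA M) := by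
  rw [← pair_tensorHom_assoc, R.on_MA, Category.assoc]

theorem RestrictsTo.apply_MM (w w' : G ⟶ S ⊗ M.X) :
    (w ≫ S ◁ iM M) ⊙ (w' ≫ S ◁ iM M) ≫ f =
      (w ⊙ w' ≫ brL S M b) ≫ (S ◁ iM M ⊗ₘ iA M) +
        (w ⊙ w' ≫ brR S M b) ≫ (S ◁ iA M ⊗ₘ iM M) := by
  rw [← pair_tensorHom_assoc, R.on_MM, bracket_desc, Preadditive.comp_add, Category.assoc,
    Category.assoc]

variable (ha : f = -((β_ (S ⊗ TX M) (S ⊗ TX M)).hom ≫ f ≫ sSwap S (TX M) (TX M)))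

include ha

theorem RestrictsTo.apply_AM (u : G ⟶ S ⊗ A.X) (w : G ⟶ S ⊗ M.X) :
    (u ≫ S ◁ iA M) ⊙ (w ≫ S ◁ iM M) ≫ f =
      (u ⊙ w ≫ anchorSwap S M ρ) ≫ (S ◁ iA M ⊗ₘ iA M) := by
  rw [pair_antisymm ha, ← Category.assoc, R.apply_MA]
  simp [anchorSwap, sSwap_natural]

end Values

end Restriction

/-! ### Values of the double jacobiator on the generators -/

section JacobiatorValues

set_option linter.unusedSectionVars false

variable {C : Type u} [Category.{v} C] [MonoidalCategory C] [SymmetricCategory C]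
  [Preadditive C] [MonoidalPreadditive C] [HasBinaryBiproducts C]

attribute [-simp] MonoidalCategory.tensor_whiskerLeft MonoidalCategory.whiskerRight_tensor
  MonoidalCategory.whisker_assoc BraidedCategory.braiding_tensor_left_hom
  BraidedCategory.braiding_tensor_right_hom MonoidalCategory.associator_conjugation

local infixr:90 " ⊙ " => pair

section Brackets

variable {A : AssocMon C}

/-- The left hand side of the compatibility of the bracket with the anchor. -/
noncomputable def compatLHS (S : C) (M : ABimod A) (ρ : (S ⊗ M.X) ⊗ (S ⊗ A.X) ⟶ (S ⊗ A.X) ⊗ A.X)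
    (b : (S ⊗ M.X) ⊗ (S ⊗ M.X) ⟶ S ⊗ ((M.X ⊗ A.X) ⊞ (A.X ⊗ M.X))) :
    (S ⊗ A.X) ⊗ (S ⊗ M.X) ⊗ (S ⊗ M.X) ⟶ ((S ⊗ A.X) ⊗ A.X) ⊗ A.X :=
  nest (anchorSwap S M ρ) (brL S M b) +
      rotIn₂ (S ⊗ A.X) (S ⊗ M.X) (S ⊗ M.X) ≫ nest ρ ρ ≫ rotOut₂ S A.X A.X A.X +
      rotIn₁ (S ⊗ A.X) (S ⊗ M.X) (S ⊗ M.X) ≫ nest ρ (anchorSwap S M ρ) ≫ rotOut₁ S A.X A.X A.X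

/-- The left hand side of the double Jacobi identity of a double Lie-Rinehart algebra. -/
noncomputable def jacobiLHS (S : C) (M : ABimod A) (ρ : (S ⊗ M.X) ⊗ (S ⊗ A.X) ⟶ (S ⊗ A.X) ⊗ A.X)
    (b : (S ⊗ M.X) ⊗ (S ⊗ M.X) ⟶ S ⊗ ((M.X ⊗ A.X) ⊞ (A.X ⊗ M.X))) :
    (S ⊗ M.X) ⊗ (S ⊗ M.X) ⊗ (S ⊗ M.X) ⟶ ((S ⊗ M.X) ⊗ A.X) ⊗ A.X :=
  nest (brL S M b) (brL S M b) +
      rotIn₁ (S ⊗ M.X) (S ⊗ M.X) (S ⊗ M.X) ≫ nest (brR S M b) (brL S M b) ≫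
        rotOut₁ S A.X M.X A.X +
      rotIn₂ (S ⊗ M.X) (S ⊗ M.X) (S ⊗ M.X) ≫ nest ρ (brR S M b) ≫ rotOut₂ S A.X A.X M.X

variable [HasCoequalizers C] [∀ X : C, PreservesColimitsOfShape WalkingParallelPair (tensorLeft X)]
  [HasCoproductsOfShape ℕ C] [∀ X : C, PreservesColimitsOfShape (Discrete ℕ) (tensorLeft X)]
  {M : ABimod A} {S : C} {f : (S ⊗ TX M) ⊗ (S ⊗ TX M) ⟶ (S ⊗ TX M) ⊗ TX M}
  {ρ : (S ⊗ M.X) ⊗ (S ⊗ A.X) ⟶ (S ⊗ A.X) ⊗ A.X}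
  {b : (S ⊗ M.X) ⊗ (S ⊗ M.X) ⟶ S ⊗ ((M.X ⊗ A.X) ⊞ (A.X ⊗ M.X))}
  (R : RestrictsTo S M f ρ b)
  (ha : f = -((β_ (S ⊗ TX M) (S ⊗ TX M)).hom ≫ f ≫ sSwap S (TX M) (TX M)))
  {G Y : C} [ComonObj G] [IsCommComonObj G]

/-- The bracket with the first factor, on the images of generators. -/
theorem bracketFst_of_eq {U V : C} {i : U ⟶ S ⊗ TX M} {i' : V ⟶ S ⊗ TX M} (j : Y ⟶ TX M)
    {φ : U ⊗ V ⟶ (S ⊗ TX M) ⊗ TX M} (h : (i ⊗ₘ i') ≫ f = φ) (u : G ⟶ U) (z : G ⟶ V ⊗ Y) :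
    (u ≫ i) ⊙ (z ≫ (i' ⊗ₘ j)) ≫ bracketFst S f = u ⊙ z ≫ (α_ _ _ _).inv ≫ (φ ⊗ₘ j) := by
  have key : (i ⊗ₘ (i' ⊗ₘ j)) ≫ bracketFst S f = (α_ _ _ _).inv ≫ (φ ⊗ₘ j) := by
    let : Probe U := Probe.leaf U
    let : Probe V := Probe.leaf V
    apply pure_ext
    rintro G _ _ _ ⟨u, _, -, ⟨v, y, -, -, rfl⟩, rfl⟩
    simp [pair_bracketFst, ← h]
  simpa only [pair_tensorHom_assoc] using u ⊙ z ≫= key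

include R

theorem RestrictsTo.bracketFst_AA (j : Y ⟶ TX M) (u : G ⟶ S ⊗ A.X) (z : G ⟶ (S ⊗ A.X) ⊗ Y) :
    (u ≫ S ◁ iA M) ⊙ (z ≫ (S ◁ iA M ⊗ₘ j)) ≫ bracketFst S f = 0 := by
  rw [bracketFst_of_eq j R.on_AA, MonoidalPreadditive.zero_tensor, comp_zero, comp_zero]

theorem RestrictsTo.bracketFst_MA (j : Y ⟶ TX M) (u : G ⟶ S ⊗ M.X) (z : G ⟶ (S ⊗ A.X) ⊗ Y) :
    (u ≫ S ◁ iM M) ⊙ (z ≫ (S ◁ iA M ⊗ₘ j)) ≫ bracketFst S f =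
      u ⊙ z ≫ (α_ _ _ _).inv ≫ ρ ▷ Y ≫ ((S ◁ iA M ⊗ₘ iA M) ⊗ₘ j) := by
  rw [bracketFst_of_eq j R.on_MA, ← tensorHom_id, tensorHom_comp_tensorHom, Category.id_comp]

theorem RestrictsTo.bracketFst_MM (j : Y ⟶ TX M) (u : G ⟶ S ⊗ M.X) (z : G ⟶ (S ⊗ M.X) ⊗ Y) :
    (u ≫ S ◁ iM M) ⊙ (z ≫ (S ◁ iM M ⊗ₘ j)) ≫ bracketFst S f =
      u ⊙ z ≫ (α_ _ _ _).inv ≫ brL S M b ▷ Y ≫ ((S ◁ iM M ⊗ₘ iA M) ⊗ₘ j) +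
        u ⊙ z ≫ (α_ _ _ _).inv ≫ brR S M b ▷ Y ≫ ((S ◁ iA M ⊗ₘ iM M) ⊗ₘ j) := by
  rw [bracketFst_of_eq j R.on_MM, bracket_desc, MonoidalPreadditive.add_tensor,
    Preadditive.comp_add, Preadditive.comp_add, ← tensorHom_id, ← tensorHom_id,
    tensorHom_comp_tensorHom, tensorHom_comp_tensorHom, Category.id_comp]

theorem RestrictsTo.jacobiator_AAA :
    (S ◁ iA M ⊗ₘ (S ◁ iA M ⊗ₘ S ◁ iA M)) ≫ doubleJacobiator S (TX M) f = 0 := by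
  apply pure_ext
  rintro G _ _ _ ⟨u, _, -, ⟨v, w, -, -, rfl⟩, rfl⟩
  simp [pair_doubleJacobiator, R.apply_AA]

/-- On three elements of `M` the double jacobiator is the sum of the rotations of the double Jacobi
identity of `M`: its components in the summands of `Σ T ⊗ T ⊗ T` with `M` in the first, the third
and the second place. -/
theorem RestrictsTo.jacobiator_MMM :
    (S ◁ iM M ⊗ₘ (S ◁ iM M ⊗ₘ S ◁ iM M)) ≫ doubleJacobiator S (TX M) f =
      jacobiLHS S M ρ b ≫ ((S ◁ iM M ⊗ₘ iA M) ⊗ₘ iA M) +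
      rotIn₁ _ _ _ ≫ jacobiLHS S M ρ b ≫ rotOut₁ _ _ _ _ ≫ ((S ◁ iA M ⊗ₘ iA M) ⊗ₘ iM M) +
      rotIn₂ _ _ _ ≫ jacobiLHS S M ρ b ≫ rotOut₂ _ _ _ _ ≫ ((S ◁ iA M ⊗ₘ iM M) ⊗ₘ iA M) := by
  have hv : ∀ {G : C} [ComonObj G] [IsCommComonObj G] (u v w : G ⟶ S ⊗ M.X),
      (u ≫ S ◁ iM M) ⊙ ((v ≫ S ◁ iM M) ⊙ (w ≫ S ◁ iM M) ≫ f) ≫ bracketFst S f =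
        u ⊙ v ⊙ w ≫ nest (brL S M b) (brL S M b) ≫ ((S ◁ iM M ⊗ₘ iA M) ⊗ₘ iA M) +
        u ⊙ v ⊙ w ≫ nest (brR S M b) (brL S M b) ≫ ((S ◁ iA M ⊗ₘ iM M) ⊗ₘ iA M) +
        u ⊙ v ⊙ w ≫ nest ρ (brR S M b) ≫ ((S ◁ iA M ⊗ₘ iA M) ⊗ₘ iM M) := by
    intro G _ _ u v w
    rw [R.apply_MM, pair_add, Preadditive.add_comp, R.bracketFst_MM, R.bracketFst_MA]
    simp [nest]
  apply pure_ext
  rintro G _ _ _ ⟨u, _, -, ⟨v, w, -, -, rfl⟩, rfl⟩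
  rw [pair_tensorHom_assoc, pair_tensorHom, pair_doubleJacobiator,
    ← Category.assoc _ (bracketFst S f), ← Category.assoc _ (bracketFst S f), hv, hv, hv]
  simp [jacobiLHS, rotOut₁_natural, rotOut₂_natural, reassoc_of% @rotOut₁_rotOut₁,
    reassoc_of% @rotOut₁_rotOut₂, reassoc_of% @rotOut₂_rotOut₁, reassoc_of% @rotOut₂_rotOut₂]
  abel

include ha

theorem RestrictsTo.on_AM :
    (S ◁ iA M ⊗ₘ S ◁ iM M) ≫ f = anchorSwap S M ρ ≫ (S ◁ iA M ⊗ₘ iA M) := by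
  apply pure_ext
  rintro G _ _ _ ⟨u, w, -, -, rfl⟩
  rw [pair_tensorHom_assoc, R.apply_AM ha, Category.assoc]

theorem RestrictsTo.bracketFst_AM (j : Y ⟶ TX M) (u : G ⟶ S ⊗ A.X) (z : G ⟶ (S ⊗ M.X) ⊗ Y) :
    (u ≫ S ◁ iA M) ⊙ (z ≫ (S ◁ iM M ⊗ₘ j)) ≫ bracketFst S f =
      u ⊙ z ≫ (α_ _ _ _).inv ≫ anchorSwap S M ρ ▷ Y ≫ ((S ◁ iA M ⊗ₘ iA M) ⊗ₘ j) := by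
  rw [bracketFst_of_eq j (R.on_AM ha), ← tensorHom_id, tensorHom_comp_tensorHom, Category.id_comp]

/-- The double jacobiator vanishes if two arguments lie in `A`: each term then contains a bracket of
two elements of `A`. -/
theorem RestrictsTo.jacobiator_AAM :
    (S ◁ iA M ⊗ₘ (S ◁ iA M ⊗ₘ S ◁ iM M)) ≫ doubleJacobiator S (TX M) f = 0 := by
  apply pure_ext
  rintro G _ _ _ ⟨u, _, -, ⟨v, w, -, -, rfl⟩, rfl⟩
  rw [pair_tensorHom_assoc, pair_tensorHom, pair_doubleJacobiator, R.apply_AA, R.apply_AM ha,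
    R.apply_MA]
  simp only [← Category.assoc _ (bracketFst S f), R.bracketFst_AA]
  simp

/-- If one argument lies in `A`, then the double jacobiator expresses the compatibility of the
bracket with the anchor; the components of the bracket with values in `Σ A ⊗ M` drop out. -/
theorem RestrictsTo.jacobiator_AMM :
    (S ◁ iA M ⊗ₘ (S ◁ iM M ⊗ₘ S ◁ iM M)) ≫ doubleJacobiator S (TX M) f =
      compatLHS S M ρ b ≫ ((S ◁ iA M ⊗ₘ iA M) ⊗ₘ iA M) := by
  apply pure_ext
  rintro G _ _ _ ⟨u, _, -, ⟨v, w, -, -, rfl⟩, rfl⟩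
  rw [pair_tensorHom_assoc, pair_tensorHom, pair_doubleJacobiator, R.apply_MM, R.apply_AM ha,
    R.apply_MA, ← Category.assoc _ (bracketFst S f), ← Category.assoc _ (bracketFst S f),
    R.bracketFst_MA, R.bracketFst_MA, pair_add, Preadditive.add_comp, R.bracketFst_AA,
    R.bracketFst_AM ha]
  simp [compatLHS, nest, rotOut₁_natural, rotOut₂_natural]
  abel

end Brackets

end JacobiatorValues

/-! ### From double Poisson brackets to double Lie-Rinehart structures -/

section PoissonToDLR

set_option linter.unusedSectionVars false

variable {C : Type u} [Category.{v} C] [MonoidalCategory C] [SymmetricCategory C]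
  [Preadditive C] [MonoidalPreadditive C] [HasBinaryBiproducts C]

attribute [-simp] MonoidalCategory.tensor_whiskerLeft MonoidalCategory.whiskerRight_tensor
  MonoidalCategory.whisker_assoc BraidedCategory.braiding_tensor_left_hom
  BraidedCategory.braiding_tensor_right_hom MonoidalCategory.associator_conjugation

local infixr:90 " ⊙ " => pair

theorem isDerSnd_zero {U S X W : C} {mul : X ⊗ X ⟶ X} {l : X ⊗ W ⟶ W} {r : W ⊗ X ⟶ W} :
    IsDerSnd (S := S) (U := U) mul l r 0 := by
  intro G _ _ u x y
  simp

variable [HasCoequalizers C] [∀ X : C, PreservesColimitsOfShape WalkingParallelPair (tensorLeft X)]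
  [HasCoproductsOfShape ℕ C] [∀ X : C, PreservesColimitsOfShape (Discrete ℕ) (tensorLeft X)]
  {A : AssocMon C} {M : ABimod A} {S : C} {f : (S ⊗ TX M) ⊗ (S ⊗ TX M) ⟶ (S ⊗ TX M) ⊗ TX M}
  {ρ : (S ⊗ M.X) ⊗ (S ⊗ A.X) ⟶ (S ⊗ A.X) ⊗ A.X}
  {b : (S ⊗ M.X) ⊗ (S ⊗ M.X) ⟶ S ⊗ ((M.X ⊗ A.X) ⊞ (A.X ⊗ M.X))}

section Jacobi

/-- The double Jacobi identity holds on the image of three morphisms to `Σ T_A(M)`. -/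
def JacobiOn (f : (S ⊗ TX M) ⊗ (S ⊗ TX M) ⟶ (S ⊗ TX M) ⊗ TX M) {U V W : C} (i : U ⟶ S ⊗ TX M)
    (j : V ⟶ S ⊗ TX M) (k : W ⟶ S ⊗ TX M) : Prop :=
  (i ⊗ₘ (j ⊗ₘ k)) ≫ doubleJacobiator S (TX M) f = 0

variable {U V W : C} {i : U ⟶ S ⊗ TX M} {j : V ⟶ S ⊗ TX M} {k : W ⟶ S ⊗ TX M}

theorem JacobiOn.cyclic (h : JacobiOn f i j k) : JacobiOn f j k i := by
  have e : (j ⊗ₘ (k ⊗ₘ i)) ≫ rotIn₁ _ _ _ = rotIn₁ _ _ _ ≫ (i ⊗ₘ (j ⊗ₘ k)) := by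
    let : Probe U := Probe.leaf U
    let : Probe V := Probe.leaf V
    let : Probe W := Probe.leaf W
    apply pure_ext
    rintro G _ _ _ ⟨v, _, -, ⟨w, u, -, -, rfl⟩, rfl⟩
    simp
  rw [JacobiOn, ← doubleJacobiator_cyclic, reassoc_of% e, reassoc_of% h]
  simp

theorem JacobiOn.extend {Sinv : C} (e : Sinv ⊗ S ≅ 𝟙_ C)
    (ha : f = -((β_ (S ⊗ TX M) (S ⊗ TX M)).hom ≫ f ≫ sSwap S (TX M) (TX M)))
    (hf : IsDerFst (Tmul M) (intL S (TX M) (Tmul M)) (intR S (Tmul M) (TX M)) f)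
    (hA : JacobiOn f i j (S ◁ iA M)) (hM : JacobiOn f i j (S ◁ iM M)) :
    JacobiOn f i j (𝟙 _) := by
  have hd := doubleJacobiator_isDerSnd (B := T M) e ha hf
  have key : (i ⊗ₘ j) ▷ (S ⊗ TX M) ≫ (α_ _ _ _).hom ≫ doubleJacobiator S (TX M) f = 0 := by
    have hn : ∀ {W : C} (k : W ⟶ S ⊗ TX M), JacobiOn f i j k →
        (U ⊗ V) ◁ k ≫ (i ⊗ₘ j) ▷ (S ⊗ TX M) ≫ (α_ _ _ _).hom ≫ doubleJacobiator S (TX M) f = 0 := by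
      intro W k hk
      rw [← id_tensorHom, ← tensorHom_id, tensorHom_comp_tensorHom_assoc, Category.id_comp,
        Category.comp_id, associator_naturality_assoc, hk, comp_zero]
    exact IsDerSnd.ext (hd.whiskerRight (i ⊗ₘ j)) isDerSnd_zero
      ((hn _ hA).trans comp_zero.symm) ((hn _ hM).trans comp_zero.symm)
  rw [JacobiOn, ← cancel_epi (α_ _ _ _).hom, ← associator_naturality_assoc, tensorHom_id, key,
    comp_zero]

/-- The double Jacobi identity on `T_A(M)` follows from the double Jacobi identity on the
generators. -/
theorem doubleJacobiator_eq_zero {Sinv : C} (e : Sinv ⊗ S ≅ 𝟙_ C)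
    (ha : f = -((β_ (S ⊗ TX M) (S ⊗ TX M)).hom ≫ f ≫ sSwap S (TX M) (TX M)))
    (hf : IsDerFst (Tmul M) (intL S (TX M) (Tmul M)) (intR S (Tmul M) (TX M)) f)
    (hAAA : JacobiOn f (S ◁ iA M) (S ◁ iA M) (S ◁ iA M))
    (hAAM : JacobiOn f (S ◁ iA M) (S ◁ iA M) (S ◁ iM M))
    (hAMM : JacobiOn f (S ◁ iA M) (S ◁ iM M) (S ◁ iM M))
    (hMMM : JacobiOn f (S ◁ iM M) (S ◁ iM M) (S ◁ iM M)) :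
    doubleJacobiator S (TX M) f = 0 := by
  have hAA := hAAA.extend e ha hf hAAM
  have hAM := hAAM.cyclic.extend e ha hf hAMM
  have hMA := hAAM.cyclic.cyclic.extend e ha hf hAMM.cyclic.cyclic
  have hMM := hAMM.cyclic.extend e ha hf hMMM
  have hA := hAA.cyclic.extend e ha hf hMA.cyclic
  have hM := hAM.cyclic.extend e ha hf hMM.cyclic
  have h := hA.cyclic.extend e ha hf hM.cyclic
  rwa [JacobiOn, id_tensorHom_id, id_tensorHom_id, Category.id_comp] at h

end Jacobi

section Values

variable (R : RestrictsTo S M f ρ b) {G : C} [ComonObj G] [IsCommComonObj G] (s s' : G ⟶ S)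
  (a a' : G ⟶ A.X) (m m' : G ⟶ M.X)

include R

theorem RestrictsTo.pure_AA : (s ⊙ (a ≫ iA M)) ⊙ (s' ⊙ (a' ≫ iA M)) ≫ f = 0 := by
  rw [← pair_whiskerLeft, ← pair_whiskerLeft, R.apply_AA]

theorem RestrictsTo.pure_MA : (s ⊙ (m ≫ iM M)) ⊙ (s' ⊙ (a ≫ iA M)) ≫ f =
    ((s ⊙ m) ⊙ (s' ⊙ a) ≫ ρ) ≫ (S ◁ iA M ⊗ₘ iA M) := by
  rw [← pair_whiskerLeft, ← pair_whiskerLeft, R.apply_MA]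

theorem RestrictsTo.pure_MM : (s ⊙ (m ≫ iM M)) ⊙ (s' ⊙ (m' ≫ iM M)) ≫ f =
    ((s ⊙ m) ⊙ (s' ⊙ m') ≫ brL S M b) ≫ (S ◁ iM M ⊗ₘ iA M) +
      ((s ⊙ m) ⊙ (s' ⊙ m') ≫ brR S M b) ≫ (S ◁ iA M ⊗ₘ iM M) := by
  rw [← pair_whiskerLeft, ← pair_whiskerLeft, R.apply_MM]

end Values

/-- The restrictions of a linear double Poisson bracket form a double Lie-Rinehart structure. -/
theorem RestrictsTo.isDLR (R : RestrictsTo S M f ρ b) (hf : IsDoublePoisson S (T M) f) :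
    IsDLR S M ρ b := by
  have ha : f = -((β_ (S ⊗ TX M) (S ⊗ TX M)).hom ≫ f ≫ sSwap S (TX M) (TX M)) := hf.antisymm
  have h₁ : IsDerFst (Tmul M) (intL S (TX M) (Tmul M)) (intR S (Tmul M) (TX M)) f := hf.isDerFst
  have h₂ : IsDerSnd (Tmul M) (extL S (Tmul M) (TX M)) (extR S (TX M) (Tmul M)) f := hf.isDerSnd
  have hl : (S ⊗ M.X) ◁ (S ◁ M.actL) ≫ brL S M b =
      sndOutL S (S ⊗ M.X) A.X M.X ≫ A.X ◁ brL S M b ≫ extL S M.actL A.X ∧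
    (S ⊗ M.X) ◁ (S ◁ M.actL) ≫ brR S M b =
      sndOutR S (S ⊗ M.X) A.X M.X ≫ ρ ▷ M.X ≫ extR S A.X M.actL +
      sndOutL S (S ⊗ M.X) A.X M.X ≫ A.X ◁ brR S M b ≫ extL S A.mul M.X := by
    apply cancel_MA_AM (M := M)
    apply pure_ext
    rintro G _ _ _ ⟨_, _, ⟨s, m, -, -, rfl⟩, ⟨s', _, -, ⟨a, m', -, -, rfl⟩, rfl⟩, rfl⟩
    have h := h₂.apply (s ⊙ (m ≫ iM M)) s' (a ≫ iA M) (m' ≫ iM M)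
    rw [mul_iA_iM, ← Category.assoc, R.pure_MM, R.pure_MM, R.pure_MA, pair_add,
      Preadditive.add_comp, extL_natural (iA_iM_mul M), extL_natural (iA_iA_mul M),
      extR_natural (iA_iM_mul M)] at h
    simp at h ⊢
    rw [h]
    abel
  have hr : (S ⊗ M.X) ◁ (S ◁ M.actR) ≫ brL S M b =
      sndOutR S (S ⊗ M.X) M.X A.X ≫ brL S M b ▷ A.X ≫ extR S M.X A.mul +
      sndOutL S (S ⊗ M.X) M.X A.X ≫ M.X ◁ ρ ≫ extL S M.actR A.X ∧
    (S ⊗ M.X) ◁ (S ◁ M.actR) ≫ brR S M b =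
      sndOutR S (S ⊗ M.X) M.X A.X ≫ brR S M b ▷ A.X ≫ extR S A.X M.actR := by
    apply cancel_MA_AM (M := M)
    apply pure_ext
    rintro G _ _ _ ⟨_, _, ⟨s, m, -, -, rfl⟩, ⟨s', _, -, ⟨m', a, -, -, rfl⟩, rfl⟩, rfl⟩
    have h := h₂.apply (s ⊙ (m ≫ iM M)) s' (m' ≫ iM M) (a ≫ iA M)
    rw [mul_iM_iA, ← Category.assoc, R.pure_MM, R.pure_MM, R.pure_MA, add_pair,
      Preadditive.add_comp, extL_natural (iM_iA_mul M), extR_natural (iA_iA_mul M),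
      extR_natural (iM_iA_mul M)] at h
    simp at h ⊢
    rw [h]
    abel
  refine ⟨?_, ?_, ?_, ?_, hl.1, hl.2, hr.1, hr.2, ?_, ?_⟩
  · apply cancel_AA (M := M)
    apply pure_ext
    rintro G _ _ _ ⟨a, _, -, ⟨_, _, ⟨s, m, -, -, rfl⟩, ⟨s', a', -, -, rfl⟩, rfl⟩, rfl⟩
    have h := h₁.apply (s' ⊙ (a' ≫ iA M)) s (a ≫ iA M) (m ≫ iM M)
    rw [mul_iA_iM, ← Category.assoc, R.pure_MA, R.pure_MA, R.pure_AA,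
      intL_natural (iA_iA_mul M)] at h
    simpa using h
  · apply cancel_AA (M := M)
    apply pure_ext
    rintro G _ _ _ ⟨_, a, ⟨_, _, ⟨s, m, -, -, rfl⟩, ⟨s', a', -, -, rfl⟩, rfl⟩, -, rfl⟩
    have h := h₁.apply (s' ⊙ (a' ≫ iA M)) s (m ≫ iM M) (a ≫ iA M)
    rw [mul_iM_iA, ← Category.assoc, R.pure_MA, R.pure_MA, R.pure_AA,
      intR_natural (iA_iA_mul M)] at h
    simpa using h
  · apply cancel_AA (M := M)
    apply pure_ext
    rintro G _ _ _ ⟨_, _, ⟨s, m, -, -, rfl⟩, ⟨s', _, -, ⟨a, a', -, -, rfl⟩, rfl⟩, rfl⟩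
    have h := h₂.apply (s ⊙ (m ≫ iM M)) s' (a ≫ iA M) (a' ≫ iA M)
    rw [mul_iA_iA, ← Category.assoc, R.pure_MA, R.pure_MA, R.pure_MA,
      extL_natural (iA_iA_mul M), extR_natural (iA_iA_mul M)] at h
    simpa using h
  · rw [bracket_antisymm_iff]
    apply cancel_MA_AM (M := M)
    apply pure_ext
    rintro G _ _ _ ⟨_, _, ⟨s, m, -, -, rfl⟩, ⟨s', m', -, -, rfl⟩, rfl⟩
    have h := pair_antisymm ha (s' ⊙ (m' ≫ iM M)) (s ⊙ (m ≫ iM M))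
    rw [← Category.assoc, R.pure_MM, R.pure_MM] at h
    simp [sSwap_natural] at h ⊢
    rw [h]
  · have h := R.jacobiator_AMM ha
    have hj : doubleJacobiator S (TX M) f = 0 := hf.jacobi
    rw [hj, comp_zero] at h
    exact cancel_AAA (M := M) (h.symm.trans zero_comp.symm)
  · have h := R.jacobiator_MMM
    have hj : doubleJacobiator S (TX M) f = 0 := hf.jacobi
    rw [hj, comp_zero] at h
    have h' := h =≫ ((S ◁ prM M ⊗ₘ prA M) ⊗ₘ prA M)
    change jacobiLHS S M ρ b = 0
    simpa only [Preadditive.add_comp, Category.assoc, tensorHom_comp_tensorHom,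
      ← whiskerLeft_comp, iA_prA, iM_prM, iA_prM, iM_prA, MonoidalPreadditive.whiskerLeft_zero,
      MonoidalPreadditive.zero_tensor, MonoidalPreadditive.tensor_zero, comp_zero, add_zero,
      zero_comp, whiskerLeft_id, id_tensorHom_id, Category.comp_id] using h'.symm

end PoissonToDLR

/-! ### Derivations with given values, in one variable of a bracket -/

section ExtensionInVariables

set_option linter.unusedSectionVars false

variable {C : Type u} [Category.{v} C] [MonoidalCategory C] [SymmetricCategory C]
  [Preadditive C] [MonoidalPreadditive C] [HasBinaryBiproducts C]

attribute [-simp] MonoidalCategory.tensor_whiskerLeft MonoidalCategory.whiskerRight_tensor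
  MonoidalCategory.whisker_assoc BraidedCategory.braiding_tensor_left_hom
  BraidedCategory.braiding_tensor_right_hom MonoidalCategory.associator_conjugation

local infixr:90 " ⊙ " => pair

section Leibniz

variable {U V S T W X Y Z : C}

/-- The Leibniz rule in the second variable, for `d(u, x y)` with `x` and `y` in objects `X` and `Y`
over the algebra `T` and `x y` in an object `Z`. -/
def LeibnizSnd (l : T ⊗ W ⟶ W) (r : W ⊗ T ⟶ W) (i : X ⟶ T) (j : Y ⟶ T) (mul : X ⊗ Y ⟶ Z)
    (dX : U ⊗ (S ⊗ X) ⟶ W) (dY : U ⊗ (S ⊗ Y) ⟶ W) (d : U ⊗ (S ⊗ Z) ⟶ W) : Prop :=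
  U ◁ (S ◁ mul) ≫ d = sndOutL S U X Y ≫ (i ⊗ₘ dY) ≫ l + sndOutR S U X Y ≫ (dX ⊗ₘ j) ≫ r

/-- The Leibniz rule in the first variable. -/
def LeibnizFst (l : T ⊗ W ⟶ W) (r : W ⊗ T ⟶ W) (i : X ⟶ T) (j : Y ⟶ T) (mul : X ⊗ Y ⟶ Z)
    (dX : (S ⊗ X) ⊗ V ⟶ W) (dY : (S ⊗ Y) ⊗ V ⟶ W) (d : (S ⊗ Z) ⊗ V ⟶ W) : Prop :=
  (S ◁ mul) ▷ V ≫ d = fstOutL S X Y V ≫ (i ⊗ₘ dY) ≫ l + fstOutR S X Y V ≫ (dX ⊗ₘ j) ≫ r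

variable {l : T ⊗ W ⟶ W} {r : W ⊗ T ⟶ W} {i : X ⟶ T} {j : Y ⟶ T} {mul : X ⊗ Y ⟶ Z}

theorem LeibnizSnd.apply {dX : U ⊗ (S ⊗ X) ⟶ W} {dY : U ⊗ (S ⊗ Y) ⟶ W} {d : U ⊗ (S ⊗ Z) ⟶ W}
    (h : LeibnizSnd l r i j mul dX dY d) {G : C} [ComonObj G] [IsCommComonObj G] (u : G ⟶ U)
    (s : G ⟶ S) (x : G ⟶ X) (y : G ⟶ Y) : u ⊙ (s ⊙ (x ⊙ y ≫ mul)) ≫ d =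
      (x ≫ i) ⊙ (u ⊙ s ⊙ y ≫ dY) ≫ l + (u ⊙ s ⊙ x ≫ dX) ⊙ (y ≫ j) ≫ r := by
  simpa using u ⊙ s ⊙ x ⊙ y ≫= h

theorem leibnizSnd_of_pure [Probe U] {dX : U ⊗ (S ⊗ X) ⟶ W} {dY : U ⊗ (S ⊗ Y) ⟶ W}
    {d : U ⊗ (S ⊗ Z) ⟶ W}
    (h : ∀ ⦃G : C⦄ [ComonObj G] [IsCommComonObj G] (u : G ⟶ U) (s : G ⟶ S) (x : G ⟶ X) (y : G ⟶ Y),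
      Probe.El u → u ⊙ (s ⊙ (x ⊙ y ≫ mul)) ≫ d =
        (x ≫ i) ⊙ (u ⊙ s ⊙ y ≫ dY) ≫ l + (u ⊙ s ⊙ x ≫ dX) ⊙ (y ≫ j) ≫ r) :
    LeibnizSnd l r i j mul dX dY d := by
  let : Probe S := Probe.leaf S
  let : Probe X := Probe.leaf X
  let : Probe Y := Probe.leaf Y
  apply pure_ext
  rintro G _ _ _ ⟨u, _, hu, ⟨s, _, -, ⟨x, y, -, -, rfl⟩, rfl⟩, rfl⟩
  simpa using h u s x y hu

theorem leibnizFst_of_pure [Probe V] {dX : (S ⊗ X) ⊗ V ⟶ W} {dY : (S ⊗ Y) ⊗ V ⟶ W}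
    {d : (S ⊗ Z) ⊗ V ⟶ W}
    (h : ∀ ⦃G : C⦄ [ComonObj G] [IsCommComonObj G] (v : G ⟶ V) (s : G ⟶ S) (x : G ⟶ X) (y : G ⟶ Y),
      Probe.El v → (s ⊙ (x ⊙ y ≫ mul)) ⊙ v ≫ d =
        (x ≫ i) ⊙ ((s ⊙ y) ⊙ v ≫ dY) ≫ l + ((s ⊙ x) ⊙ v ≫ dX) ⊙ (y ≫ j) ≫ r) :
    LeibnizFst l r i j mul dX dY d := by
  let : Probe S := Probe.leaf S
  let : Probe X := Probe.leaf X
  let : Probe Y := Probe.leaf Y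
  apply pure_ext
  rintro G _ _ _ ⟨_, v, ⟨s, _, -, ⟨x, y, -, -, rfl⟩, rfl⟩, hv, rfl⟩
  simpa using h v s x y hv

theorem LeibnizFst.apply {dX : (S ⊗ X) ⊗ V ⟶ W} {dY : (S ⊗ Y) ⊗ V ⟶ W} {d : (S ⊗ Z) ⊗ V ⟶ W}
    (h : LeibnizFst l r i j mul dX dY d) {G : C} [ComonObj G] [IsCommComonObj G] (v : G ⟶ V)
    (s : G ⟶ S) (x : G ⟶ X) (y : G ⟶ Y) : (s ⊙ (x ⊙ y ≫ mul)) ⊙ v ≫ d =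
      (x ≫ i) ⊙ ((s ⊙ y) ⊙ v ≫ dY) ≫ l + ((s ⊙ x) ⊙ v ≫ dX) ⊙ (y ≫ j) ≫ r := by
  simpa using (s ⊙ x ⊙ y) ⊙ v ≫= h

theorem LeibnizFst.leibnizSnd {dX : (S ⊗ X) ⊗ V ⟶ W} {dY : (S ⊗ Y) ⊗ V ⟶ W}
    {d : (S ⊗ Z) ⊗ V ⟶ W} (h : LeibnizFst l r i j mul dX dY d) :
    LeibnizSnd l r i j mul ((β_ _ _).hom ≫ dX) ((β_ _ _).hom ≫ dY) ((β_ _ _).hom ≫ d) := by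
  let : Probe V := Probe.leaf V
  refine leibnizSnd_of_pure fun G _ _ u s x y _ => ?_
  simpa using h.apply u s x y

/-- The Leibniz rule for a parameter that carries the suspension. -/
theorem LeibnizSnd.assoc {dX : U ⊗ (S ⊗ X) ⟶ W} {dY : U ⊗ (S ⊗ Y) ⟶ W} {d : U ⊗ (S ⊗ Z) ⟶ W}
    (h : LeibnizSnd l r i j mul dX dY d) ⦃G : C⦄ [ComonObj G] [IsCommComonObj G] (u : G ⟶ U ⊗ S)
    (x : G ⟶ X) (y : G ⟶ Y) : u ⊙ (x ⊙ y ≫ mul) ≫ (α_ _ _ _).hom ≫ d =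
      (x ≫ i) ⊙ (u ⊙ y ≫ (α_ _ _ _).hom ≫ dY) ≫ l +
        (u ⊙ x ≫ (α_ _ _ _).hom ≫ dX) ⊙ (y ≫ j) ≫ r := by
  have key : (U ⊗ S) ◁ mul ≫ (α_ _ _ _).hom ≫ d =
      (α_ _ _ _).inv ≫ (β_ _ _).hom ▷ _ ≫ (α_ _ _ _).hom ≫ (i ⊗ₘ ((α_ _ _ _).hom ≫ dY)) ≫ l +
        (α_ _ _ _).inv ≫ (((α_ _ _ _).hom ≫ dX) ⊗ₘ j) ≫ r := by
    let : Probe U := Probe.leaf U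
    let : Probe S := Probe.leaf S
    let : Probe X := Probe.leaf X
    let : Probe Y := Probe.leaf Y
    apply pure_ext
    rintro G _ _ _ ⟨_, _, ⟨u, s, -, -, rfl⟩, ⟨x, y, -, -, rfl⟩, rfl⟩
    simpa using h.apply u s x y
  simpa using u ⊙ x ⊙ y ≫= key

end Leibniz

/-- The Leibniz rule in the second variable, for the external structure, preserves derivations in
the first variable for the internal structure. -/
theorem isDerFst_leibnizSnd {B : AssocMon C} {S : C}
    {f : (S ⊗ B.X) ⊗ (S ⊗ B.X) ⟶ (S ⊗ B.X) ⊗ B.X}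
    (hf : IsDerFst B.mul (intL S B.X B.mul) (intR S B.mul B.X) f) :
    IsDerFst B.mul (intL S B.X B.mul) (intR S B.mul B.X)
      (sndOutL S (S ⊗ B.X) B.X B.X ≫ B.X ◁ f ≫ extL S B.mul B.X +
        sndOutR S (S ⊗ B.X) B.X B.X ≫ f ▷ B.X ≫ extR S B.X B.mul) := by
  let : Probe S := Probe.leaf S
  let : Probe B.X := Probe.leaf _
  refine isDerFst_of_pure ?_
  rintro G _ _ _ s x y ⟨s', _, -, ⟨t, t', -, -, rfl⟩, rfl⟩
  simp [hf.apply, intL_extL, intL_extR, intR_extL, intR_extR]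
  abel

/-- The Leibniz rule in the first variable, for the internal structure, preserves derivations in the
second variable for the external structure. -/
theorem isDerSnd_leibnizFst {B : AssocMon C} {S X Y : C} (i : X ⟶ B.X) (j : Y ⟶ B.X)
    {dX : (S ⊗ X) ⊗ (S ⊗ B.X) ⟶ (S ⊗ B.X) ⊗ B.X} {dY : (S ⊗ Y) ⊗ (S ⊗ B.X) ⟶ (S ⊗ B.X) ⊗ B.X}
    (hX : IsDerSnd B.mul (extL S B.mul B.X) (extR S B.X B.mul) dX)
    (hY : IsDerSnd B.mul (extL S B.mul B.X) (extR S B.X B.mul) dY) :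
    IsDerSnd B.mul (extL S B.mul B.X) (extR S B.X B.mul)
      (fstOutL S X Y (S ⊗ B.X) ≫ (i ⊗ₘ dY) ≫ intL S B.X B.mul +
        fstOutR S X Y (S ⊗ B.X) ≫ (dX ⊗ₘ j) ≫ intR S B.mul B.X) := by
  let : Probe X := Probe.leaf X
  let : Probe Y := Probe.leaf Y
  let : Probe S := Probe.leaf S
  refine isDerSnd_of_pure ?_
  rintro G _ _ _ s' t t' ⟨s, _, -, ⟨x, y, -, -, rfl⟩, rfl⟩
  simp [hX.apply, hY.apply, intL_extL, intL_extR, intR_extL, intR_extR]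
  abel

variable [HasCoequalizers C] [∀ X : C, PreservesColimitsOfShape WalkingParallelPair (tensorLeft X)]
  [HasCoproductsOfShape ℕ C] [∀ X : C, PreservesColimitsOfShape (Discrete ℕ) (tensorLeft X)]
  {A : AssocMon C} {M : ABimod A} {U V S W : C} {l : TX M ⊗ W ⟶ W} {r : W ⊗ TX M ⟶ W}

/-- Values on the generators extend to a derivation of `T_A(M)` in the second variable. -/
theorem exists_isDerSnd (hB : IsBimodule (Tmul M) l r) {dA : U ⊗ (S ⊗ A.X) ⟶ W}
    {dM : U ⊗ (S ⊗ M.X) ⟶ W} (hmul : LeibnizSnd l r (iA M) (iA M) A.mul dA dA dA)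
    (hL : LeibnizSnd l r (iA M) (iM M) M.actL dA dM dM)
    (hR : LeibnizSnd l r (iM M) (iA M) M.actR dM dA dM) :
    ∃ D : U ⊗ (S ⊗ TX M) ⟶ W, IsDerSnd (Tmul M) l r D ∧ U ◁ S ◁ iA M ≫ D = dA ∧
      U ◁ S ◁ iM M ≫ D = dM := by
  have h : IsDerGen M l r ((α_ U S A.X).hom ≫ dA) ((α_ U S M.X).hom ≫ dM) :=
    ⟨hB, hmul.assoc, hL.assoc, hR.assoc⟩
  let : Probe U := Probe.leaf U
  let : Probe S := Probe.leaf S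
  refine ⟨(α_ U S (TX M)).inv ≫ derExt h, ?_, ?_, ?_⟩
  · rw [IsDerSnd, Iso.hom_inv_id_assoc]
    exact derExt_isDer h
  · let : Probe A.X := Probe.leaf A.X
    apply pure_ext
    rintro G _ _ _ ⟨u, _, -, ⟨s, a, -, -, rfl⟩, rfl⟩
    simp [pair_iA_derExt]
  · let : Probe M.X := Probe.leaf M.X
    apply pure_ext
    rintro G _ _ _ ⟨u, _, -, ⟨s, a, -, -, rfl⟩, rfl⟩
    simp [pair_iM_derExt]

/-- Values on the generators extend to a derivation of `T_A(M)` in the first variable. -/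
theorem exists_isDerFst (hB : IsBimodule (Tmul M) l r) {dA : (S ⊗ A.X) ⊗ V ⟶ W}
    {dM : (S ⊗ M.X) ⊗ V ⟶ W} (hmul : LeibnizFst l r (iA M) (iA M) A.mul dA dA dA)
    (hL : LeibnizFst l r (iA M) (iM M) M.actL dA dM dM)
    (hR : LeibnizFst l r (iM M) (iA M) M.actR dM dA dM) :
    ∃ D : (S ⊗ TX M) ⊗ V ⟶ W, IsDerFst (Tmul M) l r D ∧ (S ◁ iA M) ▷ V ≫ D = dA ∧
      (S ◁ iM M) ▷ V ≫ D = dM := by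
  obtain ⟨D, hD, hA, hM⟩ := exists_isDerSnd hB hmul.leibnizSnd hL.leibnizSnd hR.leibnizSnd
  refine ⟨(β_ _ _).hom ≫ D, ?_, ?_, ?_⟩
  · rwa [IsDerFst, SymmetricCategory.symmetry_assoc]
  · rw [BraidedCategory.braiding_naturality_left_assoc, hA, SymmetricCategory.symmetry_assoc]
  · rw [BraidedCategory.braiding_naturality_left_assoc, hM, SymmetricCategory.symmetry_assoc]

end ExtensionInVariables

/-! ### From double Lie-Rinehart structures to double brackets -/

section DLRToPoisson

set_option linter.unusedSectionVars false

variable {C : Type u} [Category.{v} C] [MonoidalCategory C] [SymmetricCategory C]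
  [Preadditive C] [MonoidalPreadditive C] [HasBinaryBiproducts C]

attribute [-simp] MonoidalCategory.tensor_whiskerLeft MonoidalCategory.whiskerRight_tensor
  MonoidalCategory.whisker_assoc BraidedCategory.braiding_tensor_left_hom
  BraidedCategory.braiding_tensor_right_hom MonoidalCategory.associator_conjugation

local infixr:90 " ⊙ " => pair

variable [HasCoequalizers C] [∀ X : C, PreservesColimitsOfShape WalkingParallelPair (tensorLeft X)]
  [HasCoproductsOfShape ℕ C] [∀ X : C, PreservesColimitsOfShape (Discrete ℕ) (tensorLeft X)]
  {A : AssocMon C} {S : C}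

section Values

variable (S) (M : ABimod A) (ρ : (S ⊗ M.X) ⊗ (S ⊗ A.X) ⟶ (S ⊗ A.X) ⊗ A.X)
  (b : (S ⊗ M.X) ⊗ (S ⊗ M.X) ⟶ S ⊗ ((M.X ⊗ A.X) ⊞ (A.X ⊗ M.X)))

/-- The values on `Σ M ⊗ Σ A` of the linear double bracket with restrictions `(ρ, b)`. -/
noncomputable def valMA : (S ⊗ M.X) ⊗ (S ⊗ A.X) ⟶ (S ⊗ TX M) ⊗ TX M :=
  ρ ≫ (S ◁ iA M ⊗ₘ iA M)

/-- The values on `Σ A ⊗ Σ M` of the linear double bracket with restrictions `(ρ, b)`. -/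
noncomputable def valAM : (S ⊗ A.X) ⊗ (S ⊗ M.X) ⟶ (S ⊗ TX M) ⊗ TX M :=
  anchorSwap S M ρ ≫ (S ◁ iA M ⊗ₘ iA M)

/-- The values on `Σ M ⊗ Σ M` of the linear double bracket with restrictions `(ρ, b)`. -/
noncomputable def valMM : (S ⊗ M.X) ⊗ (S ⊗ M.X) ⟶ (S ⊗ TX M) ⊗ TX M :=
  brL S M b ≫ (S ◁ iM M ⊗ₘ iA M) + brR S M b ≫ (S ◁ iA M ⊗ₘ iM M)

end Values

variable {M : ABimod A} {ρ : (S ⊗ M.X) ⊗ (S ⊗ A.X) ⟶ (S ⊗ A.X) ⊗ A.X}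
  {b : (S ⊗ M.X) ⊗ (S ⊗ M.X) ⟶ S ⊗ ((M.X ⊗ A.X) ⊞ (A.X ⊗ M.X))}

section Antisymmetry

variable {G : C} [ComonObj G] [IsCommComonObj G]

theorem pair_valAM (u : G ⟶ S ⊗ A.X) (w : G ⟶ S ⊗ M.X) :
    u ⊙ w ≫ valAM S M ρ = -(w ⊙ u ≫ valMA S M ρ ≫ sSwap S (TX M) (TX M)) := by
  simp [valAM, valMA, anchorSwap, sSwap_natural]

theorem pair_valMA (u : G ⟶ S ⊗ A.X) (w : G ⟶ S ⊗ M.X) :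
    w ⊙ u ≫ valMA S M ρ = -(u ⊙ w ≫ valAM S M ρ ≫ sSwap S (TX M) (TX M)) := by
  rw [← Category.assoc, pair_valAM]
  simp [sSwap_sSwap]

variable (h : IsDLR S M ρ b)

include h

theorem IsDLR.pair_valMM (w w' : G ⟶ S ⊗ M.X) :
    w ⊙ w' ≫ valMM S M b = -(w' ⊙ w ≫ valMM S M b ≫ sSwap S (TX M) (TX M)) := by
  have ha := (bracket_antisymm_iff b).1 h.antisymm
  have hl : w ⊙ w' ≫ brL S M b = -(w' ⊙ w ≫ brR S M b ≫ sSwap S A.X M.X) := by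
    simpa using w' ⊙ w ≫= ha.1
  have hr : w ⊙ w' ≫ brR S M b = -(w' ⊙ w ≫ brL S M b ≫ sSwap S M.X A.X) := by
    simpa using w' ⊙ w ≫= ha.2
  simp only [valMM, Preadditive.comp_add, Preadditive.add_comp, reassoc_of% hl, reassoc_of% hr,
    Category.assoc, sSwap_natural, Preadditive.neg_comp, neg_add]
  abel

end Antisymmetry

section LeibnizSnd

variable (h : IsDLR S M ρ b)

include h

local notation "E" => extL S (Tmul M) (TX M)
local notation "E'" => extR S (TX M) (Tmul M)

theorem IsDLR.leibniz_MAA :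
    LeibnizSnd E E' (iA M) (iA M) A.mul (valMA S M ρ) (valMA S M ρ) (valMA S M ρ) := by
  let : Probe (S ⊗ M.X) := Probe.leaf _
  refine leibnizSnd_of_pure fun G _ _ w s a a' _ => ?_
  have h' := w ⊙ s ⊙ a ⊙ a' ≫= h.anchor_derivation =≫ (S ◁ iA M ⊗ₘ iA M)
  simp only [valMA, ← Category.assoc _ ρ]
  rw [extL_natural (iA_iA_mul M), extR_natural (iA_iA_mul M)]
  simpa using h'

theorem IsDLR.leibniz_MAM :
    LeibnizSnd E E' (iA M) (iM M) M.actL (valMA S M ρ) (valMM S M b) (valMM S M b) := by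
  let : Probe (S ⊗ M.X) := Probe.leaf _
  refine leibnizSnd_of_pure fun G _ _ w s a m _ => ?_
  have hl := w ⊙ s ⊙ a ⊙ m ≫= h.derivation_left_l =≫ (S ◁ iM M ⊗ₘ iA M)
  have hr := w ⊙ s ⊙ a ⊙ m ≫= h.derivation_left_r =≫ (S ◁ iA M ⊗ₘ iM M)
  simp only [valMA, valMM, Preadditive.comp_add, ← Category.assoc _ ρ,
    ← Category.assoc _ (brL S M b), ← Category.assoc _ (brR S M b), pair_add, Preadditive.add_comp]
  rw [extL_natural (iA_iA_mul M), extL_natural (iA_iM_mul M), extR_natural (iA_iM_mul M)]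
  simp at hl hr ⊢
  rw [hl, hr]
  abel

theorem IsDLR.leibniz_MMA :
    LeibnizSnd E E' (iM M) (iA M) M.actR (valMM S M b) (valMA S M ρ) (valMM S M b) := by
  let : Probe (S ⊗ M.X) := Probe.leaf _
  refine leibnizSnd_of_pure fun G _ _ w s m a _ => ?_
  have hl := w ⊙ s ⊙ m ⊙ a ≫= h.derivation_right_l =≫ (S ◁ iM M ⊗ₘ iA M)
  have hr := w ⊙ s ⊙ m ⊙ a ≫= h.derivation_right_r =≫ (S ◁ iA M ⊗ₘ iM M)
  simp only [valMA, valMM, Preadditive.comp_add, ← Category.assoc _ ρ,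
    ← Category.assoc _ (brL S M b), ← Category.assoc _ (brR S M b), add_pair, Preadditive.add_comp]
  rw [extL_natural (iM_iA_mul M), extR_natural (iM_iA_mul M), extR_natural (iA_iA_mul M)]
  simp at hl hr ⊢
  rw [hl, hr]
  abel

theorem IsDLR.leibniz_AAM :
    LeibnizSnd E E' (iA M) (iM M) M.actL 0 (valAM S M ρ) (valAM S M ρ) := by
  let : Probe (S ⊗ A.X) := Probe.leaf _
  refine leibnizSnd_of_pure fun G _ _ u s a m _ => ?_
  have h' := a ⊙ (s ⊙ m) ⊙ u ≫= h.anchor_left =≫ (S ◁ iA M ⊗ₘ iA M) ≫ sSwap S (TX M) (TX M)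
  have e := intL_natural (S := S) (iA_iA_mul M) (iA M) a ((s ⊙ m) ⊙ u ≫ ρ)
  simp only [pair_valAM, pair_neg, Preadditive.neg_comp, ← Category.assoc _ (valMA S M ρ),
    ← intL_sSwap]
  simp only [valMA, Category.assoc] at h' e ⊢
  rw [← Category.assoc (_ ⊙ _) (intL _ _ _), e]
  simpa using h'

theorem IsDLR.leibniz_AMA :
    LeibnizSnd E E' (iM M) (iA M) M.actR (valAM S M ρ) 0 (valAM S M ρ) := by
  let : Probe (S ⊗ A.X) := Probe.leaf _
  refine leibnizSnd_of_pure fun G _ _ u s m a _ => ?_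
  have h' := ((s ⊙ m) ⊙ u) ⊙ a ≫= h.anchor_right =≫ (S ◁ iA M ⊗ₘ iA M) ≫ sSwap S (TX M) (TX M)
  have e := intR_natural (S := S) (iA_iA_mul M) (iA M) a ((s ⊙ m) ⊙ u ≫ ρ)
  simp only [pair_valAM, neg_pair, Preadditive.neg_comp, ← Category.assoc _ (valMA S M ρ),
    ← intR_sSwap]
  simp only [valMA, Category.assoc] at h' e ⊢
  rw [← Category.assoc (_ ⊙ _) (intR _ _ _), e]
  simpa using h'

end LeibnizSnd

section Opposite

variable {U V X Y Z T : C}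

theorem LeibnizSnd.swapNeg {i : X ⟶ T} {j : Y ⟶ T} {mul : X ⊗ Y ⟶ Z} {μ : T ⊗ T ⟶ T}
    {dX : U ⊗ (S ⊗ X) ⟶ (S ⊗ T) ⊗ T} {dY : U ⊗ (S ⊗ Y) ⟶ (S ⊗ T) ⊗ T}
    {d : U ⊗ (S ⊗ Z) ⟶ (S ⊗ T) ⊗ T}
    (h : LeibnizSnd (extL S μ T) (extR S T μ) i j mul dX dY d) :
    LeibnizFst (intL S T μ) (intR S μ T) i j mul (swapNeg dX) (swapNeg dY) (swapNeg d) := by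
  let : Probe U := Probe.leaf U
  refine leibnizFst_of_pure fun G _ _ u s x y _ => ?_
  rw [pair_swapNeg, ← Category.assoc, h.apply]
  simp [pair_swapNeg, extL_sSwap, extR_sSwap]
  abel

theorem swapNeg_zero : swapNeg (0 : U ⊗ V ⟶ (S ⊗ T) ⊗ T) = 0 := by
  simp [swapNeg]

theorem swapNeg_valMA : swapNeg (valMA S M ρ) = valAM S M ρ := by
  apply pure_ext
  rintro G _ _ _ ⟨u, w, -, -, rfl⟩
  rw [pair_swapNeg, pair_valAM]

theorem swapNeg_valAM : swapNeg (valAM S M ρ) = valMA S M ρ := by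
  apply pure_ext
  rintro G _ _ _ ⟨u, w, -, -, rfl⟩
  rw [pair_swapNeg, pair_valMA]

theorem IsDLR.swapNeg_valMM (h : IsDLR S M ρ b) : swapNeg (valMM S M b) = valMM S M b := by
  apply pure_ext
  rintro G _ _ _ ⟨u, w, -, -, rfl⟩
  rw [pair_swapNeg, ← h.pair_valMM]

end Opposite

section Construction

theorem leibnizFst_ext {X Y Z : C} {i : X ⟶ TX M} {j : Y ⟶ TX M} {mul : X ⊗ Y ⟶ Z}
    {dX : (S ⊗ X) ⊗ (S ⊗ TX M) ⟶ (S ⊗ TX M) ⊗ TX M}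
    {dY : (S ⊗ Y) ⊗ (S ⊗ TX M) ⟶ (S ⊗ TX M) ⊗ TX M}
    {d : (S ⊗ Z) ⊗ (S ⊗ TX M) ⟶ (S ⊗ TX M) ⊗ TX M}
    (hX : IsDerSnd (Tmul M) (extL S (Tmul M) (TX M)) (extR S (TX M) (Tmul M)) dX)
    (hY : IsDerSnd (Tmul M) (extL S (Tmul M) (TX M)) (extR S (TX M) (Tmul M)) dY)
    (hd : IsDerSnd (Tmul M) (extL S (Tmul M) (TX M)) (extR S (TX M) (Tmul M)) d)
    (hA : LeibnizFst (intL S (TX M) (Tmul M)) (intR S (Tmul M) (TX M)) i j mul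
      ((S ⊗ X) ◁ S ◁ iA M ≫ dX) ((S ⊗ Y) ◁ S ◁ iA M ≫ dY) ((S ⊗ Z) ◁ S ◁ iA M ≫ d))
    (hM : LeibnizFst (intL S (TX M) (Tmul M)) (intR S (Tmul M) (TX M)) i j mul
      ((S ⊗ X) ◁ S ◁ iM M ≫ dX) ((S ⊗ Y) ◁ S ◁ iM M ≫ dY) ((S ⊗ Z) ◁ S ◁ iM M ≫ d)) :
    LeibnizFst (intL S (TX M) (Tmul M)) (intR S (Tmul M) (TX M)) i j mul dX dY d := by
  have hn : ∀ {V : C} (k : V ⟶ TX M), LeibnizFst (intL S (TX M) (Tmul M)) (intR S (Tmul M) (TX M))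
      i j mul ((S ⊗ X) ◁ S ◁ k ≫ dX) ((S ⊗ Y) ◁ S ◁ k ≫ dY) ((S ⊗ Z) ◁ S ◁ k ≫ d) →
      (S ⊗ (X ⊗ Y)) ◁ S ◁ k ≫ (S ◁ mul) ▷ (S ⊗ TX M) ≫ d =
        (S ⊗ (X ⊗ Y)) ◁ S ◁ k ≫ (fstOutL S X Y (S ⊗ TX M) ≫ (i ⊗ₘ dY) ≫ intL S (TX M) (Tmul M) +
          fstOutR S X Y (S ⊗ TX M) ≫ (dX ⊗ₘ j) ≫ intR S (Tmul M) (TX M)) := by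
    intro V k hk
    let : Probe X := Probe.leaf X
    let : Probe Y := Probe.leaf Y
    let : Probe V := Probe.leaf V
    apply pure_ext
    rintro G _ _ _ ⟨_, _, ⟨s, _, -, ⟨x, y, -, -, rfl⟩, rfl⟩, ⟨s', v, -, -, rfl⟩, rfl⟩
    simpa using hk.apply (s' ⊙ v) s x y
  exact IsDerSnd.ext (hd.whiskerRight (S ◁ mul)) (isDerSnd_leibnizFst (B := T M) i j hX hY)
    (hn _ hA) (hn _ hM)

/-- A derivation in the first variable is a derivation in the second variable, if it is one on the
generators. -/
theorem isDerSnd_of_isDerFst {f : (S ⊗ TX M) ⊗ (S ⊗ TX M) ⟶ (S ⊗ TX M) ⊗ TX M}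
    (hf : IsDerFst (Tmul M) (intL S (TX M) (Tmul M)) (intR S (Tmul M) (TX M)) f)
    (hA : IsDerSnd (Tmul M) (extL S (Tmul M) (TX M)) (extR S (TX M) (Tmul M))
      ((S ◁ iA M) ▷ (S ⊗ TX M) ≫ f))
    (hM : IsDerSnd (Tmul M) (extL S (Tmul M) (TX M)) (extR S (TX M) (Tmul M))
      ((S ◁ iM M) ▷ (S ⊗ TX M) ≫ f)) :
    IsDerSnd (Tmul M) (extL S (Tmul M) (TX M)) (extR S (TX M) (Tmul M)) f := by
  have hn : ∀ {V : C} (k : V ⟶ TX M), IsDerSnd (Tmul M) (extL S (Tmul M) (TX M))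
      (extR S (TX M) (Tmul M)) ((S ◁ k) ▷ (S ⊗ TX M) ≫ f) →
      (S ◁ k) ▷ (S ⊗ (TX M ⊗ TX M)) ≫ (S ⊗ TX M) ◁ S ◁ Tmul M ≫ f =
        (S ◁ k) ▷ (S ⊗ (TX M ⊗ TX M)) ≫
          (sndOutL S (S ⊗ TX M) (TX M) (TX M) ≫ TX M ◁ f ≫ extL S (Tmul M) (TX M) +
            sndOutR S (S ⊗ TX M) (TX M) (TX M) ≫ f ▷ TX M ≫ extR S (TX M) (Tmul M)) := by
    intro V k hk
    let : Probe (TX M) := Probe.leaf _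
    let : Probe V := Probe.leaf V
    apply pure_ext
    rintro G _ _ _ ⟨_, _, ⟨s, v, -, -, rfl⟩, ⟨s', _, -, ⟨x, y, -, -, rfl⟩, rfl⟩, rfl⟩
    simpa using hk.apply (s ⊙ v) s' x y
  have h₁ : IsDerFst (Tmul M) (intL S (TX M) (Tmul M)) (intR S (Tmul M) (TX M))
      ((S ⊗ TX M) ◁ S ◁ Tmul M ≫ f) := by
    let : Probe (TX M) := Probe.leaf _
    refine isDerFst_of_pure ?_
    rintro G _ _ _ s x y ⟨s', t, -, -, rfl⟩
    simp [hf.apply]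
  have h₂ : IsDerFst (Tmul M) (intL S (TX M) (Tmul M)) (intR S (Tmul M) (TX M))
      (sndOutL S (S ⊗ TX M) (TX M) (TX M) ≫ TX M ◁ f ≫ extL S (Tmul M) (TX M) +
        sndOutR S (S ⊗ TX M) (TX M) (TX M) ≫ f ▷ TX M ≫ extR S (TX M) (Tmul M)) :=
    isDerFst_leibnizSnd (B := T M) hf
  have key := IsDerFst.ext h₁ h₂ (hn _ hA) (hn _ hM)
  let : Probe (S ⊗ TX M) := Probe.leaf _
  refine isDerSnd_of_pure fun G _ _ u s x y _ => ?_
  simpa using u ⊙ s ⊙ x ⊙ y ≫= key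

/-- A double Lie-Rinehart structure extends to an antisymmetric biderivation of `T_A(M)`. -/
theorem IsDLR.exists_bracket (h : IsDLR S M ρ b) :
    ∃ f : (S ⊗ TX M) ⊗ (S ⊗ TX M) ⟶ (S ⊗ TX M) ⊗ TX M,
      f = -((β_ (S ⊗ TX M) (S ⊗ TX M)).hom ≫ f ≫ sSwap S (TX M) (TX M)) ∧
      IsDerFst (Tmul M) (intL S (TX M) (Tmul M)) (intR S (Tmul M) (TX M)) f ∧
      RestrictsTo S M f ρ b := by
  have hB : IsBimodule (Tmul M) (extL S (Tmul M) (TX M)) (extR S (TX M) (Tmul M)) :=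
    isBimodule_ext S (T M)
  have hB' : IsBimodule (Tmul M) (intL S (TX M) (Tmul M)) (intR S (Tmul M) (TX M)) :=
    isBimodule_int S (T M)
  -- The brackets with an element of `A` and with an element of `M`, as derivations in the second
  -- variable.
  obtain ⟨DA, hDA, hAA, hAM⟩ := exists_isDerSnd hB (dA := 0) (by simp [LeibnizSnd])
    h.leibniz_AAM h.leibniz_AMA
  obtain ⟨DM, hDM, hMA, hMM⟩ := exists_isDerSnd hB h.leibniz_MAA h.leibniz_MAM h.leibniz_MMA
  have lA₁ := h.leibniz_AAM.swapNeg
  have lA₂ := h.leibniz_AMA.swapNeg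
  have lM₁ := h.leibniz_MAA.swapNeg
  have lM₂ := h.leibniz_MAM.swapNeg
  have lM₃ := h.leibniz_MMA.swapNeg
  rw [swapNeg_zero, swapNeg_valAM, ← hAA, ← hMA] at lA₁ lA₂
  rw [swapNeg_valMA, ← hAM] at lM₁ lM₂ lM₃
  rw [h.swapNeg_valMM, ← hMM] at lM₂ lM₃
  -- The Leibniz rules in the first variable hold as equalities of derivations in the second one,
  -- hence need to be checked only on generators.
  obtain ⟨f, hf, hfA, hfM⟩ := exists_isDerFst hB' (dA := DA) (dM := DM)
    (leibnizFst_ext hDA hDA hDA (by rw [hAA]; simp [LeibnizFst]) lM₁)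
    (leibnizFst_ext hDA hDM hDM lA₁ lM₂) (leibnizFst_ext hDM hDA hDM lA₂ lM₃)
  have hf₂ := isDerSnd_of_isDerFst hf (hfA ▸ hDA) (hfM ▸ hDM)
  have vAA : (S ◁ iA M ⊗ₘ S ◁ iA M) ≫ f = 0 := by
    rw [MonoidalCategory.tensorHom_def', Category.assoc, hfA, hAA]
  have vAM : (S ◁ iA M ⊗ₘ S ◁ iM M) ≫ f = valAM S M ρ := by
    rw [MonoidalCategory.tensorHom_def', Category.assoc, hfA, hAM]
  have vMA : (S ◁ iM M ⊗ₘ S ◁ iA M) ≫ f = valMA S M ρ := by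
    rw [MonoidalCategory.tensorHom_def', Category.assoc, hfM, hMA]
  have vMM : (S ◁ iM M ⊗ₘ S ◁ iM M) ≫ f = valMM S M b := by
    rw [MonoidalCategory.tensorHom_def', Category.assoc, hfM, hMM]
  refine ⟨f, ?_, hf, vAA, vMA, ?_⟩
  -- `swapNeg f` is a biderivation with the same values on generators as `f`.
  · have hn : ∀ {U V : C} (i : U ⟶ S ⊗ TX M) (j : V ⟶ S ⊗ TX M),
        (i ⊗ₘ j) ≫ swapNeg f = swapNeg ((j ⊗ₘ i) ≫ f) := by
      intro U V i j
      simp [swapNeg]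
    refine biderivation_ext hf ?_ hf₂ ?_ ?_ ?_ ?_ ?_
    · exact hf₂.swapNeg
    · exact hf.swapNeg
    · change _ = _ ≫ swapNeg f
      rw [hn, vAA, swapNeg_zero]
    · change _ = _ ≫ swapNeg f
      rw [hn, vAM, vMA, swapNeg_valMA]
    · change _ = _ ≫ swapNeg f
      rw [hn, vAM, vMA, swapNeg_valAM]
    · change _ = _ ≫ swapNeg f
      rw [hn, vMM, h.swapNeg_valMM]
  · rw [bracket_desc, vMM, valMM]

end Construction

end DLRToPoisson

/-! ### The equivalence of categories -/

section Equivalence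

set_option linter.unusedSectionVars false

variable {C : Type u} [Category.{v} C] [MonoidalCategory C] [SymmetricCategory C]
  [Preadditive C] [MonoidalPreadditive C] [HasBinaryBiproducts C]

attribute [-simp] MonoidalCategory.tensor_whiskerLeft MonoidalCategory.whiskerRight_tensor
  MonoidalCategory.whisker_assoc BraidedCategory.braiding_tensor_left_hom
  BraidedCategory.braiding_tensor_right_hom MonoidalCategory.associator_conjugation

local infixr:90 " ⊙ " => pair

variable [HasCoequalizers C] [∀ X : C, PreservesColimitsOfShape WalkingParallelPair (tensorLeft X)]
  [HasCoproductsOfShape ℕ C] [∀ X : C, PreservesColimitsOfShape (Discrete ℕ) (tensorLeft X)]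
  {A : AssocMon C} {M : ABimod A} {S : C} {ρ : (S ⊗ M.X) ⊗ (S ⊗ A.X) ⟶ (S ⊗ A.X) ⊗ A.X}
  {b : (S ⊗ M.X) ⊗ (S ⊗ M.X) ⟶ S ⊗ ((M.X ⊗ A.X) ⊞ (A.X ⊗ M.X))}

section Correspondence

theorem IsDLR.exists_isDoublePoisson {Sinv : C} (e : Sinv ⊗ S ≅ 𝟙_ C) (h : IsDLR S M ρ b) :
    ∃ f, IsDoublePoisson S (T M) f ∧ RestrictsTo S M f ρ b := by
  obtain ⟨f, ha, hf, R⟩ := h.exists_bracket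
  have hc : compatLHS S M ρ b = 0 := h.compat
  have hj : jacobiLHS S M ρ b = 0 := h.jacobi
  have hJ : doubleJacobiator S (TX M) f = 0 :=
    doubleJacobiator_eq_zero e ha hf R.jacobiator_AAA (R.jacobiator_AAM ha)
      (by rw [JacobiOn, R.jacobiator_AMM ha, hc, zero_comp])
      (by rw [JacobiOn, R.jacobiator_MMM, hj]; simp)
  have hd : (S ◁ Tmul M) ▷ (S ⊗ TX M) ≫ f =
      fstOutL S (TX M) (TX M) (S ⊗ TX M) ≫ TX M ◁ f ≫ intL S (TX M) (Tmul M) +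
      fstOutR S (TX M) (TX M) (S ⊗ TX M) ≫ f ▷ TX M ≫ intR S (Tmul M) (TX M) := by
    let : Probe (S ⊗ TX M) := Probe.leaf _
    let : Probe (TX M) := Probe.leaf _
    apply pure_ext
    rintro G _ _ _ ⟨_, v, ⟨s, _, -, ⟨x, y, -, -, rfl⟩, rfl⟩, -, rfl⟩
    simpa using hf.apply v s x y
  exact ⟨f, ⟨ha, hd, hJ⟩, R⟩

/-- A linear double Poisson bracket is determined by its restrictions. -/
theorem RestrictsTo.unique {f f' : (S ⊗ TX M) ⊗ (S ⊗ TX M) ⟶ (S ⊗ TX M) ⊗ TX M}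
    (hf : IsDoublePoisson S (T M) f) (R : RestrictsTo S M f ρ b)
    (hf' : IsDoublePoisson S (T M) f') (R' : RestrictsTo S M f' ρ b) : f = f' :=
  biderivation_ext hf.isDerFst hf'.isDerFst hf.isDerSnd hf'.isDerSnd (R.on_AA.trans R'.on_AA.symm)
    ((R.on_AM hf.antisymm).trans (R'.on_AM hf'.antisymm).symm) (R.on_MA.trans R'.on_MA.symm)
    (R.on_MM.trans R'.on_MM.symm)

end Correspondence

section Morphisms

variable {N : ABimod A} (φ : M ⟶ N)

theorem TactM_Tmap : TactM M ≫ Tmap φ = (φ.hom ⊗ₘ Tmap φ) ≫ TactM N := by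
  refine T_extL M _ ?_ fun n => ?_
  · rw [reassoc_of% iA_TactM, iM_Tmap, reassoc_of% φ.right, ← iA_TactM, ← id_tensorHom,
      ← id_tensorHom, tensorHom_comp_tensorHom_assoc, iA_Tmap, Category.id_comp,
      id_tensorHom, MonoidalCategory.tensorHom_def, Category.assoc]
  · rw [reassoc_of% iP_TactM, iP_Tmap, reassoc_of% step_powMap, ← iP_TactM, ← id_tensorHom,
      ← id_tensorHom, tensorHom_comp_tensorHom_assoc, tensorHom_comp_tensorHom_assoc, iP_Tmap,
      Category.id_comp, Category.comp_id]

theorem TactA_Tmap : TactA M ≫ Tmap φ = A.X ◁ Tmap φ ≫ TactA N := by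
  refine T_extL M _ ?_ fun n => ?_
  · rw [reassoc_of% iA_TactA, iA_Tmap, ← iA_TactA, ← whiskerLeft_comp_assoc, iA_Tmap]
  · rw [reassoc_of% iP_TactA, iP_Tmap, reassoc_of% (powMap φ n).linear, ← iP_TactA,
      ← whiskerLeft_comp_assoc, ← whiskerLeft_comp_assoc, iP_Tmap]

/-- The morphism induced by a morphism of bimodules is a morphism of algebras. -/
theorem Tmul_Tmap : Tmul M ≫ Tmap φ = (Tmap φ ⊗ₘ Tmap φ) ≫ Tmul N := by
  have hM : ∀ {G : C} [ComonObj G] [IsCommComonObj G] (m : G ⟶ M.X) (t : G ⟶ TX M),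
      (m ≫ iM M) ⊙ t ≫ Tmul M ≫ Tmap φ =
        (m ≫ iM M ≫ Tmap φ) ⊙ (t ≫ Tmap φ) ≫ Tmul N := by
    intro G _ _ m t
    rw [iM_Tmap, ← Category.assoc, mul_iM, Category.assoc, TactM_Tmap, ← Category.assoc m, mul_iM,
      pair_tensorHom_assoc]
  let : Probe (TX M) := Probe.leaf _
  refine T_extR M _ ?_ fun n => ?_
  · apply pure_ext
    rintro G _ _ _ ⟨a, t, -, -, rfl⟩
    simp [iA_Tmap, mul_iA, TactA_Tmap, reassoc_of% @mul_iA]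
  · induction n with
    | zero =>
      let : Probe (tpow M 0).X := Probe.leaf _
      apply pure_ext
      rintro G _ _ _ ⟨m, t, -, -, rfl⟩
      rw [pair_whiskerRight_assoc, pair_whiskerRight_assoc, pair_tensorHom_assoc, Category.assoc]
      exact hM m t
    | succ n ih =>
      rw [← cancel_epi (step M n ▷ TX M)]
      let : Probe (tpow M n).X := Probe.leaf _
      apply pure_ext
      rintro G _ _ _ ⟨_, t, ⟨m, p, -, -, rfl⟩, -, rfl⟩
      have h : (p ≫ iP M n) ⊙ t ≫ Tmul M ≫ Tmap φ =
          (p ≫ iP M n ≫ Tmap φ) ⊙ (t ≫ Tmap φ) ≫ Tmul N := by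
        simpa using p ⊙ t ≫= ih
      have h' := hM m (p ≫ iP M n)
      simp only [pair_whiskerRight_assoc, pair_tensorHom_assoc, Category.assoc]
      simp only [Category.assoc] at h'
      rw [← mul_iM_iP, reassoc_of% @Tmul_assoc_elem, hM, Category.assoc, h, ← Tmul_assoc_elem,
        ← h', ← reassoc_of% @mul_iM_iP]

theorem Tmap_tensor_Tmul : (Tmap φ ⊗ₘ Tmap φ) ≫ Tmul N = Tmul M ≫ Tmap φ := (Tmul_Tmap φ).symm

variable {φ} {f : (S ⊗ TX M) ⊗ (S ⊗ TX M) ⟶ (S ⊗ TX M) ⊗ TX M}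
  {g : (S ⊗ TX N) ⊗ (S ⊗ TX N) ⟶ (S ⊗ TX N) ⊗ TX N}
  {ρ' : (S ⊗ N.X) ⊗ (S ⊗ A.X) ⟶ (S ⊗ A.X) ⊗ A.X}
  {b' : (S ⊗ N.X) ⊗ (S ⊗ N.X) ⟶ S ⊗ ((N.X ⊗ A.X) ⊞ (A.X ⊗ N.X))}

theorem bracket_map {U V : C} {b : U ⟶ S ⊗ ((M.X ⊗ A.X) ⊞ (A.X ⊗ M.X))} {p : U ⟶ V}
    {b' : V ⟶ S ⊗ ((N.X ⊗ A.X) ⊞ (A.X ⊗ N.X))} {φ : M.X ⟶ N.X}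
    (h : b ≫ S ◁ biprod.map (φ ▷ A.X) (A.X ◁ φ) = p ≫ b') :
    brL S M b ≫ (S ◁ φ) ▷ A.X = p ≫ brL S N b' ∧ brR S M b ≫ (S ⊗ A.X) ◁ φ = p ≫ brR S N b' := by
  constructor
  · rw [brL, brL, ← reassoc_of% h, ← whiskerLeft_comp_assoc, biprod.map_fst]
    simp [associator_inv_naturality_middle]
  · rw [brR, brR, ← reassoc_of% h, ← whiskerLeft_comp_assoc, biprod.map_snd]
    simp [associator_inv_naturality_right]

/-- A morphism of bimodules that commutes with the anchors and the brackets induces a morphism of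
double Poisson algebras. -/
theorem RestrictsTo.isDoubleLieHom (hf : IsDoublePoisson S (T M) f) (R : RestrictsTo S M f ρ b)
    (hg : IsDoublePoisson S (T N) g) (R' : RestrictsTo S N g ρ' b')
    (hρ : (S ◁ φ.hom) ▷ (S ⊗ A.X) ≫ ρ' = ρ)
    (hb : b ≫ S ◁ biprod.map (φ.hom ▷ A.X) (A.X ◁ φ.hom) = (S ◁ φ.hom ⊗ₘ S ◁ φ.hom) ≫ b') :
    IsDoubleLieHom S f g (Tmap φ) := by
  have hf₁ : IsDerFst (Tmul M) (intL S (TX M) (Tmul M)) (intR S (Tmul M) (TX M)) f := hf.isDerFst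
  have hf₂ : IsDerSnd (Tmul M) (extL S (Tmul M) (TX M)) (extR S (TX M) (Tmul M)) f := hf.isDerSnd
  have hg₁ : IsDerFst (Tmul N) (intL S (TX N) (Tmul N)) (intR S (Tmul N) (TX N)) g := hg.isDerFst
  have hg₂ : IsDerSnd (Tmul N) (extL S (Tmul N) (TX N)) (extR S (TX N) (Tmul N)) g := hg.isDerSnd
  have hn := Tmap_tensor_Tmul φ
  have hm : ∀ {G : C} [ComonObj G] (x y : G ⟶ TX M), x ⊙ y ≫ Tmul M ≫ Tmap φ =
      (x ≫ Tmap φ) ⊙ (y ≫ Tmap φ) ≫ Tmul N := by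
    intro G _ x y
    rw [Tmul_Tmap, pair_tensorHom_assoc]
  let : Probe (TX M) := Probe.leaf _
  let : Probe (S ⊗ TX M) := Probe.leaf _
  refine biderivation_ext (l := Tmap φ ▷ _ ≫ intL S (TX N) (Tmul N))
    (r := _ ◁ Tmap φ ≫ intR S (Tmul N) (TX N)) (l' := Tmap φ ▷ _ ≫ extL S (Tmul N) (TX N))
    (r' := _ ◁ Tmap φ ≫ extR S (TX N) (Tmul N)) ?_ ?_ ?_ ?_ ?_ ?_ ?_ ?_
  · refine isDerFst_of_pure fun G _ _ v s x y _ => ?_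
    rw [← Category.assoc, hf₁.apply, Preadditive.add_comp, Category.assoc, Category.assoc,
      ← intL_natural hn, ← intR_natural hn]
    simp
  · refine isDerFst_of_pure fun G _ _ v s x y _ => ?_
    have h := hg₁.apply (v ≫ S ◁ Tmap φ) s (x ≫ Tmap φ) (y ≫ Tmap φ)
    simpa [hm] using h
  · refine isDerSnd_of_pure fun G _ _ v s x y _ => ?_
    rw [← Category.assoc, hf₂.apply, Preadditive.add_comp, Category.assoc, Category.assoc,
      ← extL_natural hn, ← extR_natural hn]
    simp
  · refine isDerSnd_of_pure fun G _ _ v s x y _ => ?_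
    have h := hg₂.apply (v ≫ S ◁ Tmap φ) s (x ≫ Tmap φ) (y ≫ Tmap φ)
    simpa [hm] using h
  · rw [reassoc_of% R.on_AA, zero_comp, tensorHom_comp_tensorHom_assoc, ← whiskerLeft_comp, iA_Tmap,
      R'.on_AA]
  · apply pure_ext
    rintro G _ _ _ ⟨u, w, -, -, rfl⟩
    rw [reassoc_of% R.on_AM hf.antisymm, pair_tensorHom_assoc, pair_tensorHom_assoc,
      Category.assoc, Category.assoc, ← whiskerLeft_comp, ← whiskerLeft_comp,
      tensorHom_comp_tensorHom, ← whiskerLeft_comp, iA_Tmap, iM_Tmap, whiskerLeft_comp,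
      ← Category.assoc w, R'.apply_AM hg.antisymm]
    simp [anchorSwap, ← hρ]
  · rw [reassoc_of% R.on_MA, tensorHom_comp_tensorHom_assoc, ← whiskerLeft_comp,
      ← whiskerLeft_comp, tensorHom_comp_tensorHom, ← whiskerLeft_comp, iA_Tmap, iM_Tmap, ← hρ,
      Category.assoc, ← R'.on_MA, ← tensorHom_id, tensorHom_comp_tensorHom_assoc,
      ← whiskerLeft_comp, Category.id_comp]
  · obtain ⟨hl, hr⟩ := bracket_map hb
    rw [← Category.assoc, R.on_MM, bracket_desc, tensorHom_comp_tensorHom_assoc, ← whiskerLeft_comp,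
      iM_Tmap,
      whiskerLeft_comp, ← tensorHom_comp_tensorHom_assoc, R'.on_MM, bracket_desc,
      Preadditive.add_comp, Preadditive.comp_add, Category.assoc, Category.assoc,
      tensorHom_comp_tensorHom, tensorHom_comp_tensorHom, ← whiskerLeft_comp, ← whiskerLeft_comp,
      iA_Tmap, iM_Tmap, ← reassoc_of% hl, ← reassoc_of% hr, ← tensorHom_id,
      ← id_tensorHom (S ⊗ A.X), tensorHom_comp_tensorHom, tensorHom_comp_tensorHom,
      ← whiskerLeft_comp, Category.id_comp,
      Category.id_comp]

end Morphisms

section Functor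

variable (S A)

theorem Tmap_restrict_map {X Y : DPFreeLin S A} (ψ : X ⟶ Y) :
    Tmap ((restrict S A).map ψ).φ = DPFreeLin.Hom.ψ ψ :=
  (Exists.choose_spec (DPFreeLin.Hom.induced ψ)).symm

instance restrict_faithful : (restrict S A).Faithful where
  map_injective {X Y} ψ ψ' h := by
    apply DPFreeLin.Hom.ext
    rw [← Tmap_restrict_map, ← Tmap_restrict_map, h]

instance restrict_full : (restrict S A).Full where
  map_surjective {X Y} g := by
    obtain ⟨ρ, b, R⟩ := X.linear
    obtain ⟨ρ', b', R'⟩ := Y.linear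
    have h₁ := DLRData.Hom.anchor g
    have h₂ := DLRData.Hom.bracket g
    change _ ≫ restrictAnchor S Y.M Y.f = restrictAnchor S X.M X.f at h₁
    change restrictBracket S X.M X.f ≫ _ = _ ≫ restrictBracket S Y.M Y.f at h₂
    rw [R.anchor_eq, R'.anchor_eq] at h₁
    rw [R.bracket_eq, R'.bracket_eq] at h₂
    refine ⟨⟨Tmap g.φ, Tmul_Tmap g.φ, R.isDoubleLieHom X.poisson Y.poisson R' h₁ h₂, g.φ, rfl⟩, ?_⟩
    apply DLRData.Hom.ext
    apply Tmap_injective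
    rw [Tmap_restrict_map]
    rfl

variable {S A}

theorem isDLR_restrict (X : DPFreeLin S A) : isDLR S A ((restrict S A).obj X) := by
  obtain ⟨ρ, b, R⟩ := X.linear
  change IsDLR S X.M (restrictAnchor S X.M X.f) (restrictBracket S X.M X.f)
  rw [R.anchor_eq, R.bracket_eq]
  exact R.isDLR X.poisson

theorem exists_restrict_eq {Sinv : C} (e : Sinv ⊗ S ≅ 𝟙_ C) (X : DLRData S A)
    (hX : isDLR S A X) : ∃ Y : DPFreeLin S A, (restrict S A).obj Y = X := by
  obtain ⟨M, ρ, b⟩ := X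
  obtain ⟨f, hf, R⟩ := IsDLR.exists_isDoublePoisson e hX
  refine ⟨⟨M, f, hf, ρ, b, R⟩, ?_⟩
  change DLRData.mk M (restrictAnchor S M f) (restrictBracket S M f) = _
  rw [R.anchor_eq, R.bracket_eq]

/-- Restriction is an equivalence from linear double Poisson brackets to double Lie-Rinehart
algebras. -/
theorem isEquivalence_lift_restrict {Sinv : C} (e : Sinv ⊗ S ≅ 𝟙_ C) :
    ((isDLR S A).lift (restrict S A) isDLR_restrict).IsEquivalence := by
  have : ((isDLR S A).lift (restrict S A) isDLR_restrict).EssSurj := ⟨fun X => by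
    obtain ⟨Y, hY⟩ := exists_restrict_eq e X.obj X.property
    exact ⟨Y, ⟨eqToIso (ObjectProperty.FullSubcategory.ext hY)⟩⟩⟩
  exact {}

theorem isUnitalDLR_restrict (η : 𝟙_ C ⟶ A.X) (X : (dpUnital S A η).FullSubcategory) :
    isUnitalDLR S A η (((dpUnital S A η).ι ⋙ restrict S A).obj X) :=
  ⟨isDLR_restrict X.obj, X.property⟩

theorem isEquivalence_lift_restrict_unital {Sinv : C} (e : Sinv ⊗ S ≅ 𝟙_ C) (η : 𝟙_ C ⟶ A.X) :
    ((isUnitalDLR S A η).lift ((dpUnital S A η).ι ⋙ restrict S A)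
      (isUnitalDLR_restrict η)).IsEquivalence := by
  have : ((dpUnital S A η).ι ⋙ restrict S A).Faithful := Functor.Faithful.comp _ _
  have : ((dpUnital S A η).ι ⋙ restrict S A).Full := Functor.Full.comp _ _
  have : ((isUnitalDLR S A η).lift ((dpUnital S A η).ι ⋙ restrict S A)
      (isUnitalDLR_restrict η)).Faithful :=
    Functor.Faithful.of_comp_iso (ObjectProperty.liftCompιIso _ _ _)
  have : ((isUnitalDLR S A η).lift ((dpUnital S A η).ι ⋙ restrict S A)
      (isUnitalDLR_restrict η)).Full :=
    Functor.Full.of_comp_faithful_iso (ObjectProperty.liftCompιIso _ _ _)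
  have : ((isUnitalDLR S A η).lift ((dpUnital S A η).ι ⋙ restrict S A)
      (isUnitalDLR_restrict η)).EssSurj := ⟨fun X => by
    obtain ⟨Y, hY⟩ := exists_restrict_eq e X.obj X.property.1
    have hη : Y.M.IsUnital η := by
      have h := X.property.2
      rw [← hY] at h
      exact h
    exact ⟨⟨Y, hη⟩, ⟨eqToIso (ObjectProperty.FullSubcategory.ext hY)⟩⟩⟩
  exact {}

end Functor

end Equivalence

end DoubleLR

/-- Linear `Σ`-double Poisson brackets on free `A`-algebras correspond to `Σ`-double Lie-Rinehart
structures over `A`. -/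
theorem mainTheorem3 {C : Type u} [Category.{v} C] [MonoidalCategory C] [SymmetricCategory C]
    [Preadditive C] [HasZeroObject C] [HasBinaryBiproducts C] [MonoidalPreadditive C]
    [HasCoequalizers C] [∀ X : C, PreservesColimitsOfShape WalkingParallelPair (tensorLeft X)]
    [HasCoproductsOfShape ℕ C] [∀ X : C, PreservesColimitsOfShape (Discrete ℕ) (tensorLeft X)]
    (S Sinv : C) (_e : Sinv ⊗ S ≅ 𝟙_ C) (A : DoubleLR.AssocMon C) :
    -- `(ρ, b)` is a double Lie-Rinehart structure on `M` iff it is the restriction of a linear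
    -- double Poisson bracket on `T_A(M)`
    (∀ (M : DoubleLR.ABimod A) (ρ : (S ⊗ M.X) ⊗ (S ⊗ A.X) ⟶ (S ⊗ A.X) ⊗ A.X)
      (b : (S ⊗ M.X) ⊗ (S ⊗ M.X) ⟶ S ⊗ ((M.X ⊗ A.X) ⊞ (A.X ⊗ M.X))),
      DoubleLR.IsDLR S M ρ b ↔
        ∃ f, DoubleLR.IsDoublePoisson S (DoubleLR.T M) f ∧ DoubleLR.RestrictsTo S M f ρ b) ∧
    -- the linear double Poisson bracket is determined by its restrictions
    (∀ (M : DoubleLR.ABimod A) (ρ : (S ⊗ M.X) ⊗ (S ⊗ A.X) ⟶ (S ⊗ A.X) ⊗ A.X)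
      (b : (S ⊗ M.X) ⊗ (S ⊗ M.X) ⟶ S ⊗ ((M.X ⊗ A.X) ⊞ (A.X ⊗ M.X)))
      (f f' : (S ⊗ DoubleLR.TX M) ⊗ (S ⊗ DoubleLR.TX M) ⟶
        (S ⊗ DoubleLR.TX M) ⊗ DoubleLR.TX M),
      DoubleLR.IsDoublePoisson S (DoubleLR.T M) f → DoubleLR.RestrictsTo S M f ρ b →
      DoubleLR.IsDoublePoisson S (DoubleLR.T M) f' → DoubleLR.RestrictsTo S M f' ρ b → f = f') ∧
    -- restriction is an equivalence of categories from linear double Poisson brackets on free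
    -- `A`-algebras to double Lie-Rinehart algebras over `A`
    (∃ h : ∀ X : DoubleLR.DPFreeLin S A,
        DoubleLR.isDLR S A ((DoubleLR.restrict S A).obj X),
      ((DoubleLR.isDLR S A).lift (DoubleLR.restrict S A) h).IsEquivalence) ∧
    -- if `A` is unital, the same holds for unital bimodules
    (∀ η : 𝟙_ C ⟶ A.X, A.IsUnit η →
      ∃ h : ∀ X : (DoubleLR.dpUnital S A η).FullSubcategory,
          DoubleLR.isUnitalDLR S A η
            (((DoubleLR.dpUnital S A η).ι ⋙ DoubleLR.restrict S A).obj X),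
        ((DoubleLR.isUnitalDLR S A η).lift
          ((DoubleLR.dpUnital S A η).ι ⋙ DoubleLR.restrict S A) h).IsEquivalence) := by
  exact ⟨fun M ρ b => ⟨fun h => h.exists_isDoublePoisson _e, fun ⟨_, hf, R⟩ => R.isDLR hf⟩,
    fun M ρ b f f' hf R hf' R' => R.unique hf hf' R',
    ⟨DoubleLR.isDLR_restrict, DoubleLR.isEquivalence_lift_restrict _e⟩,
    fun η _ => ⟨DoubleLR.isUnitalDLR_restrict η,
      DoubleLR.isEquivalence_lift_restrict_unital _e η⟩⟩
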